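/- **Theorem.** Let $n\ge 1$, $s\in(0,1)$ and $a=1-2s$. Write $X=(x,x_{n+1})\in\mathbb R^n\times\mathbb R$, $\mathbb R^{n+1}_+=\{x_{n+1}>0\}$, $\nabla=\nabla_X$, $\operatorname{div}=\operatorname{div}_X$, and put $$\widetilde{\mathcal H}_s=x_{n+1}^a\partial_t+\operatorname{div}(x_{n+1}^a\nabla),\qquad G(X,t)=t^{-\frac{n+1+a}{2}}e^{-\frac{|X|^2}{4t}},\qquad \theta_s(t)=t^s\Big(\log\frac1t\Big)^{1+s}.$$ For $\lambda>0$ let $\sigma_s$ be the solution on $[0,1/\lambda)$ of $$\frac{d}{dt}\log\Big(\frac{\sigma_s}{t\sigma_s'}\Big)=\frac{\theta_s(\lambda t)}{t},\qquad \sigma_s(0)=0,\quad \sigma_s'(0)=1,$$ with $\sigma_s,\sigma_s'>0$ on $(0,1/\lambda)$. For $V\in C^1(Q_5)$, $Q_5=\{|x|<5\}\times[0,25)$, put $$\|V\|_1=1+\sup_{Q_5}|V|+\sup_{Q_5}|\nabla_xV|+\sup_{Q_5}|\partial_tV|\in[1,\infty].$$ There are constants $M>0$ and $\delta_0\in(0,1]$,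 depending only on $n$ and $s$, such that the following holds for all $V\in C^1(Q_5)$, all $\delta\in(0,\delta_0)$ and all $$\alpha\ge M\big(1+\|V\|_1^{1/2s}\big).$$ Let $\lambda=\alpha/\delta^2$, $0<c\le\frac1{5\lambda}$, and let $w$ be a real function on $\{x_{n+1}\ge0,\ t>0\}$ such that * $w$ is $C^\infty$ in $\{x_{n+1}>0,\ t>0\}$, and $w,\ \nabla_xw,\ \partial_tw,\ x_{n+1}^a\partial_{x_{n+1}}w$ are continuous up to $\{x_{n+1}=0\}$ for $t>0$; * there is $T<\frac1{e\lambda}$ such that $w(X,t)=0$ unless $|X|\le4$ and $t\le T$; * $\lim_{x_{n+1}\to0^+}x_{n+1}^a\,\partial_{x_{n+1}}w(x,x_{n+1},t)=V(x,t)\,w(x,0,t)$ for all $x\in\mathbb R^n$, $t>0$ (both sides being $0$ when $w$ vanishes near $(x,0,t)$). Then $$\begin{aligned} &\alpha^2\int_{\mathbb R^{n+1}_+\times[c,\infty)}x_{n+1}^a\sigma_s^{-2\alpha}(t)\,w^2\,G\,dX\,dt+\alpha\int_{\mathbb R^{n+1}_+\times[c,\infty)}x_{n+1}^a\sigma_s^{1-2\alpha}(t)\,|\nabla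 w|^2\,G\,dX\,dt\\ &\le M\int_{\mathbb R^{n+1}_+\times[c,\infty)}\sigma_s^{1-2\alpha}(t)\,x_{n+1}^{-a}\,|\widetilde{\mathcal H}_sw|^2\,G\,dX\,dt\\ &\quad+\sigma_s^{-2\alpha}(c)\Big\{-\frac cM\int_{\mathbb R^{n+1}_+}x_{n+1}^a|\nabla w(X,c)|^2G(X,c)\,dX+M\alpha\int_{\mathbb R^{n+1}_+}x_{n+1}^a|w(X,c)|^2G(X,c)\,dX\Big\}, \end{aligned}$$ where all integrals except possibly that of $|\widetilde{\mathcal H}_sw|^2$ are finite; if that one is infinite, the right-hand side is $+\infty$. -/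

import Mathlib

open Set Filter Topology MeasureTheory
open scoped ENNReal ContDiff

noncomputable section

namespace ThinCarleman

/-- Points `X = (x, y)` of `ℝⁿ × ℝ`; the last coordinate `y` plays the role of `x_{n+1}`. The
product carries the sup norm, so Euclidean lengths are always written through `normSq`. -/
abbrev Space (n : ℕ) : Type := EuclideanSpace ℝ (Fin n) × ℝ

/-- Space-time points `(X, t)`. -/
abbrev SpaceTime (n : ℕ) : Type := Space n × ℝ

/-- The squared Euclidean length `|X|² = |x|² + y²`. -/
def normSq {n : ℕ} (X : Space n) : ℝ := ‖X.1‖ ^ 2 + X.2 ^ 2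

/-- The open thick half-space `ℝⁿ⁺¹₊ = {y > 0}`. -/
def upperHalf (n : ℕ) : Set (Space n) := {X | 0 < X.2}

/-- The thick half-space including its thin boundary, `{y ≥ 0}`. -/
def upperHalfClosed (n : ℕ) : Set (Space n) := {X | 0 ≤ X.2}

/-- `∂_{x_i}`, for `i = 1, …, n`. -/
def dx {n : ℕ} (i : Fin n) (w : SpaceTime n → ℝ) (p : SpaceTime n) : ℝ :=
  fderiv ℝ w p ((EuclideanSpace.single i 1, 0), 0)

/-- `∂_{x_{n+1}}`. -/
def dy {n : ℕ} (w : SpaceTime n → ℝ) (p : SpaceTime n) : ℝ :=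
  fderiv ℝ w p ((0, 1), 0)

/-- `∂_t`. -/
def dt {n : ℕ} (w : SpaceTime n → ℝ) (p : SpaceTime n) : ℝ :=
  fderiv ℝ w p (0, 1)

/-- `|∇w|²`, the squared length of the gradient in `X = (x, x_{n+1})`. -/
def gradSq {n : ℕ} (w : SpaceTime n → ℝ) (p : SpaceTime n) : ℝ :=
  (∑ i, dx i w p ^ 2) + dy w p ^ 2

/-- The backward extension operator `x_{n+1}^a ∂_t w + div (x_{n+1}^a ∇w)`. -/
def extOp {n : ℕ} (a : ℝ) (w : SpaceTime n → ℝ) (p : SpaceTime n) : ℝ :=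
  p.1.2 ^ a * dt w p +
    ((∑ i, dx i (fun q => q.1.2 ^ a * dx i w q) p) + dy (fun q => q.1.2 ^ a * dy w q) p)

/-- The Gaussian `G(X, t) = t^{-(n+1+a)/2} exp (-|X|² / (4t))`. -/
def gauss {n : ℕ} (a : ℝ) (p : SpaceTime n) : ℝ :=
  1 / p.2 ^ (((n : ℝ) + 1 + a) / 2) * Real.exp (-normSq p.1 / (4 * p.2))

/-- `θ_s(t) = t^s (log (1/t))^{1+s}`. -/
def theta (s t : ℝ) : ℝ := t ^ s * Real.log (1 / t) ^ (1 + s)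

/-- `σ` solves `d/dt log (σ / (t σ')) = θ_s(λt) / t` on `0 < t < 1/λ`, with `σ(0) = 0` and
(one-sided) `σ'(0) = 1`. Positivity of `σ` and `σ'` makes the logarithm meaningful. Nothing is
said about `σ` outside `[0, 1/λ)`, where `θ_s(λt)` has no meaning. -/
structure IsCarlemanWeight (s lam : ℝ) (σ : ℝ → ℝ) : Prop where
  zero : σ 0 = 0
  deriv_zero : HasDerivWithinAt σ 1 (Ici 0) 0
  pos : ∀ t ∈ Ioo 0 (1 / lam), 0 < σ t
  deriv_pos : ∀ t ∈ Ioo 0 (1 / lam), 0 < deriv σ t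
  ode : ∀ t ∈ Ioo 0 (1 / lam),
    HasDerivAt (fun u => Real.log (σ u / (u * deriv σ u))) (theta s (lam * t) / t) t

/-- The thin cylinder `Q_5 = B_5 × [0, 25)` in `ℝⁿ × ℝ`. -/
def Q5 (n : ℕ) : Set (EuclideanSpace ℝ (Fin n) × ℝ) := Metric.ball 0 5 ×ˢ Ico 0 25

/-- `‖V‖_1 = 1 + sup |V| + sup |∇_x V| + sup |∂_t V|`, suprema over `Q_5`, with values in
`[0, ∞]`. (The operator norm of the `x`-derivative is the Euclidean length of `∇_x V`.) -/
def potNorm {n : ℕ} (V : EuclideanSpace ℝ (Fin n) × ℝ → ℝ) : ℝ≥0∞ :=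
  1 + (⨆ p ∈ Q5 n, ‖V p‖ₑ)
    + (⨆ p ∈ Q5 n, ‖(fderivWithin ℝ V (Q5 n) p).comp (ContinuousLinearMap.inl ℝ _ _)‖ₑ)
    + (⨆ p ∈ Q5 n, ‖fderivWithin ℝ V (Q5 n) p (0, 1)‖ₑ)

/-- `f`, given on `{y > 0, t > 0}`, extends continuously to `{y ≥ 0, t > 0}`. -/
def ExtendsToThin {n : ℕ} (f : SpaceTime n → ℝ) : Prop :=
  ∃ g : SpaceTime n → ℝ, ContinuousOn g (upperHalfClosed n ×ˢ Ioi 0) ∧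
    EqOn f g (upperHalf n ×ˢ Ioi 0)

/-- The test functions: smooth in `{y > 0, t > 0}`; `w`, `∇_x w`, `∂_t w` and
`y^a ∂_y w` are continuous up to `{y = 0}`; compactly supported in the closed half-ball
`|X| ≤ 4, y ≥ 0` in space and in `[0, T₀)` in time (that is, `w = 0` for `t > T`, some `T < T₀`);
and `lim_{y → 0+} y^a ∂_y w = V w` on `{y = 0}`. No behaviour as `t → 0+` is prescribed.
Only the values of `w` on `{y ≥ 0, t > 0}` are relevant. -/
structure IsTestFunction {n : ℕ} (a T₀ : ℝ) (V : EuclideanSpace ℝ (Fin n) × ℝ → ℝ)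
    (w : SpaceTime n → ℝ) : Prop where
  smooth : ContDiffOn ℝ ∞ w (upperHalf n ×ˢ Ioi 0)
  cont : ContinuousOn w (upperHalfClosed n ×ˢ Ioi 0)
  cont_dx : ∀ i, ExtendsToThin (dx i w)
  cont_dt : ExtendsToThin (dt w)
  cont_flux : ExtendsToThin (fun p => p.1.2 ^ a * dy w p)
  support : ∃ T < T₀, ∀ p ∈ upperHalfClosed n ×ˢ Ioi 0, w p ≠ 0 → normSq p.1 ≤ 4 ^ 2 ∧ p.2 ≤ T
  robin : ∀ (x : EuclideanSpace ℝ (Fin n)) (t : ℝ), 0 < t →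
    Tendsto (fun y : ℝ => y ^ a * dy w ((x, y), t)) (𝓝[>] 0) (𝓝 (V (x, t) * w ((x, 0), t)))

/-- The primitive from `0` of a function with an integrable power singularity at `0`. -/
theorem primitive_of_power_bound {f : ℝ → ℝ} {b C r : ℝ} (hr : 0 < r)
    (hf : ContinuousOn f (Ioo 0 b)) (hb : ∀ t ∈ Ioo 0 b, |f t| ≤ C * t ^ (r - 1))
    {t : ℝ} (ht : t ∈ Ioo 0 b) :
    HasDerivAt (fun u => ∫ v in (0 : ℝ)..u, f v) (f t) t ∧
      |∫ v in (0 : ℝ)..t, f v| ≤ C / r * t ^ r := by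
  have hpow : IntervalIntegrable (fun v : ℝ => C * v ^ (r - 1)) volume 0 t :=
    (intervalIntegral.intervalIntegrable_rpow' (by linarith)).const_mul C
  have hsub : Ioc 0 t ⊆ Ioo 0 b := fun v hv => ⟨hv.1, hv.2.trans_lt ht.2⟩
  have hint : IntervalIntegrable f volume 0 t := by
    refine hpow.mono_fun' ?_ ?_
    · rw [uIoc_of_le ht.1.le]
      exact (hf.mono hsub).aestronglyMeasurable measurableSet_Ioc
    · rw [uIoc_of_le ht.1.le]
      exact (ae_restrict_mem measurableSet_Ioc).mono fun v hv => hb v (hsub hv)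
  refine ⟨?_, ?_⟩
  · refine intervalIntegral.integral_hasDerivAt_right hint ?_ ?_
    · exact hf.stronglyMeasurableAtFilter isOpen_Ioo t ht
    · exact hf.continuousAt (isOpen_Ioo.mem_nhds ht)
  · have h1 : ‖∫ v in (0 : ℝ)..t, f v‖ ≤ ∫ v in (0 : ℝ)..t, C * v ^ (r - 1) := by
      refine intervalIntegral.norm_integral_le_of_norm_le ht.1.le ?_ hpow
      exact Eventually.of_forall fun v hv => hb v (hsub hv)
    rw [intervalIntegral.integral_const_mul, integral_rpow (Or.inl (by linarith))] at h1
    have h2 : r - 1 + 1 = r := by ring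
    rw [h2, Real.zero_rpow hr.ne', sub_zero] at h1
    calc _ ≤ _ := h1
      _ = _ := by ring

theorem theta_bound {s lam : ℝ} (hs : 0 < s) (hl : 0 < lam) :
    ∃ C : ℝ, ∀ t ∈ Ioo 0 (1 / lam), |theta s (lam * t) / t| ≤ C * t ^ (s / 2 - 1) := by
  set e : ℝ := s / (2 * (1 + s)) with he
  have hepos : 0 < e := by positivity
  refine ⟨lam ^ (s / 2) * (1 / e) ^ (1 + s), fun t ht => ?_⟩
  have htpos : 0 < t := ht.1
  have hx : 0 < lam * t := mul_pos hl htpos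
  have hx1 : lam * t < 1 := by
    have := ht.2
    rw [lt_div_iff₀ hl] at this
    linarith
  have hlog : 0 ≤ Real.log (1 / (lam * t)) :=
    Real.log_nonneg (by rw [le_div_iff₀ hx]; linarith)
  have hlog2 : Real.log (1 / (lam * t)) ≤ (1 / (lam * t)) ^ e / e :=
    Real.log_le_rpow_div (by positivity) hepos
  have hθ : 0 ≤ theta s (lam * t) := by unfold theta; positivity
  have hub : theta s (lam * t) ≤ (lam * t) ^ (s / 2) * (1 / e) ^ (1 + s) := by
    unfold theta
    have h1 : Real.log (1 / (lam * t)) ^ (1 + s) ≤ ((1 / (lam * t)) ^ e / e) ^ (1 + s) :=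
      Real.rpow_le_rpow hlog hlog2 (by linarith)
    have h2 : ((1 / (lam * t)) ^ e / e) ^ (1 + s)
        = (lam * t) ^ (-(s / 2)) * (1 / e) ^ (1 + s) := by
      rw [div_eq_mul_one_div, Real.mul_rpow (by positivity) (by positivity), one_div (lam * t),
        Real.inv_rpow hx.le, ← Real.rpow_neg hx.le, ← Real.rpow_mul hx.le]
      congr 2
      rw [he]; field_simp
    rw [h2] at h1
    calc _ ≤ (lam * t) ^ s * ((lam * t) ^ (-(s / 2)) * (1 / e) ^ (1 + s)) := by gcongr
      _ = _ := by
        rw [← mul_assoc, ← Real.rpow_add hx]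
        congr 2; ring
  rw [abs_of_nonneg (by positivity), div_le_iff₀ htpos]
  calc _ ≤ _ := hub
    _ = _ := by
      rw [Real.mul_rpow hl.le htpos.le, mul_assoc _ (t ^ (s / 2 - 1)), Real.rpow_sub_one htpos.ne']
      field_simp

/-- The weight exists. -/
theorem exists_isCarlemanWeight {s lam : ℝ} (hs : 0 < s) (hl : 0 < lam) :
    ∃ σ, IsCarlemanWeight s lam σ := by
  obtain ⟨C, hC⟩ := theta_bound hs hl
  set b : ℝ := 1 / lam with hb
  set f : ℝ → ℝ := fun t => theta s (lam * t) / t with hf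
  set h : ℝ → ℝ := fun t => ∫ v in (0 : ℝ)..t, f v with hh
  set g : ℝ → ℝ := fun t => (Real.exp (-h t) - 1) / t with hg
  set k : ℝ → ℝ := fun t => ∫ v in (0 : ℝ)..t, g v with hk
  have hr : 0 < s / 2 := by positivity
  have hb1 : ∀ t ∈ Ioo 0 b, 0 < lam * t ∧ lam * t < 1 := fun t ht => by
    refine ⟨mul_pos hl ht.1, ?_⟩
    have := ht.2
    rw [hb, lt_div_iff₀ hl] at this
    linarith
  have hfc : ContinuousOn f (Ioo 0 b) := by
    intro t ht
    obtain ⟨h1, h2⟩ := hb1 t ht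
    have hne : (1 / (lam * t)) ≠ 0 := by positivity
    refine ContinuousAt.continuousWithinAt ?_
    have hc : ContinuousAt (fun t : ℝ => lam * t) t := by fun_prop
    refine ContinuousAt.div ?_ continuousAt_id ht.1.ne'
    refine (hc.rpow_const (Or.inl h1.ne')).mul ?_
    refine ContinuousAt.rpow_const ?_ (Or.inr (by linarith))
    exact (continuousAt_const.div hc h1.ne').log hne
  have hf0 : ∀ t ∈ Ioo 0 b, 0 ≤ f t := fun t ht => by
    obtain ⟨h1, h2⟩ := hb1 t ht
    have hlog : 0 ≤ Real.log (1 / (lam * t)) :=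
      Real.log_nonneg (by rw [le_div_iff₀ h1]; linarith)
    have := ht.1
    simp only [hf, theta]
    positivity
  have hH := fun t ht => primitive_of_power_bound hr hfc hC (t := t) ht
  have hh0 : ∀ t ∈ Ioo 0 b, 0 ≤ h t := fun t ht => by
    refine intervalIntegral.integral_nonneg_of_ae_restrict ht.1.le ?_
    have h0 : ∀ᵐ v ∂(volume : Measure ℝ), v ≠ 0 := by simp [ae_iff]
    filter_upwards [ae_restrict_mem measurableSet_Icc, ae_restrict_of_ae h0] with v hv hv0
    exact hf0 v ⟨lt_of_le_of_ne hv.1 (Ne.symm hv0), hv.2.trans_lt ht.2⟩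
  have hgc : ContinuousOn g (Ioo 0 b) := fun t ht =>
    (((Real.continuous_exp.continuousAt.comp (hH t ht).1.continuousAt.neg).sub
      continuousAt_const).div continuousAt_id ht.1.ne').continuousWithinAt
  have hgb : ∀ t ∈ Ioo 0 b, |g t| ≤ C / (s / 2) * t ^ (s / 2 - 1) := fun t ht => by
    have h1 : |Real.exp (-h t) - 1| ≤ h t := by
      rw [abs_le]
      have := Real.add_one_le_exp (-h t)
      have h2 : Real.exp (-h t) ≤ 1 := Real.exp_le_one_iff.2 (by linarith [hh0 t ht])
      constructor <;> linarith [hh0 t ht]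
    have h3 : h t ≤ C / (s / 2) * t ^ (s / 2) := (le_abs_self _).trans (hH t ht).2
    have htp := ht.1
    simp only [hg]
    rw [abs_div, abs_of_pos htp, Real.rpow_sub_one htp.ne', ← mul_div_assoc]
    gcongr
    exact h1.trans h3
  have hK := fun t ht => primitive_of_power_bound hr hgc hgb (t := t) ht
  set σ : ℝ → ℝ := fun t => t * Real.exp (k t) with hσ
  have hd : ∀ t ∈ Ioo 0 b, HasDerivAt σ (Real.exp (k t) * Real.exp (-h t)) t := fun t ht => by
    have h1 := (hasDerivAt_id t).mul (hK t ht).1.exp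
    refine h1.congr_deriv ?_
    have := ht.1.ne'
    simp only [id, hg]
    field_simp
    ring
  refine ⟨σ, ⟨by simp [hσ], ?_, ?_, ?_, ?_⟩⟩
  · rw [hasDerivWithinAt_iff_tendsto_slope]
    have hb0 : 0 < b := by positivity
    have hk0 : Tendsto k (𝓝[>] 0) (𝓝 0) := by
      have h0 : Tendsto (fun t : ℝ => C / (s / 2) / (s / 2) * t ^ (s / 2)) (𝓝[>] 0) (𝓝 0) := by
        have : ContinuousAt (fun t : ℝ => C / (s / 2) / (s / 2) * t ^ (s / 2)) 0 :=
          (continuousAt_id.rpow_const (Or.inr hr.le)).const_mul _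
        have h2 := this.tendsto
        simp only [Real.zero_rpow hr.ne', mul_zero] at h2
        exact h2.mono_left nhdsWithin_le_nhds
      refine squeeze_zero_norm' ?_ h0
      filter_upwards [Ioo_mem_nhdsGT hb0] with t ht using (hK t ht).2
    have hset : Ici (0 : ℝ) \ {0} = Ioi 0 := by
      ext x; simp [lt_iff_le_and_ne, eq_comm]
    rw [hset]
    have h1 : Tendsto (fun t => Real.exp (k t)) (𝓝[>] 0) (𝓝 1) := by
      simpa [Function.comp_def] using (Real.continuous_exp.tendsto 0).comp hk0
    refine h1.congr' ?_
    filter_upwards [self_mem_nhdsWithin] with t ht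
    have : t ≠ 0 := (mem_Ioi.1 ht).ne'
    simp [slope, hσ, this]
  · intro t ht
    exact mul_pos ht.1 (Real.exp_pos _)
  · intro t ht
    rw [(hd t ht).deriv]
    positivity
  · intro t ht
    refine (hH t ht).1.congr_of_eventuallyEq ?_
    filter_upwards [isOpen_Ioo.mem_nhds ht] with u hu
    have hu0 := hu.1.ne'
    have e1 : σ u / (u * deriv σ u) = Real.exp (h u) := by
      rw [(hd u hu).deriv]
      simp only [hσ]
      rw [Real.exp_neg]
      field_simp
    rw [e1, Real.log_exp]

end ThinCarleman

end

/-! Write `y` for the last coordinate, `ρ = y^a G`, `D = ∂_t + (X/2t)·∇`, `g = tσ'/σ` (`logSlope`),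
`b = αg/t` (`dampCoeff`), `Θ(t) = θ_s(λt)` and `m = t g^{-1/2} σ^{-2α}` (`multCoeff`). The
space-time field `ρ(X/2t, 1)` is divergence free, so `ρ` is invariant under the parabolic scaling
that `D` generates.

In the interior, `y^{-a} H̃_s w` splits as `A + S` with `A = Dw - bw` and `S = y^{-a} div(y^a ∇w) -
(X/2t)·∇w + bw`; the second-order part of `S` is symmetric with respect to `ρ`. Hence `m(A + S)² ≥
2mAS`, and `2mAS ρ` is an exact divergence plus a zeroth-order form in `w` and `∇w`. The commutator
of `D` with `∇` and the equations for `b` and `m` make that form equal to `(mΘ/2t) ρ (|∇w|² + b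
w²)`. This is `pointwise_carleman`; the convexity of the weight, encoded in `Θ`, is the whole gain.

The identity is integrated over `{y > ε, t ≥ c}`, where `w` is smooth (`integral_carleman_level`).
The slice `t = c` contributes the energy `m(b w² - |∇w|²)`. The level `y = ε` contributes a normal
flux which, by the Robin condition, tends to `2m (D'w - bw) V w` times the thin Gaussian, where `D'`
is the tangential part of `D`. The dangerous terms `D'w` and `bw` disappear on integrating by parts
along the level: `m V w²` is differentiated along `D'`, and the equation for `m` reproduces the term
with `b` exactly. What remains is at most a multiple of `‖V‖_1 (m/t) w²` on the level, plus a term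
at `t = c` (`integral_thinFlux_le`).

A weighted trace inequality at the scale `√(t/α)` (`trace_line`, `trace_slice`) bounds the Gaussian
integral of `w²` on the level by `C (t/α)^s ∫ ρ(|∇w|² + (α/t) w²)`. Since `α^{2s}` dominates
`‖V‖_1`, one has `‖V‖_1 (t/α)^s ≲ (αt)^s ≤ (λt)^s ≤ Θ(t)` on the support of `w`, because `θ_s(x) ≥
x^s` for `x ≤ 1/e`. So half of the gain absorbs the boundary remainder (`carleman_level`). This
balance is the source of the exponent `1/2s`.

Finally `ε → 0`: the flux error vanishes by dominated convergence (`tendsto_fluxError`) and the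
other integrals converge by exhaustion. Bounds on `g` and `σ/t` depending on `s` alone
(`exists_weight_bounds`) turn `m`, `b` and `Θ` into the powers of `σ` in the statement. -/

namespace ThinCarleman

/-! ### Bounds on the Carleman weight that are uniform in `λ`. -/

theorem theta_nonneg {s x : ℝ} (hx : x ∈ Ioo (0 : ℝ) 1) : 0 ≤ theta s x := by
  have hlog : 0 ≤ Real.log (1 / x) :=
    Real.log_nonneg (by rw [le_div_iff₀ hx.1]; linarith [hx.2])
  have := hx.1
  unfold theta
  positivity

/-- Half of the power of `x` absorbs the logarithm. The bound is taken at `λ = 1`, so that the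
constant depends on `s` only; the remaining power makes `θ_s(λt)/t` integrable at `0`. -/
theorem exists_theta_le {s : ℝ} (hs : 0 < s) :
    ∃ K : ℝ, 0 < K ∧ ∀ x ∈ Ioo (0 : ℝ) 1, theta s x ≤ K * x ^ (s / 2) := by
  obtain ⟨C, hC⟩ := theta_bound hs one_pos
  refine ⟨max C 1, by positivity, fun x hx => ?_⟩
  have h := hC x (by simpa using hx)
  have hx0 := hx.1
  rw [one_mul, abs_of_nonneg (div_nonneg (theta_nonneg hx) hx0.le), div_le_iff₀ hx0, mul_assoc,
    Real.rpow_sub_one hx0.ne', div_mul_cancel₀ _ hx0.ne'] at h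
  exact h.trans (by gcongr; exact le_max_left _ _)

/-- The logarithm is at least `1` when `x ≤ 1/e`. This is why `w` has to vanish from some time
before `1/(eλ)` on. -/
theorem rpow_le_theta {s x : ℝ} (hs : 0 < s) (hx : 0 < x) (hx' : x ≤ 1 / Real.exp 1) :
    x ^ s ≤ theta s x := by
  have hlog : 1 ≤ Real.log (1 / x) := by
    rw [Real.le_log_iff_exp_le (by positivity), le_div_iff₀ hx]
    rwa [le_div_iff₀ (Real.exp_pos 1), mul_comm] at hx'
  have := Real.one_le_rpow hlog (by linarith : 0 ≤ 1 + s)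
  unfold theta
  exact le_mul_of_one_le_right (by positivity) this

theorem monotoneOn_Ioo_of_hasDerivAt {f f' : ℝ → ℝ} {u v : ℝ}
    (h : ∀ t ∈ Ioo u v, HasDerivAt f (f' t) t) (h0 : ∀ t ∈ Ioo u v, 0 ≤ f' t) :
    MonotoneOn f (Ioo u v) := by
  refine monotoneOn_of_deriv_nonneg (convex_Ioo u v)
    (fun t ht => (h t ht).continuousAt.continuousWithinAt) ?_ ?_ <;> rw [interior_Ioo]
  · exact fun t ht => (h t ht).differentiableAt.differentiableWithinAt
  · exact fun t ht => by rw [(h t ht).deriv]; exact h0 t ht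

/-- The device by which the initial conditions of the weight are used: if `logSlope` stayed away
from the correct side of `1` near `0`, integration would make `log (σ/t)` diverge logarithmically,
whereas it tends to `0`. -/
theorem not_le_log_of_tendsto {L : ℝ → ℝ} {l η C B : ℝ} (hη : 0 < η) (hB : 0 < B)
    (hL : Tendsto L (𝓝[>] 0) (𝓝 l)) (h : ∀ t ∈ Ioo 0 B, L t ≤ C + η * Real.log t) : False := by
  have h1 : Tendsto (fun t => C + η * Real.log t) (𝓝[>] 0) atBot :=
    tendsto_atBot_add_const_left _ _ (Real.tendsto_log_nhdsGT_zero.const_mul_atBot hη)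
  have h2 : Tendsto L (𝓝[>] 0) atBot := by
    refine tendsto_atBot_mono' _ ?_ h1
    filter_upwards [Ioo_mem_nhdsGT hB] with t ht using h t ht
  exact not_tendsto_nhds_of_tendsto_atBot h2 _ hL

/-- The logarithmic derivative `t σ' / σ`. -/
noncomputable def logSlope (σ : ℝ → ℝ) (t : ℝ) : ℝ := t * deriv σ t / σ t

namespace IsCarlemanWeight

variable {s lam : ℝ} {σ : ℝ → ℝ}

theorem logSlope_pos (h : IsCarlemanWeight s lam σ) {t : ℝ} (ht : t ∈ Ioo 0 (1 / lam)) :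
    0 < logSlope σ t :=
  div_pos (mul_pos ht.1 (h.deriv_pos t ht)) (h.pos t ht)

theorem hasDerivAt (h : IsCarlemanWeight s lam σ) {t : ℝ} (ht : t ∈ Ioo 0 (1 / lam)) :
    HasDerivAt σ (logSlope σ t * σ t / t) t := by
  have h1 := (differentiableAt_of_deriv_ne_zero (h.deriv_pos t ht).ne').hasDerivAt
  refine h1.congr_deriv ?_
  have := (h.pos t ht).ne'
  have := ht.1.ne'
  unfold logSlope
  field_simp

theorem hasDerivAt_log_logSlope (h : IsCarlemanWeight s lam σ) {t : ℝ}
    (ht : t ∈ Ioo 0 (1 / lam)) :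
    HasDerivAt (fun u => Real.log (logSlope σ u)) (-(theta s (lam * t) / t)) t := by
  refine (h.ode t ht).neg.congr_of_eventuallyEq (Eventually.of_forall fun u => ?_)
  simp only [Pi.neg_apply]
  rw [← Real.log_inv, inv_div, logSlope]

theorem hasDerivAt_logSlope (h : IsCarlemanWeight s lam σ) {t : ℝ}
    (ht : t ∈ Ioo 0 (1 / lam)) :
    HasDerivAt (logSlope σ) (-(theta s (lam * t) / t) * logSlope σ t) t := by
  have h1 := (h.hasDerivAt_log_logSlope ht).exp
  rw [Real.exp_log (h.logSlope_pos ht), mul_comm] at h1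
  refine h1.congr_of_eventuallyEq ?_
  filter_upwards [isOpen_Ioo.mem_nhds ht] with u hu
  rw [Real.exp_log (h.logSlope_pos hu)]

theorem hasDerivAt_log_div (h : IsCarlemanWeight s lam σ) {t : ℝ} (ht : t ∈ Ioo 0 (1 / lam)) :
    HasDerivAt (fun u => Real.log (σ u / u)) ((logSlope σ t - 1) / t) t := by
  have h0 := ht.1.ne'
  have h1 := h.pos t ht
  refine (((h.hasDerivAt ht).div (hasDerivAt_id t) h0).log (div_pos h1 ht.1).ne').congr_deriv ?_
  have := h1.ne'
  simp only [id, Pi.div_apply]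
  field_simp

/-- Since `σ(0) = 0`, the quotient `σ(u)/u` is the slope at `0`, which tends to `σ'(0) = 1`. -/
theorem tendsto_log_div (h : IsCarlemanWeight s lam σ) :
    Tendsto (fun u => Real.log (σ u / u)) (𝓝[>] 0) (𝓝 0) := by
  have h1 := h.deriv_zero
  rw [hasDerivWithinAt_iff_tendsto_slope] at h1
  have hset : Ici (0 : ℝ) \ {0} = Ioi 0 := by
    ext x; simp [lt_iff_le_and_ne, eq_comm]
  rw [hset] at h1
  have h2 := (Real.continuousAt_log one_ne_zero).tendsto.comp h1
  rw [Real.log_one] at h2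
  refine h2.congr fun u => ?_
  simp [slope, h.zero, div_eq_inv_mul]

theorem hasDerivAt_mul_rpow (hlam : 0 < lam) {e t : ℝ} (K : ℝ) (he : e ≠ 0) (ht : 0 < t) :
    HasDerivAt (fun u => K / e * (lam * u) ^ e) (K * (lam * t) ^ e / t) t := by
  have h1 := ((Real.hasDerivAt_rpow_const (p := e) (Or.inl (mul_pos hlam ht).ne')).comp t
    ((hasDerivAt_id t).const_mul lam)).const_mul (K / e)
  refine h1.congr_deriv ?_
  simp only [mul_one]
  rw [Real.rpow_sub_one (mul_pos hlam ht).ne']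
  field_simp

/-- `logSlope` is nonincreasing because `Θ ≥ 0`. A value above `1` at `t` would therefore persist on
all of `(0, t)`, and `log (σ/u)` would be bounded above by a constant plus a positive multiple of
`log u`. -/
theorem logSlope_le_one (hlam : 0 < lam) (h : IsCarlemanWeight s lam σ) {t : ℝ}
    (ht : t ∈ Ioo 0 (1 / lam)) : logSlope σ t ≤ 1 := by
  have hmem : ∀ u ∈ Ioo 0 (1 / lam), lam * u ∈ Ioo (0 : ℝ) 1 := fun u hu =>
    ⟨mul_pos hlam hu.1, by have := hu.2; rw [lt_div_iff₀ hlam] at this; linarith⟩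
  have hanti : MonotoneOn (fun u => -Real.log (logSlope σ u)) (Ioo 0 (1 / lam)) :=
    monotoneOn_Ioo_of_hasDerivAt (fun u hu => (h.hasDerivAt_log_logSlope hu).neg) fun u hu => by
      have := theta_nonneg (s := s) (hmem u hu)
      have := hu.1
      rw [neg_neg]; positivity
  by_contra! hlt
  have hge : ∀ u ∈ Ioo 0 t, logSlope σ t ≤ logSlope σ u := fun u hu => by
    have hu' : u ∈ Ioo 0 (1 / lam) := ⟨hu.1, hu.2.trans ht.2⟩
    have := hanti hu' ht hu.2.le
    simp only [neg_le_neg_iff] at this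
    rwa [Real.log_le_log_iff (h.logSlope_pos ht) (h.logSlope_pos hu')] at this
  have hmono : MonotoneOn (fun u => Real.log (σ u / u) - (logSlope σ t - 1) * Real.log u)
      (Ioo 0 t) := by
    refine monotoneOn_Ioo_of_hasDerivAt (fun u hu => (h.hasDerivAt_log_div
      ⟨hu.1, hu.2.trans ht.2⟩).sub ((Real.hasDerivAt_log hu.1.ne').const_mul _)) fun u hu => ?_
    have := hge u hu
    have h2 : (logSlope σ u - 1) / u - (logSlope σ t - 1) * u⁻¹
        = (logSlope σ u - logSlope σ t) / u := by ring
    rw [h2]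
    exact div_nonneg (by linarith) hu.1.le
  -- The monotonicity is known on the open interval only, so it is compared with an interior point.
  have ht2 : t / 2 ∈ Ioo 0 t := ⟨by linarith [ht.1], by linarith [ht.1]⟩
  refine not_le_log_of_tendsto (sub_pos.2 hlt) ht2.1 h.tendsto_log_div
    (C := Real.log (σ (t / 2) / (t / 2)) - (logSlope σ t - 1) * Real.log (t / 2)) fun u hu => ?_
  have := hmono ⟨hu.1, hu.2.trans ht2.2⟩ ht2 hu.2.le
  simp only at this
  linarith

/-- The function `k` is a primitive of the upper bound of `Θ/t`, so `log (logSlope) + k` is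
nondecreasing. A negative value `-η` of it would keep `logSlope` below `exp (-η) < 1` all the way to
`0`, and `log (σ/u)` would tend to `+∞`. -/
theorem exp_le_logSlope (hs : 0 < s) (hlam : 0 < lam) (h : IsCarlemanWeight s lam σ) {K : ℝ}
    (hK : ∀ x ∈ Ioo (0 : ℝ) 1, theta s x ≤ K * x ^ (s / 2)) {t : ℝ} (ht : t ∈ Ioo 0 (1 / lam)) :
    Real.exp (-(K / (s / 2) * (lam * t) ^ (s / 2))) ≤ logSlope σ t := by
  have hmem : ∀ u ∈ Ioo 0 (1 / lam), lam * u ∈ Ioo (0 : ℝ) 1 := fun u hu =>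
    ⟨mul_pos hlam hu.1, by have := hu.2; rw [lt_div_iff₀ hlam] at this; linarith⟩
  have hs2 : s / 2 ≠ 0 := by positivity
  set k : ℝ → ℝ := fun u => K / (s / 2) * (lam * u) ^ (s / 2) with hk
  have hK0 : 0 ≤ K := by
    have h1 := (theta_nonneg (s := s) (x := 1 / 2) ⟨by norm_num, by norm_num⟩).trans
      (hK (1 / 2) ⟨by norm_num, by norm_num⟩)
    exact nonneg_of_mul_nonneg_left h1 (by positivity)
  have hk0 : ∀ u ∈ Ioo 0 (1 / lam), 0 ≤ k u := fun u hu => by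
    have := (hmem u hu).1
    simp only [hk]; positivity
  have hmono : MonotoneOn (fun u => Real.log (logSlope σ u) + k u) (Ioo 0 (1 / lam)) :=
    monotoneOn_Ioo_of_hasDerivAt (fun u hu => (h.hasDerivAt_log_logSlope hu).add
      (hasDerivAt_mul_rpow hlam K hs2 hu.1)) fun u hu => by
        have := hK _ (hmem u hu)
        rw [neg_add_eq_sub, ← sub_div]
        exact div_nonneg (by linarith) hu.1.le
  by_contra! hlt
  set η := -(Real.log (logSlope σ t) + k t) with hη
  have hη0 : 0 < η := by
    have := Real.log_lt_log (h.logSlope_pos ht) hlt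
    rw [Real.log_exp] at this
    simp only [hη, hk]; linarith
  have hle : ∀ u ∈ Ioo 0 t, logSlope σ u ≤ Real.exp (-η) := fun u hu => by
    have hu' : u ∈ Ioo 0 (1 / lam) := ⟨hu.1, hu.2.trans ht.2⟩
    have h1 := hmono hu' ht hu.2.le
    simp only at h1
    rw [← Real.log_le_iff_le_exp (h.logSlope_pos hu')]
    linarith [hk0 u hu']
  have hexp : Real.exp (-η) < 1 := by simpa using hη0
  have hmono2 : MonotoneOn (fun u => -Real.log (σ u / u) - (1 - Real.exp (-η)) * Real.log u)
      (Ioo 0 t) := by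
    refine monotoneOn_Ioo_of_hasDerivAt (fun u hu => (h.hasDerivAt_log_div
      ⟨hu.1, hu.2.trans ht.2⟩).neg.sub ((Real.hasDerivAt_log hu.1.ne').const_mul _)) fun u hu => ?_
    have := hle u hu
    have h2 : -((logSlope σ u - 1) / u) - (1 - Real.exp (-η)) * u⁻¹
        = (Real.exp (-η) - logSlope σ u) / u := by ring
    rw [h2]
    exact div_nonneg (by linarith) hu.1.le
  have ht2 : t / 2 ∈ Ioo 0 t := ⟨by linarith [ht.1], by linarith [ht.1]⟩
  refine not_le_log_of_tendsto (sub_pos.2 hexp) ht2.1 h.tendsto_log_div.neg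
    (C := -Real.log (σ (t / 2) / (t / 2)) - (1 - Real.exp (-η)) * Real.log (t / 2)) fun u hu => ?_
  have := hmono2 ⟨hu.1, hu.2.trans ht2.2⟩ ht2 hu.2.le
  simp only at this
  linarith

theorem le_self (hlam : 0 < lam) (h : IsCarlemanWeight s lam σ) {t : ℝ}
    (ht : t ∈ Ioo 0 (1 / lam)) : σ t ≤ t := by
  have hmono : MonotoneOn (fun u => -Real.log (σ u / u)) (Ioo 0 (1 / lam)) :=
    monotoneOn_Ioo_of_hasDerivAt (fun u hu => (h.hasDerivAt_log_div hu).neg) fun u hu => by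
      rw [neg_nonneg]
      exact div_nonpos_of_nonpos_of_nonneg (by linarith [h.logSlope_le_one hlam hu]) hu.1.le
  have h1 : 0 ≤ -Real.log (σ t / t) := by
    refine le_of_tendsto (by simpa using h.tendsto_log_div.neg) ?_
    filter_upwards [Ioo_mem_nhdsGT ht.1] with u hu
    exact hmono ⟨hu.1, hu.2.trans ht.2⟩ ht hu.2.le
  have h2 : σ t / t ≤ 1 := by
    rw [← Real.log_nonpos_iff (div_pos (h.pos t ht) ht.1).le]; linarith
  rwa [div_le_one ht.1] at h2

/-- A second integration: `(log (σ/u))' = (logSlope - 1)/u`, the lower bound on `logSlope` is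
linearised by `1 + x ≤ exp x`, and the initial value is `0`. -/
theorem exp_mul_le (hs : 0 < s) (hlam : 0 < lam) (h : IsCarlemanWeight s lam σ) {K : ℝ}
    (hK : ∀ x ∈ Ioo (0 : ℝ) 1, theta s x ≤ K * x ^ (s / 2)) {t : ℝ} (ht : t ∈ Ioo 0 (1 / lam)) :
    Real.exp (-(K / (s / 2) / (s / 2) * (lam * t) ^ (s / 2))) * t ≤ σ t := by
  have hs2 : s / 2 ≠ 0 := by positivity
  set k : ℝ → ℝ := fun u => K / (s / 2) / (s / 2) * (lam * u) ^ (s / 2) with hk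
  have hmono : MonotoneOn (fun u => Real.log (σ u / u) + k u) (Ioo 0 (1 / lam)) :=
    monotoneOn_Ioo_of_hasDerivAt (fun u hu => (h.hasDerivAt_log_div hu).add
      (hasDerivAt_mul_rpow hlam (K / (s / 2)) hs2 hu.1)) fun u hu => by
        rw [← add_div]
        have h1 := h.exp_le_logSlope hs hlam hK hu
        have h2 := Real.add_one_le_exp (-(K / (s / 2) * (lam * u) ^ (s / 2)))
        exact div_nonneg (by linarith) hu.1.le
  have hk0 : Tendsto k (𝓝[>] 0) (𝓝 0) := by
    have h1 : ContinuousAt k 0 := by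
      refine continuousAt_const.mul (ContinuousAt.rpow_const ?_ (Or.inr (by positivity)))
      fun_prop
    have h2 := h1.tendsto
    simp only [hk, mul_zero, Real.zero_rpow hs2] at h2
    exact h2.mono_left nhdsWithin_le_nhds
  have h1 : 0 ≤ Real.log (σ t / t) + k t := by
    refine le_of_tendsto (by simpa using h.tendsto_log_div.add hk0) ?_
    filter_upwards [Ioo_mem_nhdsGT ht.1] with u hu
    exact hmono ⟨hu.1, hu.2.trans ht.2⟩ ht hu.2.le
  rw [← le_div_iff₀ ht.1, ← Real.le_log_iff_exp_le (div_pos (h.pos t ht) ht.1)]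
  simp only [hk] at h1
  linarith

end IsCarlemanWeight

/-- Bounds for the weight that depend on `s` only. -/
theorem exists_weight_bounds {s : ℝ} (hs : 0 < s) :
    ∃ Γ K : ℝ, 1 ≤ Γ ∧ 0 < K ∧ ∀ (lam : ℝ) (σ : ℝ → ℝ), 0 < lam → IsCarlemanWeight s lam σ →
      ∀ t ∈ Ioo 0 (1 / lam), 1 / Γ ≤ logSlope σ t ∧ logSlope σ t ≤ 1 ∧ t / Γ ≤ σ t ∧ σ t ≤ t ∧
        0 ≤ theta s (lam * t) ∧ theta s (lam * t) ≤ K := by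
  obtain ⟨K, hK0, hK⟩ := exists_theta_le hs
  set e1 := K / (s / 2) with he1
  set e2 := K / (s / 2) / (s / 2) with he2
  have h1 : 0 < e1 := by positivity
  have h2 : 0 < e2 := by positivity
  refine ⟨Real.exp (e1 + e2), K, Real.one_le_exp (by positivity), hK0,
    fun lam σ hlam h t ht => ?_⟩
  have hmem : lam * t ∈ Ioo (0 : ℝ) 1 :=
    ⟨mul_pos hlam ht.1, by have := ht.2; rw [lt_div_iff₀ hlam] at this; linarith⟩
  have hp : (lam * t) ^ (s / 2) ≤ 1 := Real.rpow_le_one hmem.1.le hmem.2.le (by positivity)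
  have hp0 : 0 ≤ (lam * t) ^ (s / 2) := Real.rpow_nonneg hmem.1.le _
  refine ⟨?_, h.logSlope_le_one hlam ht, ?_, h.le_self hlam ht, theta_nonneg hmem, ?_⟩
  · rw [one_div, ← Real.exp_neg]
    refine le_trans (Real.exp_le_exp.2 ?_) (h.exp_le_logSlope hs hlam hK ht)
    nlinarith
  · rw [div_eq_inv_mul, ← Real.exp_neg]
    refine le_trans (mul_le_mul_of_nonneg_right (Real.exp_le_exp.2 ?_) ht.1.le)
      (h.exp_mul_le hs hlam hK ht)
    nlinarith
  · exact (hK _ hmem).trans (mul_le_of_le_one_right hK0.le hp)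

/-! ### The time coefficients `b` and `m` and their differential equations. -/

/-- The zeroth-order coefficient `α σ' / σ`. -/
noncomputable def dampCoeff (α : ℝ) (σ : ℝ → ℝ) (t : ℝ) : ℝ := α * logSlope σ t / t

/-- The multiplier `t (t σ' / σ)^{-1/2} σ^{-2α}`. -/
noncomputable def multCoeff (α : ℝ) (σ : ℝ → ℝ) (t : ℝ) : ℝ :=
  t * logSlope σ t ^ (-(1 / 2) : ℝ) * σ t ^ (-2 * α)

namespace IsCarlemanWeight

variable {s lam : ℝ} {σ : ℝ → ℝ}

theorem hasDerivAt_dampCoeff (h : IsCarlemanWeight s lam σ) (α : ℝ) {t : ℝ}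
    (ht : t ∈ Ioo 0 (1 / lam)) :
    HasDerivAt (dampCoeff α σ) (-(dampCoeff α σ t * (1 + theta s (lam * t)) / t)) t := by
  have h0 := ht.1.ne'
  refine (((h.hasDerivAt_logSlope ht).const_mul α).div (hasDerivAt_id t) h0).congr_deriv ?_
  simp only [id, dampCoeff]
  field_simp
  ring

/-- The exponent `-1/2` of `logSlope` in `m` produces `Θ/2`, half of the `Θ` in the equation for
`b`. With this choice `|∇w|²` and `b w²` gain the same coefficient `Θ/2t`. -/
theorem hasDerivAt_multCoeff (h : IsCarlemanWeight s lam σ) (α : ℝ) {t : ℝ}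
    (ht : t ∈ Ioo 0 (1 / lam)) :
    HasDerivAt (multCoeff α σ)
      (multCoeff α σ t * ((1 + theta s (lam * t) / 2) / t - 2 * dampCoeff α σ t)) t := by
  have h0 := ht.1.ne'
  have hσ := h.pos t ht
  have hg := h.logSlope_pos ht
  refine (((hasDerivAt_id t).mul ((h.hasDerivAt_logSlope ht).rpow_const
    (p := (-(1 / 2) : ℝ)) (Or.inl hg.ne'))).mul ((h.hasDerivAt ht).rpow_const
    (p := -2 * α) (Or.inl hσ.ne'))).congr_deriv ?_
  rw [Real.rpow_sub_one hσ.ne', Real.rpow_sub_one hg.ne']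
  have := hσ.ne'
  have := hg.ne'
  simp only [id, dampCoeff, multCoeff, Pi.mul_apply]
  field_simp
  ring

theorem continuousOn_theta (hs : 0 < s) (hlam : 0 < lam) :
    ContinuousOn (fun t => theta s (lam * t)) (Ioo 0 (1 / lam)) := by
  intro t ht
  have h1 : 0 < lam * t := mul_pos hlam ht.1
  have hc : ContinuousAt (fun t : ℝ => lam * t) t := by fun_prop
  refine ContinuousAt.continuousWithinAt ((hc.rpow_const (Or.inl h1.ne')).mul
    (ContinuousAt.rpow_const ?_ (Or.inr (by linarith))))
  exact (continuousAt_const.div hc h1.ne').log (one_div_pos.2 h1).ne'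

theorem contDiffOn_one_of_hasDerivAt {f f' : ℝ → ℝ} {u v : ℝ}
    (h : ∀ t ∈ Ioo u v, HasDerivAt f (f' t) t) (hc : ContinuousOn f' (Ioo u v)) :
    ContDiffOn ℝ 1 f (Ioo u v) := by
  rw [show (1 : WithTop ℕ∞) = 0 + 1 by rfl, contDiffOn_succ_iff_deriv_of_isOpen isOpen_Ioo]
  refine ⟨fun t ht => (h t ht).differentiableAt.differentiableWithinAt, by simp, ?_⟩
  rw [contDiffOn_zero]
  exact hc.congr fun t ht => (h t ht).deriv

theorem contDiffOn_dampCoeff (hs : 0 < s) (hlam : 0 < lam) (h : IsCarlemanWeight s lam σ) (α : ℝ) :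
    ContDiffOn ℝ 1 (dampCoeff α σ) (Ioo 0 (1 / lam)) := by
  refine contDiffOn_one_of_hasDerivAt (fun t ht => h.hasDerivAt_dampCoeff α ht) ?_
  have h1 : ContinuousOn (dampCoeff α σ) (Ioo 0 (1 / lam)) := fun t ht =>
    (h.hasDerivAt_dampCoeff α ht).continuousAt.continuousWithinAt
  exact ((h1.mul (continuousOn_const.add (continuousOn_theta hs hlam))).div continuousOn_id
    fun t ht => ht.1.ne').neg

theorem contDiffOn_multCoeff (hs : 0 < s) (hlam : 0 < lam) (h : IsCarlemanWeight s lam σ) (α : ℝ) :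
    ContDiffOn ℝ 1 (multCoeff α σ) (Ioo 0 (1 / lam)) := by
  refine contDiffOn_one_of_hasDerivAt (fun t ht => h.hasDerivAt_multCoeff α ht) ?_
  have h1 : ContinuousOn (dampCoeff α σ) (Ioo 0 (1 / lam)) := fun t ht =>
    (h.hasDerivAt_dampCoeff α ht).continuousAt.continuousWithinAt
  have h2 : ContinuousOn (multCoeff α σ) (Ioo 0 (1 / lam)) := fun t ht =>
    (h.hasDerivAt_multCoeff α ht).continuousAt.continuousWithinAt
  exact h2.mul ((((continuousOn_const.add ((continuousOn_theta hs hlam).div_const 2)).div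
    continuousOn_id fun t ht => ht.1.ne')).sub (continuousOn_const.mul h1))

end IsCarlemanWeight

end ThinCarleman

/-! ### Calculus of the Gaussian weight and of the scaling field. -/

namespace ThinCarleman

variable {n : ℕ}

/-- The weight `x_{n+1}^a G`. -/
noncomputable def rho (a : ℝ) (p : SpaceTime n) : ℝ := p.1.2 ^ a * gauss a p

/-- The restriction of `G` to the thin space, extended constantly in `x_{n+1}`. -/
noncomputable def thinGauss (a : ℝ) (p : SpaceTime n) : ℝ :=
  1 / p.2 ^ (((n : ℝ) + 1 + a) / 2) * Real.exp (-‖p.1.1‖ ^ 2 / (4 * p.2))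

/-- The generator `(X / 2t, 1)` of the parabolic scaling. -/
noncomputable def radial (p : SpaceTime n) : SpaceTime n :=
  (((1 / (2 * p.2)) • p.1.1, 1 / (2 * p.2) * p.1.2), 1)

/-- `∂_t w + X / 2t · ∇w`. -/
noncomputable def drift (w : SpaceTime n → ℝ) (p : SpaceTime n) : ℝ := fderiv ℝ w p (radial p)

theorem sum_single_apply (L : SpaceTime n →L[ℝ] ℝ) (x : EuclideanSpace ℝ (Fin n)) :
    L ((x, 0), 0) = ∑ i, x i * L ((EuclideanSpace.single i 1, 0), 0) := by
  have h : x = ∑ i, x i • EuclideanSpace.single i (1 : ℝ) := by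
    ext j
    simp [Finset.sum_apply, Pi.single_apply]
  have h2 : (((x, 0), 0) : SpaceTime n)
      = ∑ i, x i • (((EuclideanSpace.single i 1, 0), 0) : SpaceTime n) := by
    refine Prod.ext (Prod.ext ?_ ?_) ?_
    · simpa [Prod.fst_sum] using h
    · simp [Prod.fst_sum, Prod.snd_sum]
    · simp [Prod.snd_sum]
  rw [h2, map_sum]
  simp only [map_smul, smul_eq_mul]

theorem drift_eq (w : SpaceTime n → ℝ) (p : SpaceTime n) :
    drift w p = (∑ i, p.1.1 i * dx i w p) / (2 * p.2) + p.1.2 * dy w p / (2 * p.2) + dt w p := by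
  have h : radial p = (1 / (2 * p.2)) • ((p.1.1, 0), 0) + (p.1.2 / (2 * p.2)) • ((0, 1), 0)
      + (((0, 0), 1) : SpaceTime n) := by
    refine Prod.ext (Prod.ext ?_ ?_) ?_
    · simp [radial]
    · simp [radial]; ring
    · simp [radial]
  rw [drift, h, map_add, map_add, map_smul, map_smul, sum_single_apply]
  simp only [smul_eq_mul, dx, dy, dt]
  rw [show (((0, 0), 1) : SpaceTime n) = (0, 1) from rfl]
  ring

theorem fderiv_mul_apply {f g : SpaceTime n → ℝ} {p : SpaceTime n} (hf : DifferentiableAt ℝ f p)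
    (hg : DifferentiableAt ℝ g p) (v : SpaceTime n) :
    fderiv ℝ (fun q => f q * g q) p v = f p * fderiv ℝ g p v + g p * fderiv ℝ f p v := by
  rw [fderiv_fun_mul hf hg]
  simp

theorem hasFDerivAt_time {m : ℝ → ℝ} {m' : ℝ} {p : SpaceTime n} (h : HasDerivAt m m' p.2) :
    HasFDerivAt (fun q : SpaceTime n => m q.2) (m' • ContinuousLinearMap.snd ℝ _ _) p :=
  h.comp_hasFDerivAt p hasFDerivAt_snd

theorem hasFDerivAt_height (p : SpaceTime n) :
    HasFDerivAt (fun q : SpaceTime n => q.1.2)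
      ((ContinuousLinearMap.snd ℝ _ _).comp (ContinuousLinearMap.fst ℝ (Space n) ℝ)) p :=
  hasFDerivAt_snd.comp p hasFDerivAt_fst

theorem hasFDerivAt_tangential (p : SpaceTime n) :
    HasFDerivAt (fun q : SpaceTime n => q.1.1)
      ((ContinuousLinearMap.fst ℝ _ _).comp (ContinuousLinearMap.fst ℝ (Space n) ℝ)) p :=
  hasFDerivAt_fst.comp p hasFDerivAt_fst

theorem exists_fderiv_thinGauss (a : ℝ) {p : SpaceTime n} (ht : 0 < p.2) :
    ∃ L : SpaceTime n →L[ℝ] ℝ, HasFDerivAt (thinGauss a) L p ∧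
      (∀ v, L v = thinGauss a p * (-(inner ℝ p.1.1 v.1.1) / (2 * p.2)
        + (-(((n : ℝ) + 1 + a) / 2) / p.2 + ‖p.1.1‖ ^ 2 / (4 * p.2 ^ 2)) * v.2)) := by
  have h1 : HasDerivAt (fun t : ℝ => 1 / t ^ (((n : ℝ) + 1 + a) / 2))
      (-(((n : ℝ) + 1 + a) / 2) / p.2 * (1 / p.2 ^ (((n : ℝ) + 1 + a) / 2))) p.2 := by
    have h2 := (Real.hasDerivAt_rpow_const (p := ((n : ℝ) + 1 + a) / 2) (Or.inl ht.ne')).fun_inv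
      (Real.rpow_pos_of_pos ht _).ne'
    simp only [one_div]
    refine h2.congr_deriv ?_
    have := (Real.rpow_pos_of_pos ht (((n : ℝ) + 1 + a) / 2)).ne'
    rw [Real.rpow_sub_one ht.ne']
    field_simp
  have h2 := (hasFDerivAt_tangential p).norm_sq.fun_neg
  have h3 : HasDerivAt (fun t : ℝ => (4 * t)⁻¹) (-(1 / (4 * p.2 ^ 2))) p.2 := by
    refine (((hasDerivAt_id p.2).const_mul 4).fun_inv (by simpa using ht.ne')).congr_deriv ?_
    simp only [id]
    field_simp
  have h4 := (hasFDerivAt_time h1).mul ((h2.mul (hasFDerivAt_time h3)).exp)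
  refine ⟨_, h4, fun v => ?_⟩
  simp [thinGauss, div_eq_mul_inv]
  field_simp
  ring

theorem rho_eq (a : ℝ) (p : SpaceTime n) :
    rho a p = p.1.2 ^ a * (thinGauss a p * Real.exp (-p.1.2 ^ 2 / (4 * p.2))) := by
  simp only [rho, gauss, thinGauss, normSq]
  rw [mul_assoc (1 / p.2 ^ _), ← Real.exp_add]
  congr 4
  ring

theorem exists_fderiv_rho (a : ℝ) {p : SpaceTime n} (hy : 0 < p.1.2) (ht : 0 < p.2) :
    ∃ L : SpaceTime n →L[ℝ] ℝ, HasFDerivAt (rho a) L p ∧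
      (∀ v, L v = rho a p * (-(inner ℝ p.1.1 v.1.1) / (2 * p.2)
        + (a / p.1.2 - p.1.2 / (2 * p.2)) * v.1.2
        + (-(((n : ℝ) + 1 + a) / 2) / p.2 + normSq p.1 / (4 * p.2 ^ 2)) * v.2)) := by
  obtain ⟨L, hL, hL'⟩ := exists_fderiv_thinGauss a ht
  have h3 : HasDerivAt (fun t : ℝ => (4 * t)⁻¹) (-(1 / (4 * p.2 ^ 2))) p.2 := by
    refine (((hasDerivAt_id p.2).const_mul 4).fun_inv (by simpa using ht.ne')).congr_deriv ?_
    simp only [id]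
    field_simp
  have h0 : rho (n := n) a = fun p => p.1.2 ^ a *
      (thinGauss a p * Real.exp (-p.1.2 ^ 2 * (4 * p.2)⁻¹)) := by
    funext p; rw [rho_eq, div_eq_mul_inv]
  have h4 := ((hasFDerivAt_height p).rpow_const (p := a) (Or.inl hy.ne')).mul (hL.mul
    ((((hasFDerivAt_height p).pow 2).fun_neg.mul (hasFDerivAt_time h3)).exp))
  rw [h0]
  refine ⟨_, h4, fun v => ?_⟩
  simp [hL', Real.rpow_sub_one hy.ne', normSq, div_eq_mul_inv]
  field_simp
  ring

theorem inner_single_right (x : EuclideanSpace ℝ (Fin n)) (i : Fin n) :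
    inner ℝ x (EuclideanSpace.single i (1 : ℝ)) = x i := by
  simp [EuclideanSpace.inner_single_right]

theorem norm_sq_eq_sum (x : EuclideanSpace ℝ (Fin n)) : ‖x‖ ^ 2 = ∑ i, x i * x i := by
  rw [EuclideanSpace.real_norm_sq_eq]
  exact Finset.sum_congr rfl fun i _ => sq _

theorem hasFDerivAt_coord (p : SpaceTime n) (i : Fin n) :
    HasFDerivAt (fun q : SpaceTime n => q.1.1 i)
      ((EuclideanSpace.proj i : EuclideanSpace ℝ (Fin n) →L[ℝ] ℝ).comp
        ((ContinuousLinearMap.fst ℝ _ _).comp (ContinuousLinearMap.fst ℝ (Space n) ℝ))) p :=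
  (EuclideanSpace.proj i : EuclideanSpace ℝ (Fin n) →L[ℝ] ℝ).hasFDerivAt.comp p
    (hasFDerivAt_tangential p)

theorem hasDerivAt_inv_two_mul {t : ℝ} (ht : t ≠ 0) :
    HasDerivAt (fun t : ℝ => 1 / (2 * t)) (-(1 / (2 * t ^ 2))) t := by
  refine ((hasDerivAt_const t (1 : ℝ)).fun_div ((hasDerivAt_id t).const_mul 2)
    (by simpa using ht)).congr_deriv ?_
  simp only [id]
  field_simp
  ring

section Pointwise

variable {a : ℝ} {p : SpaceTime n} {w h q : SpaceTime n → ℝ}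

/-- The thick divergence of a flux of the form `ρ (h ∇w + q X / 2t, q)`. -/
theorem divergence_flux (hy : 0 < p.1.2) (ht : 0 < p.2) (hh : DifferentiableAt ℝ h p)
    (hq : DifferentiableAt ℝ q p) (hwx : ∀ i, DifferentiableAt ℝ (dx i w) p)
    (hwy : DifferentiableAt ℝ (dy w) p) :
    (∑ i, dx i (fun r => rho a r * (h r * dx i w r + q r * (r.1.1 i * (1 / (2 * r.2))))) p)
      + dy (fun r => rho a r * (h r * dy w r + q r * (r.1.2 * (1 / (2 * r.2))))) p
      + dt (fun r => rho a r * q r) p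
    = rho a p * (h p * ((∑ i, dx i (dx i w) p) + dy (dy w) p + a / p.1.2 * dy w p
        - ((∑ i, p.1.1 i * dx i w p) + p.1.2 * dy w p) / (2 * p.2))
      + ((∑ i, dx i w p * dx i h p) + dy w p * dy h p) + drift q p) := by
  obtain ⟨L, hL, hL'⟩ := exists_fderiv_rho a hy ht
  have hT := hasFDerivAt_time (p := p) (hasDerivAt_inv_two_mul ht.ne')
  have hx : ∀ i, dx i (fun r => rho a r * (h r * dx i w r + q r * (r.1.1 i * (1 / (2 * r.2))))) p
      = rho a p * (h p * dx i (dx i w) p + dx i w p * dx i h p + q p / (2 * p.2)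
        + p.1.1 i * dx i q p / (2 * p.2) - h p * (p.1.1 i * dx i w p) / (2 * p.2)
        - q p * (p.1.1 i * p.1.1 i) / (4 * p.2 ^ 2)) := fun i => by
    have hc := hasFDerivAt_coord p i
    have h1 := hc.fun_mul hT
    rw [dx, fderiv_mul_apply hL.differentiableAt ((hh.fun_mul (hwx i)).fun_add
      (hq.fun_mul h1.differentiableAt)), fderiv_fun_add (hh.fun_mul (hwx i)) (hq.fun_mul h1.differentiableAt),
      add_apply, fderiv_mul_apply hh (hwx i),
      fderiv_mul_apply hq h1.differentiableAt, h1.fderiv, hL.fderiv, hL', inner_single_right]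
    simp only [dx]
    simp
    field_simp
    ring
  have hy' : dy (fun r => rho a r * (h r * dy w r + q r * (r.1.2 * (1 / (2 * r.2))))) p
      = rho a p * (h p * dy (dy w) p + dy w p * dy h p + q p / (2 * p.2)
        + p.1.2 * dy q p / (2 * p.2) + (h p * dy w p + q p * p.1.2 / (2 * p.2)) *
        (a / p.1.2 - p.1.2 / (2 * p.2))) := by
    have h1 := (hasFDerivAt_height p).fun_mul hT
    rw [dy, fderiv_mul_apply hL.differentiableAt ((hh.fun_mul hwy).fun_add
      (hq.fun_mul h1.differentiableAt)), fderiv_fun_add (hh.fun_mul hwy) (hq.fun_mul h1.differentiableAt),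
      add_apply, fderiv_mul_apply hh hwy,
      fderiv_mul_apply hq h1.differentiableAt, h1.fderiv, hL.fderiv, hL']
    simp only [dy]
    simp
    field_simp
    ring
  have ht' : dt (fun r => rho a r * q r) p = rho a p * (dt q p
      + q p * (-(((n : ℝ) + 1 + a) / 2) / p.2 + normSq p.1 / (4 * p.2 ^ 2))) := by
    rw [dt, fderiv_mul_apply hL.differentiableAt hq, hL.fderiv, hL']
    simp only [dt]
    simp
    ring
  -- All terms with an undifferentiated `q` cancel, since `ρ(X/2t, 1)` is divergence free:
  -- `(n+1)/2t` from `div (X/2t)` and `a/2t` from `y^a` compensate the power of `t` in `G`, and the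
  -- two terms in `|X|²/4t²` cancel each other.
  rw [Finset.sum_congr rfl fun i _ => hx i, hy', ht', drift_eq, ← Finset.mul_sum,
    Finset.sum_sub_distrib, Finset.sum_sub_distrib, Finset.sum_add_distrib,
    Finset.sum_add_distrib, Finset.sum_add_distrib, ← Finset.mul_sum, ← Finset.sum_div,
    ← Finset.sum_div, ← Finset.sum_div, ← Finset.sum_div, ← Finset.mul_sum, ← Finset.mul_sum, normSq,
    norm_sq_eq_sum]
  simp only [Finset.sum_const, Finset.card_univ, Fintype.card_fin, nsmul_eq_mul]
  field_simp
  ring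

theorem hasFDerivAt_radial (ht : p.2 ≠ 0) {v : SpaceTime n} (hv : v.2 = 0) :
    ∃ L : SpaceTime n →L[ℝ] SpaceTime n, HasFDerivAt radial L p ∧ L v = (1 / (2 * p.2)) • v := by
  have hT := hasFDerivAt_time (p := p) (hasDerivAt_inv_two_mul ht)
  have h := ((hT.smul (hasFDerivAt_tangential p)).prodMk (hT.mul (hasFDerivAt_height p))).prodMk
    (hasFDerivAt_const (1 : ℝ) p)
  refine ⟨_, h, Prod.ext (Prod.ext ?_ ?_) ?_⟩ <;> simp [hv]

/-- The commutator of `D` with a spatial derivative is `1/2t` times that derivative: second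
derivatives are symmetric, and only the factor `X/2t` of the field depends on `X`. -/
theorem fderiv_drift (ht : p.2 ≠ 0) (hw : ContDiffAt ℝ ∞ w p) {v : SpaceTime n} (hv : v.2 = 0) :
    fderiv ℝ (drift w) p v
      = drift (fun r => fderiv ℝ w r v) p + 1 / (2 * p.2) * fderiv ℝ w p v := by
  obtain ⟨L, hL, hLv⟩ := hasFDerivAt_radial ht hv
  have hd : DifferentiableAt ℝ (fderiv ℝ w) p :=
    (hw.fderiv_right (m := ∞) (by simp)).differentiableAt (by simp)
  have hsymm : IsSymmSndFDerivAt ℝ w p := 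
    hw.isSymmSndFDerivAt (by
      rw [minSmoothness_of_isRCLikeNormedField]
      exact WithTop.coe_le_coe.2 le_top)
  have h1 : fderiv ℝ (drift w) p v
      = fderiv ℝ w p (L v) + fderiv ℝ (fderiv ℝ w) p v (radial p) := by
    have := (hd.hasFDerivAt.clm_apply hL).fderiv
    change fderiv ℝ (fun r => fderiv ℝ w r (radial r)) p v = _
    rw [this]
    simp
  have h2 : drift (fun r => fderiv ℝ w r v) p = fderiv ℝ (fderiv ℝ w) p (radial p) v := by
    have := (hd.hasFDerivAt.clm_apply (hasFDerivAt_const v p)).fderiv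
    rw [drift, this]
    simp
  rw [h1, h2, hLv, hsymm v (radial p), map_smul, smul_eq_mul]
  ring

theorem contDiffAt_dir (hw : ContDiffAt ℝ ∞ w p) (v : SpaceTime n) :
    ContDiffAt ℝ ∞ (fun r => fderiv ℝ w r v) p :=
  (hw.fderiv_right (m := ∞) (by simp)).clm_apply contDiffAt_const

theorem contDiffAt_dx (hw : ContDiffAt ℝ ∞ w p) (i : Fin n) : ContDiffAt ℝ ∞ (dx i w) p :=
  contDiffAt_dir hw _

theorem contDiffAt_dy (hw : ContDiffAt ℝ ∞ w p) : ContDiffAt ℝ ∞ (dy w) p :=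
  contDiffAt_dir hw _

theorem contDiffAt_dt (hw : ContDiffAt ℝ ∞ w p) : ContDiffAt ℝ ∞ (dt w) p :=
  contDiffAt_dir hw _

theorem differentiableAt_of_smooth (hw : ContDiffAt ℝ ∞ w p) : DifferentiableAt ℝ w p :=
  hw.differentiableAt (by simp)

theorem contDiffAt_drift (ht : p.2 ≠ 0) (hw : ContDiffAt ℝ ∞ w p) : ContDiffAt ℝ ∞ (drift w) p := by
  have h2 : ContDiffAt ℝ ∞ (fun r : SpaceTime n => 1 / (2 * r.2)) p :=
    contDiffAt_const.div (contDiffAt_const.mul contDiffAt_snd) (by simpa using ht)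
  have h3 : ContDiffAt ℝ ∞ (radial (n := n)) p :=
    ((h2.smul (contDiffAt_fst.comp p contDiffAt_fst)).prodMk
      (h2.mul (contDiffAt_snd.comp p contDiffAt_fst))).prodMk contDiffAt_const
  exact (hw.fderiv_right (m := ∞) (by simp)).clm_apply h3

theorem contDiffAt_gradSq (hw : ContDiffAt ℝ ∞ w p) : ContDiffAt ℝ ∞ (gradSq w) p :=
  (ContDiffAt.sum fun _ _ => (contDiffAt_dir hw _).pow 2).add ((contDiffAt_dir hw _).pow 2)

theorem drift_gradSq (hw : ContDiffAt ℝ ∞ w p) :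
    drift (gradSq w) p
      = 2 * ((∑ i, dx i w p * drift (dx i w) p) + dy w p * drift (dy w) p) := by
  have hx := fun i : Fin n => differentiableAt_of_smooth
    (contDiffAt_dir hw ((EuclideanSpace.single i 1, 0), 0))
  have hy := differentiableAt_of_smooth (contDiffAt_dir hw ((0, 1), 0))
  have hx' : ∀ i ∈ Finset.univ, HasFDerivAt (fun r => dx i w r ^ 2) _ p :=
    fun i _ => (hx i).hasFDerivAt.pow 2
  have hy' := hy.hasFDerivAt.pow 2
  have h := (HasFDerivAt.fun_sum hx').add hy'
  have h2 : drift (gradSq w) p = _ := congrArg (fun L => L (radial p)) h.fderiv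
  rw [h2]
  simp only [add_apply, sum_apply]
  simp [Finset.mul_sum, mul_add, mul_assoc, drift]
  rfl

/-- The Rellich-type identity: it makes `∇w · ∇(Dw)` a derivative along `D` plus a term without
second derivatives. -/
theorem sum_grad_drift (ht : p.2 ≠ 0) (hw : ContDiffAt ℝ ∞ w p) :
    (∑ i, dx i w p * dx i (drift w) p) + dy w p * dy (drift w) p
      = drift (gradSq w) p / 2 + gradSq w p / (2 * p.2) := by
  have hx : ∀ i, dx i (drift w) p = drift (dx i w) p + 1 / (2 * p.2) * dx i w p :=
    fun i => fderiv_drift ht hw rfl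
  have hy : dy (drift w) p = drift (dy w) p + 1 / (2 * p.2) * dy w p := fderiv_drift ht hw rfl
  rw [drift_gradSq hw, hy, Finset.sum_congr rfl fun i _ => by rw [hx i, mul_add]]
  rw [Finset.sum_add_distrib, gradSq]
  have h3 : ∑ i, dx i w p * (1 / (2 * p.2) * dx i w p) = (∑ i, dx i w p ^ 2) / (2 * p.2) := by
    rw [Finset.sum_div]
    exact Finset.sum_congr rfl fun i _ => by ring
  rw [h3]
  ring

end Pointwise

end ThinCarleman

/-! ### The pointwise Carleman inequality. -/

namespace ThinCarleman

variable {n : ℕ} {a : ℝ} {p : SpaceTime n} {w : SpaceTime n → ℝ}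

theorem extOp_eq (hy : 0 < p.1.2) (hw : ContDiffAt ℝ ∞ w p) :
    extOp a w p = p.1.2 ^ a * (dt w p + ((∑ i, dx i (dx i w) p) + dy (dy w) p
      + a / p.1.2 * dy w p)) := by
  have hY := (hasFDerivAt_height p).rpow_const (p := a) (Or.inl hy.ne')
  have hx : ∀ i, dx i (fun q => q.1.2 ^ a * dx i w q) p = p.1.2 ^ a * dx i (dx i w) p := fun i => by
    rw [dx, fderiv_mul_apply hY.differentiableAt (differentiableAt_of_smooth (contDiffAt_dx hw i)),
      hY.fderiv]
    simp [dx]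
  have hy' : dy (fun q => q.1.2 ^ a * dy w q) p
      = p.1.2 ^ a * (dy (dy w) p + a / p.1.2 * dy w p) := by
    rw [dy, fderiv_mul_apply hY.differentiableAt (differentiableAt_of_smooth (contDiffAt_dy hw)),
      hY.fderiv]
    simp [dy, Real.rpow_sub_one hy.ne']
    ring
  rw [extOp, Finset.sum_congr rfl fun i _ => hx i, hy', ← Finset.mul_sum]
  ring

/-- The multiplier `2m (Dw - bw)`. -/
noncomputable def fluxMult (m b : ℝ → ℝ) (w : SpaceTime n → ℝ) (p : SpaceTime n) : ℝ :=
  2 * m p.2 * (drift w p - b p.2 * w p)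

/-- The energy density `m (b w² - |∇w|²)`. -/
noncomputable def fluxEnergy (m b : ℝ → ℝ) (w : SpaceTime n → ℝ) (p : SpaceTime n) : ℝ :=
  m p.2 * (b p.2 * w p ^ 2 - gradSq w p)

/-- The tangential components of the flux. -/
noncomputable def fluxX (a : ℝ) (m b : ℝ → ℝ) (w : SpaceTime n → ℝ) (i : Fin n) (p : SpaceTime n) :
    ℝ :=
  rho a p * (fluxMult m b w p * dx i w p + fluxEnergy m b w p * (p.1.1 i * (1 / (2 * p.2))))

/-- The normal component of the flux. -/
noncomputable def fluxY (a : ℝ) (m b : ℝ → ℝ) (w : SpaceTime n → ℝ) (p : SpaceTime n) : ℝ :=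
  rho a p * (fluxMult m b w p * dy w p + fluxEnergy m b w p * (p.1.2 * (1 / (2 * p.2))))

/-- The time component of the flux. -/
noncomputable def fluxT (a : ℝ) (m b : ℝ → ℝ) (w : SpaceTime n → ℝ) (p : SpaceTime n) : ℝ :=
  rho a p * fluxEnergy m b w p

theorem drift_fluxEnergy (hw : ContDiffAt ℝ ∞ w p) {m b : ℝ → ℝ} {m' b' : ℝ}
    (hm : HasDerivAt m m' p.2) (hb : HasDerivAt b b' p.2) :
    drift (fluxEnergy m b w) p = m' * (b p.2 * w p ^ 2 - gradSq w p)
      + m p.2 * (b' * w p ^ 2 + 2 * b p.2 * w p * drift w p - drift (gradSq w) p) := by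
  have h1 := (hasFDerivAt_time hm).mul (((hasFDerivAt_time hb).mul
    ((differentiableAt_of_smooth hw).hasFDerivAt.pow 2)).sub
    (differentiableAt_of_smooth (contDiffAt_gradSq hw)).hasFDerivAt)
  have h2 : drift (fluxEnergy m b w) p = _ := congrArg (fun L => L (radial p)) h1.fderiv
  rw [h2]
  have h3 : (radial p).2 = 1 := rfl
  simp [drift, h3]
  ring

theorem fderiv_fluxMult (ht : 0 < p.2) (hw : ContDiffAt ℝ ∞ w p) {m b : ℝ → ℝ} {m' b' : ℝ}
    (hm : HasDerivAt m m' p.2) (hb : HasDerivAt b b' p.2) {v : SpaceTime n} (hv : v.2 = 0) :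
    fderiv ℝ (fluxMult m b w) p v
      = 2 * m p.2 * (fderiv ℝ (drift w) p v - b p.2 * fderiv ℝ w p v) := by
  have h1 := ((hasFDerivAt_time hm).const_mul 2).mul
    ((differentiableAt_of_smooth (contDiffAt_drift ht.ne' hw)).hasFDerivAt.sub
    ((hasFDerivAt_time hb).mul (differentiableAt_of_smooth hw).hasFDerivAt))
  have h2 : fderiv ℝ (fluxMult m b w) p v = _ := congrArg (fun L => L v) h1.fderiv
  rw [h2]
  simp [hv]

/-- The pointwise Carleman inequality. -/
theorem pointwise_carleman (hy : 0 < p.1.2) (ht : 0 < p.2) (hw : ContDiffAt ℝ ∞ w p)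
    {m b : ℝ → ℝ} {Θ : ℝ} (hm0 : 0 ≤ m p.2)
    (hm : HasDerivAt m (m p.2 * ((1 + Θ / 2) / p.2 - 2 * b p.2)) p.2)
    (hb : HasDerivAt b (-(b p.2 * (1 + Θ) / p.2)) p.2) :
    (∑ i, dx i (fluxX a m b w i) p) + dy (fluxY a m b w) p + dt (fluxT a m b w) p
      + m p.2 * Θ / (2 * p.2) * (rho a p * (gradSq w p + b p.2 * w p ^ 2))
    ≤ m p.2 * (p.1.2 ^ (-a) * extOp a w p ^ 2 * gauss a p) := by
  have hwd := differentiableAt_of_smooth hw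
  have hh : DifferentiableAt ℝ (fluxMult m b w) p :=
    ((hasFDerivAt_time hm).differentiableAt.const_mul 2).mul
      ((differentiableAt_of_smooth (contDiffAt_drift ht.ne' hw)).sub
      ((hasFDerivAt_time hb).differentiableAt.mul hwd))
  have hq : DifferentiableAt ℝ (fluxEnergy m b w) p :=
    (hasFDerivAt_time hm).differentiableAt.mul (((hasFDerivAt_time hb).differentiableAt.mul
      (hwd.pow 2)).sub (differentiableAt_of_smooth (contDiffAt_gradSq hw)))
  have h1 := divergence_flux (a := a) hy ht hh hq
    (fun i => differentiableAt_of_smooth (contDiffAt_dir hw _))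
    (differentiableAt_of_smooth (contDiffAt_dir hw _))
  have h2 : (∑ i, dx i w p * dx i (fluxMult m b w) p) + dy w p * dy (fluxMult m b w) p
      = 2 * m p.2 * ((∑ i, dx i w p * dx i (drift w) p) + dy w p * dy (drift w) p
        - b p.2 * gradSq w p) := by
    have hx : ∀ i, dx i w p * dx i (fluxMult m b w) p = 2 * m p.2 * (dx i w p * dx i (drift w) p)
        - 2 * m p.2 * b p.2 * (dx i w p ^ 2) := fun i => by
      have := fderiv_fluxMult ht hw hm hb (v := ((EuclideanSpace.single i 1, 0), 0)) rfl
      simp only [dx]; rw [this]; ring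
    have hy2 := fderiv_fluxMult ht hw hm hb (v := ((0, 1), 0)) rfl
    rw [Finset.sum_congr rfl fun i _ => hx i, Finset.sum_sub_distrib, ← Finset.mul_sum,
      ← Finset.mul_sum, gradSq]
    simp only [dy]
    rw [hy2]
    ring
  rw [h2, sum_grad_drift ht.ne' hw, drift_fluxEnergy hw hm hb] at h1
  have h3 := extOp_eq (a := a) hy hw
  have h4 := drift_eq w p
  have hya : 0 < p.1.2 ^ a := Real.rpow_pos_of_pos hy a
  have hG : 0 ≤ gauss a p := by unfold gauss; positivity
  have h5 : p.1.2 ^ (-a) * extOp a w p ^ 2 * gauss a p = rho a p * (dt w p +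
      ((∑ i, dx i (dx i w) p) + dy (dy w) p + a / p.1.2 * dy w p)) ^ 2 := by
    rw [h3, Real.rpow_neg hy.le, rho]
    field_simp
  rw [h5]
  change (∑ i, dx i (fun r => rho a r * (fluxMult m b w r * dx i w r
    + fluxEnergy m b w r * (r.1.1 i * (1 / (2 * r.2))))) p)
      + dy (fun r => rho a r * (fluxMult m b w r * dy w r
      + fluxEnergy m b w r * (r.1.2 * (1 / (2 * r.2))))) p
      + dt (fun r => rho a r * fluxEnergy m b w r) p + _ ≤ _
  rw [h1]
  generalize (∑ i, dx i (dx i w) p) + dy (dy w) p + a / p.1.2 * dy w p = Q at *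
  have h6 : ((∑ i, p.1.1 i * dx i w p) + p.1.2 * dy w p) / (2 * p.2) = drift w p - dt w p := by
    rw [h4]; ring
  rw [h6]
  generalize drift (gradSq w) p = E at *
  have hr : 0 ≤ rho a p := mul_nonneg hya.le hG
  -- The identity `(A + S)² - A² - S² = 2AS`, where `A = Dw - bw` and `S` is the rest of the
  -- operator. The product `2mAS` has already been expanded into divergences; inserting the
  -- equations of `m` and `b` leaves exactly the gain in `Θ`.
  have key : m p.2 * (rho a p * (dt w p + Q) ^ 2)
      - m p.2 * rho a p * ((drift w p - b p.2 * w p) ^ 2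
        + (dt w p + Q - drift w p + b p.2 * w p) ^ 2)
      = rho a p * (fluxMult m b w p * (Q - (drift w p - dt w p))
        + 2 * m p.2 * (E / 2 + gradSq w p / (2 * p.2) - b p.2 * gradSq w p)
        + (m p.2 * ((1 + Θ / 2) / p.2 - 2 * b p.2) * (b p.2 * w p ^ 2 - gradSq w p)
          + m p.2 * (-(b p.2 * (1 + Θ) / p.2) * w p ^ 2 + 2 * b p.2 * w p * drift w p - E)))
        + m p.2 * Θ / (2 * p.2) * (rho a p * (gradSq w p + b p.2 * w p ^ 2)) := by
    simp only [fluxMult]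
    field_simp
    ring
  rw [← key]
  have : 0 ≤ m p.2 * rho a p * ((drift w p - b p.2 * w p) ^ 2
        + (dt w p + Q - drift w p + b p.2 * w p) ^ 2) := by positivity
  linarith

end ThinCarleman

/-! ### Supports, Fubini and the divergence theorem above a level `y = ε`. -/

namespace ThinCarleman

variable {n : ℕ}

/-- `f` vanishes on `{y > 0, t > 0}` unless `|X| ≤ 4` and `t ≤ T`. -/
def SupportedBy (T : ℝ) (f : SpaceTime n → ℝ) : Prop :=
  ∀ p : SpaceTime n, 0 < p.1.2 → 0 < p.2 → f p ≠ 0 → normSq p.1 ≤ 4 ^ 2 ∧ p.2 ≤ T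

/-- The open region `{y > 0, 0 < t < B}`. -/
def region (n : ℕ) (B : ℝ) : Set (SpaceTime n) := upperHalf n ×ˢ Ioo 0 B

/-- The region `{y > ε, c ≤ t ≤ b}`. -/
def slab (n : ℕ) (ε c b : ℝ) : Set (SpaceTime n) := (univ ×ˢ Ioi ε) ×ˢ Icc c b

theorem isOpen_upperHalf : IsOpen (upperHalf n) := isOpen_lt continuous_const continuous_snd

theorem isOpen_region (B : ℝ) : IsOpen (region n B) := isOpen_upperHalf.prod isOpen_Ioo

theorem continuous_normSq : Continuous (normSq (n := n)) := by
  unfold normSq; fun_prop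

theorem measurableSet_slab (ε c b : ℝ) : MeasurableSet (slab n ε c b) :=
  (MeasurableSet.univ.prod measurableSet_Ioi).prod measurableSet_Icc

theorem norm_le_of_normSq {X : Space n} (h : normSq X ≤ 4 ^ 2) : ‖X.1‖ ≤ 4 ∧ |X.2| ≤ 4 := by
  unfold normSq at h
  exact ⟨abs_le_of_sq_le_sq' (by nlinarith [sq_nonneg X.2]) (by norm_num) |>.2,
    abs_le_of_sq_le_sq (by nlinarith [sq_nonneg ‖X.1‖]) (by norm_num)⟩

namespace SupportedBy

variable {T : ℝ} {f g : SpaceTime n → ℝ}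

theorem fderiv_eq_zero (hf : SupportedBy T f) {p : SpaceTime n} (hy : 0 < p.1.2) (ht : 0 < p.2)
    (h : ¬(normSq p.1 ≤ 4 ^ 2 ∧ p.2 ≤ T)) : fderiv ℝ f p = 0 := by
  have h1 : f =ᶠ[𝓝 p] fun _ => 0 := by
    have hc : IsClosed {q : SpaceTime n | normSq q.1 ≤ 4 ^ 2 ∧ q.2 ≤ T} :=
      (isClosed_le (continuous_normSq.comp continuous_fst) continuous_const).inter
        (isClosed_le continuous_snd continuous_const)
    have ho : IsOpen (upperHalf n ×ˢ Ioi (0 : ℝ)) := isOpen_upperHalf.prod isOpen_Ioi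
    filter_upwards [hc.isOpen_compl.mem_nhds h, ho.mem_nhds ⟨hy, ht⟩] with q hq hq'
    by_contra hne
    exact hq (hf q hq'.1 hq'.2 hne)
  rw [h1.fderiv_eq]
  simp

theorem fderiv_apply (hf : SupportedBy T f) (v : SpaceTime n → SpaceTime n) :
    SupportedBy T (fun p => fderiv ℝ f p (v p)) := fun p hy ht hne => by
  by_contra h
  exact hne (by simp [hf.fderiv_eq_zero hy ht h])

theorem dx (hf : SupportedBy T f) (i : Fin n) : SupportedBy T (dx i f) := hf.fderiv_apply _

theorem dy (hf : SupportedBy T f) : SupportedBy T (dy f) := hf.fderiv_apply _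

theorem dt (hf : SupportedBy T f) : SupportedBy T (dt f) := hf.fderiv_apply _

theorem of_imp (hf : SupportedBy T f)
    (h : ∀ p : SpaceTime n, 0 < p.1.2 → 0 < p.2 → f p = 0 → g p = 0) : SupportedBy T g :=
  fun p hy ht hne => hf p hy ht fun h0 => hne (h p hy ht h0)

theorem mul_left (hf : SupportedBy T f) (g : SpaceTime n → ℝ) :
    SupportedBy T (fun p => g p * f p) := hf.of_imp fun p _ _ h => by simp [h]

theorem mul_right (hf : SupportedBy T f) (g : SpaceTime n → ℝ) :
    SupportedBy T (fun p => f p * g p) := hf.of_imp fun p _ _ h => by simp [h]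

theorem add (hf : SupportedBy T f) (hg : SupportedBy T g) :
    SupportedBy T (fun p => f p + g p) := fun p hy ht hne => by
  by_cases h : f p = 0
  · exact hg p hy ht fun h' => hne (by simp [h, h'])
  · exact hf p hy ht h

theorem sub (hf : SupportedBy T f) (hg : SupportedBy T g) :
    SupportedBy T (fun p => f p - g p) := fun p hy ht hne => by
  by_cases h : f p = 0
  · exact hg p hy ht fun h' => hne (by simp [h, h'])
  · exact hf p hy ht h

theorem sum {ι : Type*} (s : Finset ι) {F : ι → SpaceTime n → ℝ}
    (hF : ∀ i, SupportedBy T (F i)) : SupportedBy T (fun p => ∑ i ∈ s, F i p) :=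
  fun p hy ht hne => by
    obtain ⟨i, _, hi⟩ := Finset.exists_ne_zero_of_sum_ne_zero hne
    exact hF i p hy ht hi

theorem sq (hf : SupportedBy T f) : SupportedBy T (fun p => f p ^ 2) :=
  hf.of_imp fun p _ _ h => by simp [h]

end SupportedBy

section Integration

variable {B T c b ε : ℝ} {f F : SpaceTime n → ℝ}

theorem slab_subset_region (hε : 0 ≤ ε) (hc : 0 < c) (hb : b < B) : slab n ε c b ⊆ region n B :=
  fun _ hp => ⟨lt_of_le_of_lt hε hp.1.2, lt_of_lt_of_le hc hp.2.1, lt_of_le_of_lt hp.2.2 hb⟩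

theorem integrableOn_slab (hF : ContinuousOn F (region n B)) (hs : SupportedBy T F) (hε : 0 < ε)
    (hc : 0 < c) (hb : b < B) : IntegrableOn F (slab n ε c b) := by
  have hK : IsCompact ((Metric.closedBall (0 : EuclideanSpace ℝ (Fin n)) 4 ×ˢ Icc ε 4) ×ˢ Icc c b) :=
    ((isCompact_closedBall _ _).prod isCompact_Icc).prod isCompact_Icc
  refine IntegrableOn.of_forall_sdiff_eq_zero
    ((hF.mono fun p hp => ⟨lt_of_lt_of_le hε hp.1.2.1, lt_of_lt_of_le hc hp.2.1,
      lt_of_le_of_lt hp.2.2 hb⟩).integrableOn_compact hK) (measurableSet_slab ε c b) fun p hp => ?_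
  by_contra hne
  have h1 := hs p (hε.trans hp.1.1.2) (lt_of_lt_of_le hc hp.1.2.1) hne
  have h2 := norm_le_of_normSq h1.1
  exact hp.2 ⟨⟨by simpa using h2.1, le_of_lt hp.1.1.2, (le_abs_self _).trans h2.2⟩, hp.1.2⟩

theorem integrableOn_slice (hF : ContinuousOn F (region n B)) (hs : SupportedBy T F) (hε : 0 < ε)
    {t : ℝ} (ht : t ∈ Ioo 0 B) : IntegrableOn (fun X => F (X, t)) (univ ×ˢ Ioi ε) := by
  have hK : IsCompact (Metric.closedBall (0 : EuclideanSpace ℝ (Fin n)) 4 ×ˢ Icc ε 4) :=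
    (isCompact_closedBall _ _).prod isCompact_Icc
  have hc : ContinuousOn (fun X : Space n => F (X, t)) (Metric.closedBall 0 4 ×ˢ Icc ε 4) :=
    hF.comp (by fun_prop) fun X hX => ⟨lt_of_lt_of_le hε hX.2.1, ht⟩
  refine IntegrableOn.of_forall_sdiff_eq_zero (hc.integrableOn_compact hK)
    (MeasurableSet.univ.prod measurableSet_Ioi) fun X hX => ?_
  by_contra hne
  have h2 := norm_le_of_normSq (hs (X, t) (hε.trans hX.1.2) ht.1 hne).1
  exact hX.2 ⟨by simpa using h2.1, le_of_lt hX.1.2, (le_abs_self _).trans h2.2⟩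

theorem integrable_line (hF : ContinuousOn F (region n B)) (hs : SupportedBy T F) {y t : ℝ}
    (hy : 0 < y) (ht : t ∈ Ioo 0 B) : Integrable (fun x => F ((x, y), t)) := by
  have hc : ContinuousOn (fun x : EuclideanSpace ℝ (Fin n) => F ((x, y), t))
      (Metric.closedBall 0 4) := hF.comp (by fun_prop) fun x _ => ⟨hy, ht⟩
  rw [← integrableOn_univ]
  refine IntegrableOn.of_forall_sdiff_eq_zero (hc.integrableOn_compact (isCompact_closedBall _ _))
    MeasurableSet.univ fun x hx => ?_
  by_contra hne
  exact hx.2 (by simpa using (norm_le_of_normSq (hs ((x, y), t) hy ht.1 hne).1).1)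

theorem integrableOn_thin (hF : ContinuousOn F (region n B)) (hs : SupportedBy T F) (hε : 0 < ε)
    (hc : 0 < c) (hb : b < B) :
    IntegrableOn (fun z : EuclideanSpace ℝ (Fin n) × ℝ => F ((z.1, ε), z.2)) (univ ×ˢ Icc c b) := by
  have hK : IsCompact (Metric.closedBall (0 : EuclideanSpace ℝ (Fin n)) 4 ×ˢ Icc c b) :=
    (isCompact_closedBall _ _).prod isCompact_Icc
  have hcont : ContinuousOn (fun z : EuclideanSpace ℝ (Fin n) × ℝ => F ((z.1, ε), z.2))
      (Metric.closedBall 0 4 ×ˢ Icc c b) :=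
    hF.comp (by fun_prop) fun z hz => ⟨hε, lt_of_lt_of_le hc hz.2.1, lt_of_le_of_lt hz.2.2 hb⟩
  refine IntegrableOn.of_forall_sdiff_eq_zero (hcont.integrableOn_compact hK)
    (MeasurableSet.univ.prod measurableSet_Icc) fun z hz => ?_
  by_contra hne
  have h2 := norm_le_of_normSq (hs ((z.1, ε), z.2) hε (lt_of_lt_of_le hc hz.1.2.1) hne).1
  exact hz.2 ⟨by simpa using h2.1, hz.1.2⟩

theorem continuousOn_fderiv_apply (hf : ContDiffOn ℝ 1 f (region n B)) (v : SpaceTime n) :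
    ContinuousOn (fun p => fderiv ℝ f p v) (region n B) :=
  (hf.continuousOn_fderiv_of_isOpen (isOpen_region B) le_rfl).clm_apply continuousOn_const

theorem continuousOn_dx (hf : ContDiffOn ℝ 1 f (region n B)) (i : Fin n) :
    ContinuousOn (dx i f) (region n B) := continuousOn_fderiv_apply hf _

theorem continuousOn_dy (hf : ContDiffOn ℝ 1 f (region n B)) : ContinuousOn (dy f) (region n B) :=
  continuousOn_fderiv_apply hf _

theorem continuousOn_dt (hf : ContDiffOn ℝ 1 f (region n B)) : ContinuousOn (dt f) (region n B) :=
  continuousOn_fderiv_apply hf _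

theorem hasFDerivAt_of_region (hf : ContDiffOn ℝ 1 f (region n B)) {p : SpaceTime n}
    (hp : p ∈ region n B) : HasFDerivAt f (fderiv ℝ f p) p :=
  ((hf.contDiffAt ((isOpen_region B).mem_nhds hp)).differentiableAt (by simp)).hasFDerivAt

theorem integral_slab_eq (hF : ContinuousOn F (region n B)) (hs : SupportedBy T F) (hε : 0 < ε)
    (hc : 0 < c) (hb : b < B) :
    ∫ p in slab n ε c b, F p = ∫ t in Icc c b, ∫ X in univ ×ˢ Ioi ε, F (X, t) := by
  have h := integrableOn_slab hF hs hε hc hb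
  rw [IntegrableOn, slab, Measure.volume_eq_prod, ← Measure.prod_restrict] at h
  rw [slab, Measure.volume_eq_prod, ← Measure.prod_restrict, integral_prod_symm _ h]

theorem integral_slab_eq' (hF : ContinuousOn F (region n B)) (hs : SupportedBy T F) (hε : 0 < ε)
    (hc : 0 < c) (hb : b < B) :
    ∫ p in slab n ε c b, F p = ∫ X in univ ×ˢ Ioi ε, ∫ t in Icc c b, F (X, t) := by
  have h := integrableOn_slab hF hs hε hc hb
  rw [slab, Measure.volume_eq_prod] at h ⊢
  exact setIntegral_prod _ h

theorem integral_slice_eq (hF : ContinuousOn F (region n B)) (hs : SupportedBy T F) (hε : 0 < ε)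
    {t : ℝ} (ht : t ∈ Ioo 0 B) :
    ∫ X in univ ×ˢ Ioi ε, F (X, t) = ∫ x, ∫ y in Ioi ε, F ((x, y), t) := by
  have h := integrableOn_slice hF hs hε ht
  rw [Measure.volume_eq_prod] at h ⊢
  rw [setIntegral_prod _ h, setIntegral_univ]

theorem integral_slice_eq' (hF : ContinuousOn F (region n B)) (hs : SupportedBy T F) (hε : 0 < ε)
    {t : ℝ} (ht : t ∈ Ioo 0 B) :
    ∫ X in univ ×ˢ Ioi ε, F (X, t) = ∫ y in Ioi ε, ∫ x, F ((x, y), t) := by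
  have h := integrableOn_slice hF hs hε ht
  rw [IntegrableOn, Measure.volume_eq_prod, ← Measure.prod_restrict] at h
  rw [Measure.volume_eq_prod, ← Measure.prod_restrict, integral_prod_symm _ h,
    Measure.restrict_univ]

theorem integral_thin_eq (hF : ContinuousOn F (region n B)) (hs : SupportedBy T F) (hε : 0 < ε)
    (hc : 0 < c) (hb : b < B) :
    ∫ z in (univ : Set (EuclideanSpace ℝ (Fin n))) ×ˢ Icc c b, F ((z.1, ε), z.2)
      = ∫ t in Icc c b, ∫ x, F ((x, ε), t) := by
  have h := integrableOn_thin hF hs hε hc hb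
  rw [IntegrableOn, Measure.volume_eq_prod, ← Measure.prod_restrict] at h
  rw [Measure.volume_eq_prod, ← Measure.prod_restrict, integral_prod_symm _ h,
    Measure.restrict_univ]

theorem integral_thin_eq' (hF : ContinuousOn F (region n B)) (hs : SupportedBy T F) (hε : 0 < ε)
    (hc : 0 < c) (hb : b < B) :
    ∫ z in (univ : Set (EuclideanSpace ℝ (Fin n))) ×ˢ Icc c b, F ((z.1, ε), z.2)
      = ∫ x, ∫ t in Icc c b, F ((x, ε), t) := by
  have h := integrableOn_thin hF hs hε hc hb
  rw [Measure.volume_eq_prod] at h ⊢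
  rw [setIntegral_prod _ h, setIntegral_univ]

theorem integral_line_dx (hf : ContDiffOn ℝ 1 f (region n B)) (hs : SupportedBy T f) {y t : ℝ}
    (hy : 0 < y) (ht : t ∈ Ioo 0 B) (i : Fin n) : ∫ x, dx i f ((x, y), t) = 0 := by
  have hd : ∀ x, HasFDerivAt (fun x : EuclideanSpace ℝ (Fin n) => f ((x, y), t))
      ((fderiv ℝ f ((x, y), t)).comp ((ContinuousLinearMap.inl ℝ (Space n) ℝ).comp
        (ContinuousLinearMap.inl ℝ (EuclideanSpace ℝ (Fin n)) ℝ))) x := fun x => by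
    have h1 := hasFDerivAt_of_region hf (p := ((x, y), t)) ⟨hy, ht⟩
    have h2 : HasFDerivAt (fun x : EuclideanSpace ℝ (Fin n) => ((x, y), t))
        ((ContinuousLinearMap.inl ℝ (Space n) ℝ).comp
        (ContinuousLinearMap.inl ℝ (EuclideanSpace ℝ (Fin n)) ℝ)) x :=
      HasFDerivAt.comp (g := fun X : Space n => (X, t)) x (hasFDerivAt_prodMk_left (x, y) t)
        (hasFDerivAt_prodMk_left x y)
    exact h1.comp x h2
  have he : ∀ x, fderiv ℝ (fun x : EuclideanSpace ℝ (Fin n) => f ((x, y), t)) x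
      (EuclideanSpace.single i 1) = dx i f ((x, y), t) := fun x => by
    rw [(hd x).fderiv]; rfl
  -- Integration by parts against the constant `1`: the integral of a derivative of a compactly
  -- supported function vanishes.
  have h := integral_mul_fderiv_eq_neg_fderiv_mul_of_integrable (𝕜 := ℝ)
    (μ := (volume : Measure (EuclideanSpace ℝ (Fin n)))) (f := fun _ => (1 : ℝ))
    (g := fun x => f ((x, y), t)) (v := EuclideanSpace.single i 1) (by simp)
    (by simpa [he] using integrable_line (continuousOn_dx hf i) (hs.dx i) hy ht)
    (by simpa using integrable_line hf.continuousOn hs hy ht) (by fun_prop)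
    (fun x _ => (hd x).differentiableAt)
  simpa [he] using h

theorem integral_height_dy (hf : ContDiffOn ℝ 1 f (region n B)) (hs : SupportedBy T f)
    (hε : 0 < ε) {t : ℝ} (ht : t ∈ Ioo 0 B) (x : EuclideanSpace ℝ (Fin n)) :
    ∫ y in Ioi ε, dy f ((x, y), t) = -f ((x, ε), t) := by
  have hd : ∀ y, 0 < y → HasDerivAt (fun y => f ((x, y), t)) (dy f ((x, y), t)) y := fun y hy => by
    have h1 := hasFDerivAt_of_region hf (p := ((x, y), t)) ⟨hy, ht⟩
    exact h1.comp_hasDerivAt y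
      (((hasDerivAt_const y x).prodMk (hasDerivAt_id y)).prodMk (hasDerivAt_const y t))
  have h0 : ∀ y, ε < y → 5 ≤ y → ∀ F : SpaceTime n → ℝ, SupportedBy T F → F ((x, y), t) = 0 :=
    fun y hy h5 F hF => by
      by_contra hne
      have := (norm_le_of_normSq (hF ((x, y), t) (hε.trans hy) ht.1 hne).1).2
      have := (le_abs_self _).trans this
      simp only at this
      linarith
  -- Any height of at least `5` lies outside the support, which is contained in `y ≤ 4`.
  set R := ε + 5 with hR
  have h1 : ∫ y in Ioi ε, dy f ((x, y), t) = ∫ y in Ioc ε R, dy f ((x, y), t) := by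
    refine setIntegral_eq_of_subset_of_forall_sdiff_eq_zero measurableSet_Ioi
      Ioc_subset_Ioi_self fun y hy => ?_
    refine h0 y hy.1 ?_ _ hs.dy
    by_contra! h
    exact hy.2 ⟨hy.1, by linarith⟩
  rw [h1, ← intervalIntegral.integral_of_le (by linarith),
    intervalIntegral.integral_eq_sub_of_hasDerivAt (f := fun y => f ((x, y), t)),
    h0 R (by linarith) (by linarith) f hs, zero_sub]
  · intro y hy
    rw [uIcc_of_le (by linarith)] at hy
    exact hd y (hε.trans_le hy.1)
  · refine ContinuousOn.intervalIntegrable ?_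
    rw [uIcc_of_le (by linarith)]
    exact (continuousOn_fderiv_apply hf ((0, 1), 0)).comp (by fun_prop)
      fun y hy => ⟨hε.trans_le hy.1, ht⟩

theorem integral_time_dt (hf : ContDiffOn ℝ 1 f (region n B)) (hs : SupportedBy T f)
    (hc : 0 < c) (hcb : c ≤ b) (hT : T < b) (hb : b < B) {X : Space n} (hX : 0 < X.2) :
    ∫ t in Icc c b, dt f (X, t) = -f (X, c) := by
  rw [integral_Icc_eq_integral_Ioc, ← intervalIntegral.integral_of_le hcb,
    intervalIntegral.integral_eq_sub_of_hasDerivAt (f := fun t => f (X, t))]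
  · have : f (X, b) = 0 := by
      by_contra hne
      have := (hs (X, b) hX (hc.trans_le hcb) hne).2
      simp only at this
      linarith
    rw [this, zero_sub]
  · intro t ht
    rw [uIcc_of_le hcb] at ht
    have h1 := hasFDerivAt_of_region hf (p := (X, t))
      ⟨hX, hc.trans_le ht.1, lt_of_le_of_lt ht.2 hb⟩
    exact h1.comp_hasDerivAt t ((hasDerivAt_const t X).prodMk (hasDerivAt_id t))
  · refine ContinuousOn.intervalIntegrable ?_
    rw [uIcc_of_le hcb]
    exact (continuousOn_fderiv_apply hf (0, 1)).comp (by fun_prop)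
      fun t ht => ⟨hX, hc.trans_le ht.1, lt_of_le_of_lt ht.2 hb⟩

theorem integral_slab_dx (hf : ContDiffOn ℝ 1 f (region n B)) (hs : SupportedBy T f)
    (hε : 0 < ε) (hc : 0 < c) (hb : b < B) (i : Fin n) : ∫ p in slab n ε c b, dx i f p = 0 := by
  rw [integral_slab_eq (continuousOn_dx hf i) (hs.dx i) hε hc hb]
  refine setIntegral_eq_zero_of_forall_eq_zero fun t ht => ?_
  have ht' : t ∈ Ioo 0 B := ⟨hc.trans_le ht.1, lt_of_le_of_lt ht.2 hb⟩
  rw [integral_slice_eq' (continuousOn_dx hf i) (hs.dx i) hε ht']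
  exact setIntegral_eq_zero_of_forall_eq_zero fun y hy =>
    integral_line_dx hf hs (hε.trans hy) ht' i

theorem integral_slab_dy (hf : ContDiffOn ℝ 1 f (region n B)) (hs : SupportedBy T f)
    (hε : 0 < ε) (hc : 0 < c) (hb : b < B) :
    ∫ p in slab n ε c b, dy f p
      = -∫ z in (univ : Set (EuclideanSpace ℝ (Fin n))) ×ˢ Icc c b, f ((z.1, ε), z.2) := by
  rw [integral_slab_eq (continuousOn_dy hf) hs.dy hε hc hb,
    integral_thin_eq hf.continuousOn hs hε hc hb, ← integral_neg]
  refine setIntegral_congr_fun measurableSet_Icc fun t ht => ?_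
  have ht' : t ∈ Ioo 0 B := ⟨hc.trans_le ht.1, lt_of_le_of_lt ht.2 hb⟩
  rw [integral_slice_eq (continuousOn_dy hf) hs.dy hε ht', ← integral_neg]
  exact integral_congr_ae (Eventually.of_forall fun x => integral_height_dy hf hs hε ht' x)

theorem integral_slab_dt (hf : ContDiffOn ℝ 1 f (region n B)) (hs : SupportedBy T f)
    (hε : 0 < ε) (hc : 0 < c) (hcb : c ≤ b) (hT : T < b) (hb : b < B) :
    ∫ p in slab n ε c b, dt f p = -∫ X in univ ×ˢ Ioi ε, f (X, c) := by
  rw [integral_slab_eq' (continuousOn_dt hf) hs.dt hε hc hb, ← integral_neg]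
  exact setIntegral_congr_fun (MeasurableSet.univ.prod measurableSet_Ioi) fun X hX =>
    integral_time_dt hf hs hc hcb hT hb (hε.trans hX.2)

theorem integral_thin_dx (hf : ContDiffOn ℝ 1 f (region n B)) (hs : SupportedBy T f)
    (hε : 0 < ε) (hc : 0 < c) (hb : b < B) (i : Fin n) :
    ∫ z in (univ : Set (EuclideanSpace ℝ (Fin n))) ×ˢ Icc c b, dx i f ((z.1, ε), z.2) = 0 := by
  rw [integral_thin_eq (continuousOn_dx hf i) (hs.dx i) hε hc hb]
  exact setIntegral_eq_zero_of_forall_eq_zero fun t ht =>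
    integral_line_dx hf hs hε ⟨hc.trans_le ht.1, lt_of_le_of_lt ht.2 hb⟩ i

theorem integral_thin_dt (hf : ContDiffOn ℝ 1 f (region n B)) (hs : SupportedBy T f)
    (hε : 0 < ε) (hc : 0 < c) (hcb : c ≤ b) (hT : T < b) (hb : b < B) :
    ∫ z in (univ : Set (EuclideanSpace ℝ (Fin n))) ×ˢ Icc c b, dt f ((z.1, ε), z.2)
      = -∫ x, f ((x, ε), c) := by
  rw [integral_thin_eq' (continuousOn_dt hf) hs.dt hε hc hb, ← integral_neg]
  exact integral_congr_ae (Eventually.of_forall fun x =>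
    integral_time_dt hf hs hc hcb hT hb (X := (x, ε)) hε)

end Integration

end ThinCarleman

/-! ### The weighted trace inequality at the scale `√(t/α)`. -/

namespace ThinCarleman

/-- A one-dimensional weighted trace inequality. -/
theorem trace_line {a ε r : ℝ} (ha : a ∈ Ioo (-1 : ℝ) 1) (hε : 0 < ε) (hεr : ε ≤ r)
    (hχ : (ε / r) ^ (1 + a) ≤ 1 / 2) {g g' : ℝ → ℝ} (hg : ∀ y, 0 < y → HasDerivAt g (g' y) y)
    (hg' : ContinuousOn g' (Ioi 0)) :
    g ε ^ 2 ≤ 2 * Real.exp 1 * ((1 + a) + 1 / (1 - a)) * r ^ (1 - a)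
      * ∫ y in ε..r, y ^ a * (g' y ^ 2 + 1 / r ^ 2 * g y ^ 2) := by
  have hr : 0 < r := hε.trans_le hεr
  have ha1 : 0 < 1 + a := by linarith [ha.1]
  have ha2 : 0 < 1 - a := by linarith [ha.2]
  -- The function `exp(A) χ g²` is differentiated between `ε` and `r`. The cutoff `χ` removes the
  -- endpoint `r`, is at least `1/2` at `ε`, and has derivative a multiple of `y^a`. The factor
  -- `exp(A)` supplies `A' g²`, which absorbs the cross term `2 g g'` at the cost of `g'²/A'`; again
  -- `1/A'` is a multiple of `y^a`.
  set A : ℝ → ℝ := fun y => (y / r) ^ (1 - a) with hA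
  set χ : ℝ → ℝ := fun y => 1 - (y / r) ^ (1 + a) with hχ'
  have hpow : ∀ e y, 0 < y → HasDerivAt (fun y : ℝ => (y / r) ^ e) (e * (y / r) ^ e / y) y := by
    intro e y hy
    have h1 := (Real.hasDerivAt_rpow_const (p := e) (Or.inl (div_pos hy hr).ne')).comp y
      ((hasDerivAt_id y).div_const r)
    refine h1.congr_deriv ?_
    rw [Real.rpow_sub_one (div_pos hy hr).ne']
    field_simp
  set D : ℝ → ℝ := fun y => -(Real.exp (A y) * ((1 - a) * A y / y) * χ y * g y ^ 2
    - Real.exp (A y) * ((1 + a) * (y / r) ^ (1 + a) / y) * g y ^ 2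
    + Real.exp (A y) * χ y * (2 * g y * g' y)) with hD
  have hder : ∀ y, 0 < y → HasDerivAt (fun y => -(Real.exp (A y) * χ y * g y ^ 2)) (D y) y := by
    intro y hy
    refine ((((hpow (1 - a) y hy).exp.mul ((hpow (1 + a) y hy).const_sub 1)).mul
      ((hg y hy).pow 2)).neg).congr_deriv ?_
    simp only [hD, hA, hχ', Pi.mul_apply, Pi.pow_apply]
    ring
  have hgc : ContinuousOn g (Ioi 0) := fun y hy => (hg y hy).continuousAt.continuousWithinAt
  have hpc : ∀ e : ℝ, ContinuousOn (fun y : ℝ => (y / r) ^ e) (Ioi 0) := fun e y hy =>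
    (hpow e y hy).continuousAt.continuousWithinAt
  have hDc : ContinuousOn D (Ioi 0) := by
    have hE : ContinuousOn (fun y => Real.exp (A y)) (Ioi 0) :=
      Real.continuous_exp.comp_continuousOn (hpc _)
    have hX : ContinuousOn χ (Ioi 0) := continuousOn_const.sub (hpc _)
    have hne : ∀ y ∈ Ioi (0 : ℝ), y ≠ 0 := fun y hy => ne_of_gt hy
    exact ((((hE.mul ((continuousOn_const.mul (hpc _)).div continuousOn_id hne)).mul hX).mul
      (hgc.pow 2)).sub ((hE.mul ((continuousOn_const.mul (hpc _)).div continuousOn_id hne)).mul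
      (hgc.pow 2)) |>.add ((hE.mul hX).mul ((continuousOn_const.mul hgc).mul hg'))).neg
  have hsub : uIcc ε r ⊆ Ioi 0 := by
    rw [uIcc_of_le hεr]; exact fun y hy => hε.trans_le hy.1
  have hftc := intervalIntegral.integral_eq_sub_of_hasDerivAt
    (fun y hy => hder y (hsub hy)) (hDc.mono hsub).intervalIntegrable
  have hχr : χ r = 0 := by simp [hχ', div_self hr.ne']
  set C := Real.exp 1 * ((1 + a) + 1 / (1 - a)) * r ^ (1 - a) with hC
  have hRc : ContinuousOn (fun y => C * (y ^ a * (g' y ^ 2 + 1 / r ^ 2 * g y ^ 2))) (Ioi 0) := by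
    refine continuousOn_const.mul (ContinuousOn.mul (fun y hy => ?_)
      ((hg'.pow 2).add (continuousOn_const.mul (hgc.pow 2))))
    exact (Real.continuousAt_rpow_const y a (Or.inl (ne_of_gt hy))).continuousWithinAt
  have hbound : ∀ y ∈ Icc ε r, D y ≤ C * (y ^ a * (g' y ^ 2 + 1 / r ^ 2 * g y ^ 2)) := by
    intro y hy
    have hy0 : 0 < y := hε.trans_le hy.1
    have hyr : y / r ≤ 1 := (div_le_one hr).2 hy.2
    have hyr0 : 0 < y / r := div_pos hy0 hr
    have hA1 : A y ≤ 1 := Real.rpow_le_one hyr0.le hyr ha2.le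
    have hA0 : 0 < A y := Real.rpow_pos_of_pos hyr0 _
    have hE1 : Real.exp (A y) ≤ Real.exp 1 := Real.exp_le_exp.2 hA1
    have hχ0 : 0 ≤ χ y := by
      have := Real.rpow_le_one hyr0.le hyr ha1.le
      simp only [hχ']; linarith
    have hχ1 : χ y ≤ 1 := by
      have := Real.rpow_nonneg hyr0.le (1 + a)
      simp only [hχ']; linarith
    have e1 : (y / r) ^ (1 + a) / y = r ^ (1 - a) * y ^ a * (1 / r ^ 2) := by
      rw [Real.div_rpow hy0.le hr.le, Real.rpow_add hy0, Real.rpow_one,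
        show (1 - a) = 2 - (1 + a) by ring, Real.rpow_sub hr, Real.rpow_two]
      field_simp
    have e2 : 1 / ((1 - a) * A y / y) = 1 / (1 - a) * (r ^ (1 - a) * y ^ a) := by
      simp only [hA]
      rw [Real.div_rpow hy0.le hr.le, Real.rpow_sub hy0, Real.rpow_one]
      have := (Real.rpow_pos_of_pos hy0 a).ne'
      have := (Real.rpow_pos_of_pos hr (1 - a)).ne'
      field_simp
    set A' := (1 - a) * A y / y with hA'
    have hA'0 : 0 < A' := by positivity
    -- Completing the square removes the cross term without loss.
    have hsq : 0 ≤ A' * g y ^ 2 + 2 * g y * g' y + 1 / A' * g' y ^ 2 := by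
      have : A' * g y ^ 2 + 2 * g y * g' y + 1 / A' * g' y ^ 2 = A' * (g y + g' y / A') ^ 2 := by
        field_simp
        ring
      rw [this]; positivity
    have e3 : D y = Real.exp (A y) * ((1 + a) * ((y / r) ^ (1 + a) / y) * g y ^ 2
        + χ y * (1 / A' * g' y ^ 2)
        - χ y * (A' * g y ^ 2 + 2 * g y * g' y + 1 / A' * g' y ^ 2)) := by
      simp only [hD]; ring
    have hP : 0 < r ^ (1 - a) * y ^ a := by positivity
    rw [e3, e1, e2]
    rw [e2] at hsq
    set P := r ^ (1 - a) * y ^ a with hPdef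
    have k1 : (1 + a) * (P * (1 / r ^ 2)) * g y ^ 2 + χ y * (1 / (1 - a) * P * g' y ^ 2)
        - χ y * (A' * g y ^ 2 + 2 * g y * g' y + 1 / (1 - a) * P * g' y ^ 2)
        ≤ ((1 + a) + 1 / (1 - a)) * (P * (g' y ^ 2 + 1 / r ^ 2 * g y ^ 2)) := by
      have m1 : χ y * (1 / (1 - a) * P * g' y ^ 2) ≤ 1 / (1 - a) * P * g' y ^ 2 :=
        mul_le_of_le_one_left (by positivity) hχ1
      have m2 := mul_nonneg hχ0 hsq
      have m3 : 0 ≤ (1 + a) * (P * g' y ^ 2) := by positivity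
      have m4 : 0 ≤ 1 / (1 - a) * (P * (1 / r ^ 2 * g y ^ 2)) := by positivity
      nlinarith
    calc _ ≤ Real.exp (A y) * (((1 + a) + 1 / (1 - a)) * (P * (g' y ^ 2 + 1 / r ^ 2 * g y ^ 2))) :=
          mul_le_mul_of_nonneg_left k1 (Real.exp_pos _).le
      _ ≤ Real.exp 1 * (((1 + a) + 1 / (1 - a)) * (P * (g' y ^ 2 + 1 / r ^ 2 * g y ^ 2))) :=
          mul_le_mul_of_nonneg_right hE1 (by positivity)
      _ = _ := by rw [hC, hPdef]; ring
  have hi1 : IntervalIntegrable D volume ε r := (hDc.mono hsub).intervalIntegrable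
  have hi2 := (hRc.mono hsub).intervalIntegrable (μ := volume)
  have hle := intervalIntegral.integral_mono_on hεr hi1 hi2 hbound
  rw [hftc, hχr, intervalIntegral.integral_const_mul] at hle
  have hχε : 1 / 2 ≤ χ ε := by simp only [hχ']; linarith
  have hE : 1 ≤ Real.exp (A ε) := Real.one_le_exp (Real.rpow_nonneg (by positivity) _)
  have h2 : 1 / 2 * g ε ^ 2 ≤ Real.exp (A ε) * χ ε * g ε ^ 2 := by
    refine mul_le_mul_of_nonneg_right ?_ (sq_nonneg _)
    nlinarith
  simp only [mul_zero, zero_mul, neg_zero, zero_sub, neg_neg] at hle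
  have h3 : 2 * Real.exp 1 * ((1 + a) + 1 / (1 - a)) * r ^ (1 - a) = 2 * C := by rw [hC]; ring
  rw [h3]
  linarith

variable {n : ℕ}

/-- The constant of the trace inequality. -/
noncomputable def traceConst (a : ℝ) : ℝ := 2 * Real.exp 1 * ((1 + a) + 1 / (1 - a)) * Real.exp 1

theorem traceConst_pos {a : ℝ} (ha : a ∈ Ioo (-1 : ℝ) 1) : 0 < traceConst a := by
  have ha1 : 0 < 1 + a := by linarith [ha.1]
  have ha2 : 0 < 1 - a := by linarith [ha.2]
  unfold traceConst
  positivity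

theorem gradSq_nonneg (w : SpaceTime n → ℝ) (p : SpaceTime n) : 0 ≤ gradSq w p :=
  add_nonneg (Finset.sum_nonneg fun _ _ => sq_nonneg _) (sq_nonneg _)

theorem sq_dy_le_gradSq (w : SpaceTime n → ℝ) (p : SpaceTime n) : dy w p ^ 2 ≤ gradSq w p :=
  le_add_of_nonneg_left (Finset.sum_nonneg fun _ _ => sq_nonneg _)

theorem thinGauss_pos (a : ℝ) {p : SpaceTime n} (ht : 0 < p.2) : 0 < thinGauss a p := by
  unfold thinGauss; positivity

theorem rho_pos (a : ℝ) {p : SpaceTime n} (hy : 0 < p.1.2) (ht : 0 < p.2) : 0 < rho a p := by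
  unfold rho gauss; positivity

theorem continuousOn_thinGauss (a B : ℝ) : ContinuousOn (thinGauss (n := n) a) (region n B) :=
  fun p hp => by
    obtain ⟨L, hL, -⟩ := exists_fderiv_thinGauss a (p := p) hp.2.1
    exact hL.continuousAt.continuousWithinAt

theorem continuousOn_rho (a B : ℝ) : ContinuousOn (rho (n := n) a) (region n B) :=
  fun p hp => by
    obtain ⟨L, hL, -⟩ := exists_fderiv_rho a (p := p) hp.1 hp.2.1
    exact hL.continuousAt.continuousWithinAt

section Slice

variable {B T : ℝ} {w : SpaceTime n → ℝ}

theorem SupportedBy.gradSq (hw : SupportedBy T w) : SupportedBy T (gradSq w) :=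
  (SupportedBy.sum _ fun i => (hw.dx i).sq).add hw.dy.sq

theorem continuousOn_gradSq (hw : ContDiffOn ℝ 1 w (region n B)) :
    ContinuousOn (gradSq w) (region n B) :=
  (continuousOn_finsetSum _ fun i _ => (continuousOn_dx hw i).pow 2).add
    ((continuousOn_dy hw).pow 2)

/-- The energy density in the trace inequality. -/
noncomputable def traceDensity (a α : ℝ) (w : SpaceTime n → ℝ) (p : SpaceTime n) : ℝ :=
  rho a p * (gradSq w p + α / p.2 * w p ^ 2)

theorem SupportedBy.traceDensity (hw : SupportedBy T w) (a α : ℝ) :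
    SupportedBy T (traceDensity a α w) :=
  (hw.gradSq.add (hw.sq.mul_left _)).mul_left _

theorem continuousOn_traceDensity (hw : ContDiffOn ℝ 1 w (region n B)) (a α : ℝ) :
    ContinuousOn (traceDensity a α w) (region n B) :=
  (continuousOn_rho a B).mul ((continuousOn_gradSq hw).add ((continuousOn_const.div
    continuousOn_snd fun _ hp => hp.2.1.ne').mul (hw.continuousOn.pow 2)))

theorem traceDensity_nonneg {a α : ℝ} (hα : 0 ≤ α) (w : SpaceTime n → ℝ) {p : SpaceTime n}
    (hy : 0 < p.1.2) (ht : 0 < p.2) : 0 ≤ traceDensity a α w p :=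
  mul_nonneg (rho_pos a hy ht).le
    (add_nonneg (gradSq_nonneg w p) (mul_nonneg (div_nonneg hα ht.le) (sq_nonneg _)))

/-- The one-dimensional inequality is applied on every vertical line with `r = √(t/α)`: then
`r^{1-a} = (t/α)^s`, and `1/r²` is the coefficient `α/t` at which the Carleman estimate controls
`w²`. -/
theorem trace_slice {a s α ε t : ℝ} (ha : a ∈ Ioo (-1 : ℝ) 1) (has : a = 1 - 2 * s) (hα : 1 ≤ α)
    (hw : ContDiffOn ℝ 1 w (region n B)) (hs : SupportedBy T w) (hε : 0 < ε) (ht : t ∈ Ioo 0 B)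
    (hεr : ε ≤ √(t / α)) (hχ : (ε / √(t / α)) ^ (1 + a) ≤ 1 / 2) :
    ∫ x, thinGauss a ((x, ε), t) * w ((x, ε), t) ^ 2
      ≤ traceConst a * (t / α) ^ s * ∫ X in univ ×ˢ Ioi ε, traceDensity a α w (X, t) := by
  have hα0 : 0 < α := by linarith
  have hcT := continuousOn_traceDensity (a := a) (α := α) hw
  have hsT := hs.traceDensity a α
  rw [integral_slice_eq hcT hsT hε ht, ← integral_const_mul]
  have hint : Integrable fun x => ∫ y in Ioi ε, traceDensity a α w ((x, y), t) := by
    have h := integrableOn_slice hcT hsT hε ht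
    rw [IntegrableOn, Measure.volume_eq_prod, ← Measure.prod_restrict, Measure.restrict_univ] at h
    exact h.integral_prod_left
  refine integral_mono (integrable_line ((continuousOn_thinGauss a B).mul (hw.continuousOn.pow 2))
    (hs.sq.mul_left _) hε ht) (hint.const_mul _) fun x => ?_
  have hd : ∀ y, 0 < y → HasDerivAt (fun y => w ((x, y), t)) (dy w ((x, y), t)) y := fun y hy => by
    have h1 := hasFDerivAt_of_region hw (p := ((x, y), t)) ⟨hy, ht⟩
    exact h1.comp_hasDerivAt y
      (((hasDerivAt_const y x).prodMk (hasDerivAt_id y)).prodMk (hasDerivAt_const y t))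
  have hdc : ContinuousOn (fun y => dy w ((x, y), t)) (Ioi 0) :=
    (continuousOn_dy hw).comp (by fun_prop) fun y hy => ⟨hy, ht⟩
  have hline := trace_line ha hε hεr hχ hd hdc
  set r := √(t / α) with hr
  have htα : 0 < t / α := div_pos ht.1 hα0
  have hr0 : 0 < r := Real.sqrt_pos.2 htα
  have hr2 : r ^ 2 = t / α := Real.sq_sqrt htα.le
  have hrs : r ^ (1 - a) = (t / α) ^ s := by
    rw [hr, Real.sqrt_eq_rpow, ← Real.rpow_mul htα.le]
    congr 1; rw [has]; ring
  have hr2' : 1 / r ^ 2 = α / t := by rw [hr2]; field_simp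
  rw [hrs, hr2'] at hline
  set g0 := thinGauss a ((x, ε), t) with hg0
  have hg0' : 0 < g0 := thinGauss_pos a ht.1
  have hgy : ∀ y, thinGauss a ((x, y), t) = g0 := fun y => rfl
  have hTc : ContinuousOn (fun y => traceDensity a α w ((x, y), t)) (Ioi 0) :=
    hcT.comp (by fun_prop) fun y hy => ⟨hy, ht⟩
  have hTint : IntegrableOn (fun y => traceDensity a α w ((x, y), t)) (Ioi ε) := by
    refine IntegrableOn.of_forall_sdiff_eq_zero ((hTc.mono (show Icc ε 4 ⊆ Ioi 0 from
      fun y hy => hε.trans_le hy.1)).integrableOn_compact isCompact_Icc) measurableSet_Ioi fun y hy => ?_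
    by_contra hne
    have h2 := norm_le_of_normSq (hsT ((x, y), t) (hε.trans hy.1) ht.1 hne).1
    exact hy.2 ⟨le_of_lt hy.1, (le_abs_self _).trans h2.2⟩
  have hsub : uIcc ε r ⊆ Ioi 0 := by
    rw [uIcc_of_le hεr]; exact fun y hy => hε.trans_le hy.1
  have hle : g0 * ∫ y in ε..r, y ^ a * (dy w ((x, y), t) ^ 2 + α / t * w ((x, y), t) ^ 2)
      ≤ Real.exp 1 * ∫ y in ε..r, traceDensity a α w ((x, y), t) := by
    rw [← intervalIntegral.integral_const_mul, ← intervalIntegral.integral_const_mul]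
    refine intervalIntegral.integral_mono_on hεr ?_ ?_ fun y hy => ?_
    · refine (continuousOn_const.mul (ContinuousOn.mul (fun y hy => ?_) ((hdc.pow 2).add
        (continuousOn_const.mul (ContinuousOn.pow (fun y hy =>
          (hd y hy).continuousAt.continuousWithinAt) 2))))).mono hsub |>.intervalIntegrable
      exact (Real.continuousAt_rpow_const y a (Or.inl (ne_of_gt hy))).continuousWithinAt
    · exact ((continuousOn_const.mul hTc).mono hsub).intervalIntegrable
    · have hy0 : 0 < y := hε.trans_le hy.1
      -- For `y ≤ r ≤ √t`, which needs `α ≥ 1`, the vertical factor of the Gaussian costs at most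
      -- `e`. This is the last factor of `traceConst`.
      have hexp : 1 ≤ Real.exp 1 * Real.exp (-y ^ 2 / (4 * t)) := by
        rw [← Real.exp_add]
        refine Real.one_le_exp ?_
        have : y ^ 2 ≤ t := by
          calc y ^ 2 ≤ r ^ 2 := by gcongr; exact hy.2
            _ = t / α := hr2
            _ ≤ t := div_le_self ht.1.le hα
        have h4 : y ^ 2 / (4 * t) ≤ 1 := by
          rw [div_le_one (by linarith [ht.1])]; linarith [ht.1]
        rw [neg_div]; linarith
      simp only [traceDensity, rho_eq, hgy]
      have k1 : dy w ((x, y), t) ^ 2 + α / t * w ((x, y), t) ^ 2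
          ≤ gradSq w ((x, y), t) + α / t * w ((x, y), t) ^ 2 := by
        gcongr; exact sq_dy_le_gradSq _ _
      have k0 : 0 ≤ gradSq w ((x, y), t) + α / t * w ((x, y), t) ^ 2 :=
        add_nonneg (gradSq_nonneg _ _) (mul_nonneg (div_nonneg hα0.le ht.1.le) (sq_nonneg _))
      have hya : 0 < y ^ a := Real.rpow_pos_of_pos hy0 a
      calc _ ≤ g0 * (y ^ a * (gradSq w ((x, y), t) + α / t * w ((x, y), t) ^ 2)) := by gcongr
        _ ≤ g0 * (y ^ a * (gradSq w ((x, y), t) + α / t * w ((x, y), t) ^ 2))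
            * (Real.exp 1 * Real.exp (-y ^ 2 / (4 * t))) :=
          le_mul_of_one_le_right (by positivity) hexp
        _ = _ := by ring
  have hle2 : ∫ y in ε..r, traceDensity a α w ((x, y), t)
      ≤ ∫ y in Ioi ε, traceDensity a α w ((x, y), t) := by
    rw [intervalIntegral.integral_of_le hεr]
    refine setIntegral_mono_set hTint ?_ Ioc_subset_Ioi_self.eventuallyLE
    filter_upwards [ae_restrict_mem measurableSet_Ioi] with y hy
    exact traceDensity_nonneg hα0.le w (hε.trans hy) ht.1
  have ha1 : 0 < 1 + a := by linarith [ha.1]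
  have ha2 : 0 < 1 - a := by linarith [ha.2]
  set I0 := ∫ y in ε..r, y ^ a * (dy w ((x, y), t) ^ 2 + α / t * w ((x, y), t) ^ 2)
  calc g0 * w ((x, ε), t) ^ 2
      ≤ g0 * (2 * Real.exp 1 * ((1 + a) + 1 / (1 - a)) * (t / α) ^ s * I0) := by gcongr
    _ = 2 * Real.exp 1 * ((1 + a) + 1 / (1 - a)) * (t / α) ^ s * (g0 * I0) := by ring
    _ ≤ 2 * Real.exp 1 * ((1 + a) + 1 / (1 - a)) * (t / α) ^ s
        * (Real.exp 1 * ∫ y in Ioi ε, traceDensity a α w ((x, y), t)) := by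
      refine mul_le_mul_of_nonneg_left (hle.trans (by gcongr)) (by positivity)
    _ = _ := by rw [traceConst]; ring

end Slice

end ThinCarleman

/-! ### Regularity of the fluxes and integration of the pointwise inequality. -/

namespace ThinCarleman

variable {n : ℕ}

section Regularity

variable {a B T : ℝ} {w : SpaceTime n → ℝ} {m b : ℝ → ℝ}

theorem contDiffAt_of_region (hw : ContDiffOn ℝ ∞ w (region n B)) {p : SpaceTime n}
    (hp : p ∈ region n B) : ContDiffAt ℝ ∞ w p :=
  hw.contDiffAt ((isOpen_region B).mem_nhds hp)

theorem contDiffOn_dx (hw : ContDiffOn ℝ ∞ w (region n B)) (i : Fin n) :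
    ContDiffOn ℝ ∞ (dx i w) (region n B) := fun _ hp =>
  (contDiffAt_dx (contDiffAt_of_region hw hp) i).contDiffWithinAt

theorem contDiffOn_dy (hw : ContDiffOn ℝ ∞ w (region n B)) :
    ContDiffOn ℝ ∞ (dy w) (region n B) := fun _ hp =>
  (contDiffAt_dy (contDiffAt_of_region hw hp)).contDiffWithinAt

theorem contDiffOn_dt (hw : ContDiffOn ℝ ∞ w (region n B)) :
    ContDiffOn ℝ ∞ (dt w) (region n B) := fun _ hp =>
  (contDiffAt_dt (contDiffAt_of_region hw hp)).contDiffWithinAt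

theorem contDiffOn_time (hm : ContDiffOn ℝ 1 m (Ioo 0 B)) :
    ContDiffOn ℝ 1 (fun p : SpaceTime n => m p.2) (region n B) :=
  hm.comp contDiff_snd.contDiffOn fun _ hp => hp.2

theorem continuousOn_time (hm : ContinuousOn m (Ioo 0 B)) :
    ContinuousOn (fun p : SpaceTime n => m p.2) (region n B) :=
  hm.comp continuous_snd.continuousOn fun _ hp => hp.2

theorem contDiffOn_height_rpow (e B : ℝ) :
    ContDiffOn ℝ 1 (fun p : SpaceTime n => p.1.2 ^ e) (region n B) := fun p hp =>
  ((contDiffAt_snd.comp p contDiffAt_fst).rpow_const_of_ne (ne_of_gt hp.1)).contDiffWithinAt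

theorem contDiffOn_inv_two_mul (B : ℝ) :
    ContDiffOn ℝ 1 (fun p : SpaceTime n => 1 / (2 * p.2)) (region n B) :=
  ContDiffOn.div contDiffOn_const (by fun_prop) fun _ hp =>
    mul_ne_zero two_ne_zero (ne_of_gt hp.2.1)

theorem contDiffOn_thinGauss (a B : ℝ) : ContDiffOn ℝ 1 (thinGauss (n := n) a) (region n B) :=
  fun p hp => by
    have ht : p.2 ≠ 0 := hp.2.1.ne'
    refine ContDiffAt.contDiffWithinAt (ContDiffAt.mul (ContDiffAt.div contDiffAt_const
      (contDiffAt_snd.rpow_const_of_ne ht) (Real.rpow_pos_of_pos hp.2.1 _).ne')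
      (ContDiffAt.exp (ContDiffAt.div ?_ (contDiffAt_const.mul contDiffAt_snd)
        (mul_ne_zero four_ne_zero ht))))
    exact ((contDiffAt_fst.comp p contDiffAt_fst).norm_sq ℝ).neg

theorem contDiffOn_rho (a B : ℝ) : ContDiffOn ℝ 1 (rho (n := n) a) (region n B) := fun p hp => by
  rw [show rho (n := n) a = fun p => p.1.2 ^ a *
    (thinGauss a p * Real.exp (-p.1.2 ^ 2 / (4 * p.2))) from funext (rho_eq a)]
  refine (contDiffOn_height_rpow a B p hp).mul ((contDiffOn_thinGauss a B p hp).mul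
    (ContDiffAt.contDiffWithinAt (ContDiffAt.exp (ContDiffAt.div ?_
    (contDiffAt_const.mul contDiffAt_snd) (mul_ne_zero four_ne_zero hp.2.1.ne')))))
  exact ((contDiffAt_snd.comp p contDiffAt_fst).pow 2).neg

theorem contDiffOn_gradSq (hw : ContDiffOn ℝ ∞ w (region n B)) :
    ContDiffOn ℝ ∞ (gradSq w) (region n B) := fun _ hp =>
  (contDiffAt_gradSq (contDiffAt_of_region hw hp)).contDiffWithinAt

theorem contDiffOn_drift (hw : ContDiffOn ℝ ∞ w (region n B)) :
    ContDiffOn ℝ ∞ (drift w) (region n B) := fun _ hp =>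
  (contDiffAt_drift (ne_of_gt hp.2.1) (contDiffAt_of_region hw hp)).contDiffWithinAt

theorem one_le_infty : (1 : WithTop ℕ∞) ≤ ((⊤ : ℕ∞) : WithTop ℕ∞) := WithTop.coe_le_coe.2 le_top

theorem contDiffOn_fluxMult (hw : ContDiffOn ℝ ∞ w (region n B)) (hm : ContDiffOn ℝ 1 m (Ioo 0 B))
    (hb : ContDiffOn ℝ 1 b (Ioo 0 B)) : ContDiffOn ℝ 1 (fluxMult m b w) (region n B) :=
  (contDiffOn_const.mul (contDiffOn_time hm)).mul (((contDiffOn_drift hw).of_le one_le_infty).sub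
    ((contDiffOn_time hb).mul (hw.of_le one_le_infty)))

theorem contDiffOn_fluxEnergy (hw : ContDiffOn ℝ ∞ w (region n B))
    (hm : ContDiffOn ℝ 1 m (Ioo 0 B)) (hb : ContDiffOn ℝ 1 b (Ioo 0 B)) :
    ContDiffOn ℝ 1 (fluxEnergy m b w) (region n B) :=
  (contDiffOn_time hm).mul (((contDiffOn_time hb).mul ((hw.of_le one_le_infty).pow 2)).sub
    ((contDiffOn_gradSq hw).of_le one_le_infty))

theorem contDiff_coord (i : Fin n) : ContDiff ℝ 1 (fun p : SpaceTime n => p.1.1 i) :=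
  (EuclideanSpace.proj i : EuclideanSpace ℝ (Fin n) →L[ℝ] ℝ).contDiff.comp
    (contDiff_fst.comp contDiff_fst)

theorem contDiffOn_fluxX (hw : ContDiffOn ℝ ∞ w (region n B)) (hm : ContDiffOn ℝ 1 m (Ioo 0 B))
    (hb : ContDiffOn ℝ 1 b (Ioo 0 B)) (i : Fin n) :
    ContDiffOn ℝ 1 (fluxX a m b w i) (region n B) :=
  (contDiffOn_rho a B).mul (((contDiffOn_fluxMult hw hm hb).mul
    ((contDiffOn_dx hw i).of_le one_le_infty)).add ((contDiffOn_fluxEnergy hw hm hb).mul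
      ((contDiff_coord i).contDiffOn.mul (contDiffOn_inv_two_mul B))))

theorem contDiffOn_fluxY (hw : ContDiffOn ℝ ∞ w (region n B)) (hm : ContDiffOn ℝ 1 m (Ioo 0 B))
    (hb : ContDiffOn ℝ 1 b (Ioo 0 B)) : ContDiffOn ℝ 1 (fluxY a m b w) (region n B) :=
  (contDiffOn_rho a B).mul (((contDiffOn_fluxMult hw hm hb).mul
    ((contDiffOn_dy hw).of_le one_le_infty)).add ((contDiffOn_fluxEnergy hw hm hb).mul
      ((contDiff_snd.comp contDiff_fst).contDiffOn.mul (contDiffOn_inv_two_mul B))))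

theorem contDiffOn_fluxT (hw : ContDiffOn ℝ ∞ w (region n B)) (hm : ContDiffOn ℝ 1 m (Ioo 0 B))
    (hb : ContDiffOn ℝ 1 b (Ioo 0 B)) : ContDiffOn ℝ 1 (fluxT a m b w) (region n B) :=
  (contDiffOn_rho a B).mul (contDiffOn_fluxEnergy hw hm hb)

theorem SupportedBy.fluxEnergy (hs : SupportedBy T w) : SupportedBy T (fluxEnergy m b w) :=
  ((hs.sq.mul_left _).sub hs.gradSq).mul_left _

theorem SupportedBy.fluxX (hs : SupportedBy T w) (i : Fin n) : SupportedBy T (fluxX a m b w i) :=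
  (((hs.dx i).mul_left _).add (hs.fluxEnergy.mul_right _)).mul_left _

theorem SupportedBy.fluxY (hs : SupportedBy T w) : SupportedBy T (fluxY a m b w) :=
  ((hs.dy.mul_left _).add (hs.fluxEnergy.mul_right _)).mul_left _

theorem SupportedBy.fluxT (hs : SupportedBy T w) : SupportedBy T (fluxT a m b w) :=
  hs.fluxEnergy.mul_left _

/-- The square of the operator in the weighted norm of the Carleman inequality. -/
noncomputable def opDensity (a : ℝ) (w : SpaceTime n → ℝ) (p : SpaceTime n) : ℝ :=
  p.1.2 ^ (-a) * extOp a w p ^ 2 * gauss a p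

theorem continuousOn_gauss (a B : ℝ) : ContinuousOn (gauss (n := n) a) (region n B) := by
  refine ((continuousOn_rho a B).mul (contDiffOn_height_rpow (-a) B).continuousOn).congr
    fun p hp => ?_
  have : 0 < p.1.2 ^ a := Real.rpow_pos_of_pos hp.1 a
  have hy : 0 < p.1.2 := hp.1
  change gauss a p = p.1.2 ^ a * gauss a p * p.1.2 ^ (-a)
  rw [Real.rpow_neg hy.le]
  field_simp

theorem continuousOn_extOp (hw : ContDiffOn ℝ ∞ w (region n B)) :
    ContinuousOn (extOp a w) (region n B) := by
  refine ContinuousOn.congr (f := fun p => p.1.2 ^ a * (dt w p + ((∑ i, dx i (dx i w) p)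
    + dy (dy w) p + a / p.1.2 * dy w p))) ?_ fun p hp => extOp_eq hp.1 (contDiffAt_of_region hw hp)
  have h : ContinuousOn (fun p : SpaceTime n => a / p.1.2) (region n B) :=
    continuousOn_const.div (by fun_prop) fun p hp => ne_of_gt hp.1
  exact (contDiffOn_height_rpow a B).continuousOn.mul ((contDiffOn_dt hw).continuousOn.add
    (((continuousOn_finsetSum _ fun i _ => (contDiffOn_dx (contDiffOn_dx hw i) i).continuousOn).add
      (contDiffOn_dy (contDiffOn_dy hw)).continuousOn).add (h.mul (contDiffOn_dy hw).continuousOn)))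

theorem continuousOn_opDensity (hw : ContDiffOn ℝ ∞ w (region n B)) :
    ContinuousOn (opDensity a w) (region n B) :=
  ((contDiffOn_height_rpow (-a) B).continuousOn.mul ((continuousOn_extOp hw).pow 2)).mul
    (continuousOn_gauss a B)

theorem SupportedBy.extOp (hs : SupportedBy T w) : SupportedBy T (extOp a w) :=
  (hs.dt.mul_left _).add ((SupportedBy.sum _ fun i => ((hs.dx i).mul_left _).dx i).add
    (hs.dy.mul_left _).dy)

theorem SupportedBy.opDensity (hs : SupportedBy T w) : SupportedBy T (opDensity a w) :=
  (hs.extOp.sq.mul_left _).mul_right _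

/-- The density gained in the Carleman inequality. -/
noncomputable def gainDensity (a : ℝ) (b : ℝ → ℝ) (w : SpaceTime n → ℝ) (p : SpaceTime n) : ℝ :=
  rho a p * (gradSq w p + b p.2 * w p ^ 2)

theorem continuousOn_gainDensity (hw : ContDiffOn ℝ ∞ w (region n B))
    (hb : ContinuousOn b (Ioo 0 B)) : ContinuousOn (gainDensity a b w) (region n B) :=
  (continuousOn_rho a B).mul ((contDiffOn_gradSq hw).continuousOn.add
    ((continuousOn_time hb).mul (hw.continuousOn.pow 2)))

theorem SupportedBy.gainDensity (hs : SupportedBy T w) : SupportedBy T (gainDensity a b w) :=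
  (hs.gradSq.add (hs.sq.mul_left _)).mul_left _

end Regularity

section Energy

variable {a B T c T₁ ε : ℝ} {w : SpaceTime n → ℝ} {m b Θ : ℝ → ℝ}

/-- The integrated Carleman inequality above the level `x_{n+1} = ε`. -/
theorem integral_carleman_level (hw : ContDiffOn ℝ ∞ w (region n B)) (hs : SupportedBy T w)
    (hm : ContDiffOn ℝ 1 m (Ioo 0 B)) (hb : ContDiffOn ℝ 1 b (Ioo 0 B))
    (hΘ : ContinuousOn Θ (Ioo 0 B)) (hm0 : ∀ t ∈ Ioo 0 B, 0 ≤ m t)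
    (hm' : ∀ t ∈ Ioo 0 B, HasDerivAt m (m t * ((1 + Θ t / 2) / t - 2 * b t)) t)
    (hb' : ∀ t ∈ Ioo 0 B, HasDerivAt b (-(b t * (1 + Θ t) / t)) t)
    (hε : 0 < ε) (hc : 0 < c) (hcT : c ≤ T₁) (hT : T < T₁) (hB : T₁ < B) :
    ∫ p in slab n ε c T₁, m p.2 * Θ p.2 / (2 * p.2) * gainDensity a b w p
      ≤ (∫ p in slab n ε c T₁, m p.2 * opDensity a w p)
        + (∫ z in (univ : Set (EuclideanSpace ℝ (Fin n))) ×ˢ Icc c T₁,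
            fluxY a m b w ((z.1, ε), z.2))
        + ∫ X in univ ×ˢ Ioi ε, fluxT a m b w (X, c) := by
  have hX := fun i => contDiffOn_fluxX (a := a) hw hm hb i
  have hY := contDiffOn_fluxY (a := a) hw hm hb
  have hTt := contDiffOn_fluxT (a := a) hw hm hb
  have sX := fun i => hs.fluxX (a := a) (m := m) (b := b) i
  have sY := hs.fluxY (a := a) (m := m) (b := b)
  have sT := hs.fluxT (a := a) (m := m) (b := b)
  have iX : ∀ i, IntegrableOn (dx i (fluxX a m b w i)) (slab n ε c T₁) := fun i =>
    integrableOn_slab (continuousOn_dx (hX i) i) ((sX i).dx i) hε hc hB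
  have iY := integrableOn_slab (continuousOn_dy hY) sY.dy hε hc hB
  have iT := integrableOn_slab (continuousOn_dt hTt) sT.dt hε hc hB
  have iG : IntegrableOn (fun p => m p.2 * Θ p.2 / (2 * p.2) * gainDensity a b w p)
      (slab n ε c T₁) := by
    refine integrableOn_slab (ContinuousOn.mul (ContinuousOn.div ((continuousOn_time
      hm.continuousOn).mul (continuousOn_time hΘ)) (by fun_prop) fun p hp => ?_)
      (continuousOn_gainDensity hw hb.continuousOn)) (hs.gainDensity.mul_left _) hε hc hB
    exact mul_ne_zero two_ne_zero (ne_of_gt hp.2.1)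
  have iO : IntegrableOn (fun p => m p.2 * opDensity a w p) (slab n ε c T₁) :=
    integrableOn_slab ((continuousOn_time hm.continuousOn).mul (continuousOn_opDensity hw))
      (hs.opDensity.mul_left _) hε hc hB
  have iS : IntegrableOn (fun p => ∑ i, dx i (fluxX a m b w i) p) (slab n ε c T₁) :=
    integrable_finsetSum _ fun i _ => iX i
  have iSY : IntegrableOn (fun p => (∑ i, dx i (fluxX a m b w i) p) + dy (fluxY a m b w) p)
    (slab n ε c T₁) := iS.add iY
  have iSYT : IntegrableOn (fun p => (∑ i, dx i (fluxX a m b w i) p) + dy (fluxY a m b w) p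
    + dt (fluxT a m b w) p) (slab n ε c T₁) := iSY.add iT
  have hle : ∫ p in slab n ε c T₁, ((((∑ i, dx i (fluxX a m b w i) p) + dy (fluxY a m b w) p)
      + dt (fluxT a m b w) p) + m p.2 * Θ p.2 / (2 * p.2) * gainDensity a b w p)
      ≤ ∫ p in slab n ε c T₁, m p.2 * opDensity a w p := by
    refine setIntegral_mono_on (iSYT.add iG) iO (measurableSet_slab ε c T₁)
      fun p hp => ?_
    have hp' : p ∈ region n B := slab_subset_region hε.le hc hB hp
    exact pointwise_carleman hp'.1 hp'.2.1 (contDiffAt_of_region hw hp') (hm0 _ hp'.2)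
      (hm' _ hp'.2) (hb' _ hp'.2)
  -- The tangential fluxes integrate to zero and nothing is left at the final time, which lies
  -- beyond the support. The fluxes through `y = ε` and `t = c` appear with a minus sign and are
  -- moved to the right.
  rw [integral_add iSYT iG, integral_add iSY iT, integral_add iS iY,
    integral_finsetSum _ fun i _ => iX i, integral_slab_dy hY sY hε hc hB,
    integral_slab_dt hTt sT hε hc hcT hT hB, Finset.sum_congr rfl fun i _ =>
      integral_slab_dx (hX i) (sX i) hε hc hB i] at hle
  simp only [Finset.sum_const_zero, zero_add] at hle
  linarith

end Energy

/-! ### Integration by parts along the level `y = ε`. -/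

section Thin

variable {a s B T c T₁ ε N : ℝ} {w : SpaceTime n → ℝ} {m b Θ : ℝ → ℝ}
  {V : EuclideanSpace ℝ (Fin n) × ℝ → ℝ}

/-- The tangential part `∂_t + x / 2t · ∇_x` of the drift. -/
noncomputable def thinDrift (w : SpaceTime n → ℝ) (p : SpaceTime n) : ℝ :=
  (∑ i, p.1.1 i * dx i w p) / (2 * p.2) + dt w p

theorem thinDrift_eq (w : SpaceTime n → ℝ) (p : SpaceTime n) :
    thinDrift w p = fderiv ℝ w p (((1 / (2 * p.2)) • p.1.1, 0), 1) := by
  have h : ((((1 / (2 * p.2)) • p.1.1, 0), 1) : SpaceTime n)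
      = (1 / (2 * p.2)) • ((p.1.1, 0), 0) + (((0, 0), 1) : SpaceTime n) := by
    refine Prod.ext (Prod.ext ?_ ?_) ?_ <;> simp
  rw [h, map_add, map_smul, sum_single_apply]
  simp only [smul_eq_mul, thinDrift, dx, dt]
  rw [show (((0, 0), 1) : SpaceTime n) = (0, 1) from rfl]
  ring

/-- The thin Gaussian is not invariant under the tangential scaling: the power of `t` in `G` counts
`n + 1 + a` dimensions, the divergence of `x/2t` only `n`. The defect is `(1 + a)/2t = (1 - s)/t`.
-/
theorem thin_divergence {p : SpaceTime n} (ht : 0 < p.2) (has : a = 1 - 2 * s)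
    {k : SpaceTime n → ℝ} (hk : DifferentiableAt ℝ k p) :
    dt (fun r => thinGauss a r * k r) p
      + ∑ i, dx i (fun r => thinGauss a r * (k r * (r.1.1 i * (1 / (2 * r.2))))) p
      = thinGauss a p * (thinDrift k p - (1 - s) / p.2 * k p) := by
  obtain ⟨L, hL, hL'⟩ := exists_fderiv_thinGauss a ht
  have hT := hasFDerivAt_time (p := p) (hasDerivAt_inv_two_mul ht.ne')
  have hx : ∀ i, dx i (fun r => thinGauss a r * (k r * (r.1.1 i * (1 / (2 * r.2))))) p
      = thinGauss a p * (k p / (2 * p.2) + p.1.1 i * dx i k p / (2 * p.2)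
        - k p * (p.1.1 i * p.1.1 i) / (4 * p.2 ^ 2)) := fun i => by
    have h1 := (hasFDerivAt_coord p i).fun_mul hT
    rw [dx, fderiv_mul_apply hL.differentiableAt (hk.fun_mul h1.differentiableAt),
      fderiv_mul_apply hk h1.differentiableAt, h1.fderiv, hL.fderiv, hL', inner_single_right]
    simp only [dx]
    simp
    field_simp
    ring
  have ht' : dt (fun r => thinGauss a r * k r) p = thinGauss a p * (dt k p
      + k p * (-(((n : ℝ) + 1 + a) / 2) / p.2 + ‖p.1.1‖ ^ 2 / (4 * p.2 ^ 2))) := by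
    rw [dt, fderiv_mul_apply hL.differentiableAt hk, hL.fderiv, hL']
    simp only [dt]
    simp
    ring
  rw [Finset.sum_congr rfl fun i _ => hx i, ht', thinDrift, ← Finset.mul_sum,
    Finset.sum_sub_distrib, Finset.sum_add_distrib, ← Finset.sum_div, ← Finset.sum_div,
    ← Finset.sum_div, ← Finset.mul_sum, norm_sq_eq_sum]
  simp only [Finset.sum_const, Finset.card_univ, Fintype.card_fin, nsmul_eq_mul]
  rw [has]
  field_simp
  ring

/-- The potential, extended constantly in `x_{n+1}`, times `w`. -/
def potMul (V : EuclideanSpace ℝ (Fin n) × ℝ → ℝ) (w : SpaceTime n → ℝ) (p : SpaceTime n) : ℝ :=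
  V (p.1.1, p.2) * w p

theorem SupportedBy.potMul (hs : SupportedBy T w) : SupportedBy T (potMul V w) := hs.mul_left _

/-- The interior of the cylinder where the potential lives. -/
theorem mem_nhds_Q5 {x : EuclideanSpace ℝ (Fin n)} {t : ℝ} (hx : ‖x‖ < 5) (ht : t ∈ Ioo (0 : ℝ) 25) :
    Q5 n ∈ 𝓝 (x, t) := by
  have h : Metric.ball (0 : EuclideanSpace ℝ (Fin n)) 5 ×ˢ Ioo (0 : ℝ) 25 ∈ 𝓝 (x, t) :=
    (Metric.isOpen_ball.prod isOpen_Ioo).mem_nhds ⟨by simpa using hx, ht⟩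
  exact mem_of_superset h (prod_mono le_rfl Ioo_subset_Ico_self)

/-- `V` is regular on `|x| < 5` only, but `w` vanishes for `|x| > 4`, so the product is regular for
all `x`. -/
theorem contDiffOn_potMul (hV : ContDiffOn ℝ 1 V (Q5 n)) (hB : B ≤ 25)
    (hw : ContDiffOn ℝ 1 w (region n B)) (hs : SupportedBy T w) :
    ContDiffOn ℝ 1 (potMul V w) (region n B) := fun p hp => by
  by_cases hx : ‖p.1.1‖ < 5
  · have h1 := hV.contDiffAt (mem_nhds_Q5 hx ⟨hp.2.1, hp.2.2.trans_le hB⟩)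
    refine ContDiffWithinAt.mul (ContDiffAt.contDiffWithinAt ?_) (hw p hp)
    exact h1.comp p ((contDiffAt_fst.comp p contDiffAt_fst).prodMk contDiffAt_snd)
  · refine ContDiffAt.contDiffWithinAt ((contDiffAt_const (c := (0 : ℝ))).congr_of_eventuallyEq ?_)
    have ho : IsOpen {q : SpaceTime n | 4 < ‖q.1.1‖} :=
      isOpen_lt continuous_const (by fun_prop)
    have hp4 : p ∈ {q : SpaceTime n | 4 < ‖q.1.1‖} := by
      change 4 < ‖p.1.1‖; linarith
    filter_upwards [(isOpen_region B).mem_nhds hp, ho.mem_nhds hp4] with q hq hq4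
    by_contra hne
    have := (norm_le_of_normSq (hs.potMul (V := V) q hq.1 hq.2.1 hne).1).1
    have : 4 < ‖q.1.1‖ := hq4
    linarith

/-- The limit at the thin space of the normal flux. -/
noncomputable def thinFlux (a : ℝ) (m b : ℝ → ℝ) (V : EuclideanSpace ℝ (Fin n) × ℝ → ℝ)
    (w : SpaceTime n → ℝ) (p : SpaceTime n) : ℝ :=
  thinGauss a p * (2 * m p.2 * (thinDrift w p - b p.2 * w p) * potMul V w p)

theorem SupportedBy.thinFlux (hs : SupportedBy T w) : SupportedBy T (thinFlux a m b V w) :=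
  (hs.potMul.mul_left _).mul_left _

theorem continuousOn_thinDrift (hw : ContDiffOn ℝ 1 w (region n B)) :
    ContinuousOn (thinDrift w) (region n B) :=
  ((continuousOn_finsetSum _ fun i _ => (contDiff_coord i).continuous.continuousOn.mul
    (continuousOn_dx hw i)).div (by fun_prop) fun _ hp =>
      mul_ne_zero two_ne_zero (ne_of_gt hp.2.1)).add (continuousOn_dt hw)

theorem continuousOn_thinFlux (hV : ContDiffOn ℝ 1 V (Q5 n)) (hB : B ≤ 25)
    (hw : ContDiffOn ℝ 1 w (region n B)) (hs : SupportedBy T w)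
    (hm : ContinuousOn m (Ioo 0 B)) (hb : ContinuousOn b (Ioo 0 B)) :
    ContinuousOn (thinFlux a m b V w) (region n B) :=
  (continuousOn_thinGauss a B).mul (((continuousOn_const.mul (continuousOn_time hm)).mul
    ((continuousOn_thinDrift hw).sub ((continuousOn_time hb).mul hw.continuousOn))).mul
    (contDiffOn_potMul hV hB hw hs).continuousOn)

end Thin

end ThinCarleman

namespace ThinCarleman

variable {n : ℕ} {a s B T c T₁ ε N K : ℝ} {w : SpaceTime n → ℝ} {m b Θ : ℝ → ℝ}
  {V : EuclideanSpace ℝ (Fin n) × ℝ → ℝ}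

/-- The zeroth-order remainder of the integration by parts on the thin space. -/
noncomputable def thinRemainder (a s : ℝ) (m Θ : ℝ → ℝ) (V : EuclideanSpace ℝ (Fin n) × ℝ → ℝ)
    (w : SpaceTime n → ℝ) (p : SpaceTime n) : ℝ :=
  thinGauss a p * (m p.2 * ((s + Θ p.2 / 2) / p.2 * (potMul V w p * w p)
    + (w p * thinDrift (potMul V w) p - potMul V w p * thinDrift w p)))

/-- The thin density whose divergence is taken in the integration by parts. -/
noncomputable def thinDensity (a : ℝ) (m : ℝ → ℝ) (V : EuclideanSpace ℝ (Fin n) × ℝ → ℝ)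
    (w : SpaceTime n → ℝ) (p : SpaceTime n) : ℝ :=
  thinGauss a p * (m p.2 * (potMul V w p * w p))

theorem SupportedBy.thinRemainder (hs : SupportedBy T w) :
    SupportedBy T (thinRemainder a s m Θ V w) :=
  (((hs.mul_left (ThinCarleman.potMul V w)).mul_left _).add ((hs.mul_right _).sub
    (hs.potMul.mul_right _)) |>.mul_left _).mul_left _

theorem SupportedBy.thinDensity (hs : SupportedBy T w) : SupportedBy T (thinDensity a m V w) :=
  ((hs.mul_left _).mul_left _).mul_left _

theorem contDiffOn_thinDensity (hV : ContDiffOn ℝ 1 V (Q5 n)) (hB : B ≤ 25)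
    (hw : ContDiffOn ℝ 1 w (region n B)) (hs : SupportedBy T w)
    (hm : ContDiffOn ℝ 1 m (Ioo 0 B)) : ContDiffOn ℝ 1 (thinDensity a m V w) (region n B) :=
  (contDiffOn_thinGauss a B).mul ((contDiffOn_time hm).mul
    ((contDiffOn_potMul hV hB hw hs).mul hw))

theorem continuousOn_thinRemainder (hV : ContDiffOn ℝ 1 V (Q5 n)) (hB : B ≤ 25)
    (hw : ContDiffOn ℝ 1 w (region n B)) (hs : SupportedBy T w)
    (hm : ContinuousOn m (Ioo 0 B)) (hΘ : ContinuousOn Θ (Ioo 0 B)) :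
    ContinuousOn (thinRemainder a s m Θ V w) (region n B) := by
  have hu := contDiffOn_potMul hV hB hw hs
  refine (continuousOn_thinGauss a B).mul ((continuousOn_time hm).mul (((ContinuousOn.div
    (continuousOn_const.add ((continuousOn_time hΘ).div_const 2)) (by fun_prop)
    fun _ hp => ne_of_gt hp.2.1).mul (hu.continuousOn.mul hw.continuousOn)).add
    ((hw.continuousOn.mul (continuousOn_thinDrift hu)).sub
      (hu.continuousOn.mul (continuousOn_thinDrift hw)))))

/-- The crucial cancellation: differentiating `m V w²` along the tangential drift yields both `2m V
w D'w` and, through `m'`, `-2mb V w²`, that is, the whole flux. The remainder has no factor `b`, and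
so no factor `α`; its `1/t` terms combine as `1 + Θ/2 - (1 - s) = s + Θ/2`. -/
theorem thin_divergence_density {p : SpaceTime n} (ht : 0 < p.2) (has : a = 1 - 2 * s)
    (hw : DifferentiableAt ℝ w p) (hu : DifferentiableAt ℝ (potMul V w) p)
    (hm' : HasDerivAt m (m p.2 * ((1 + Θ p.2 / 2) / p.2 - 2 * b p.2)) p.2) :
    dt (thinDensity a m V w) p
      + ∑ i, dx i (fun r => thinDensity a m V w r * (r.1.1 i * (1 / (2 * r.2)))) p
      = thinFlux a m b V w p + thinRemainder a s m Θ V w p := by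
  have h1 := (hasFDerivAt_time hm').mul (hu.hasFDerivAt.mul hw.hasFDerivAt)
  have h2 := thin_divergence ht has h1.differentiableAt
  have h3 : thinDrift (fun r : SpaceTime n => m r.2 * (potMul V w r * w r)) p
      = m p.2 * ((1 + Θ p.2 / 2) / p.2 - 2 * b p.2) * (potMul V w p * w p)
      + m p.2 * (potMul V w p * thinDrift w p + w p * thinDrift (potMul V w) p) := by
    rw [thinDrift_eq, thinDrift_eq, thinDrift_eq]
    have h4 : fderiv ℝ (fun r : SpaceTime n => m r.2 * (potMul V w r * w r)) p
      (((1 / (2 * p.2)) • p.1.1, 0), 1) = _ :=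
      congrArg (fun L => L (((1 / (2 * p.2)) • p.1.1, 0), 1)) h1.fderiv
    rw [h4]
    simp
    ring
  have h5 : (fun i => dx i (fun r => thinDensity a m V w r * (r.1.1 i * (1 / (2 * r.2)))) p)
      = fun i : Fin n => dx i (fun r => thinGauss a r * (m r.2 * (potMul V w r * w r)
        * (r.1.1 i * (1 / (2 * r.2))))) p := by
    funext i
    congr 1
    funext r
    simp only [thinDensity]
    ring
  simp only [Pi.mul_def] at h2
  rw [h5]
  change dt (fun r => thinGauss a r * (m r.2 * (potMul V w r * w r))) p + _ = _
  rw [h2, h3, thinFlux, thinRemainder]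
  ring

theorem integral_thinFlux (has : a = 1 - 2 * s) (hV : ContDiffOn ℝ 1 V (Q5 n)) (hB : B ≤ 25)
    (hw : ContDiffOn ℝ 1 w (region n B)) (hs : SupportedBy T w)
    (hm : ContDiffOn ℝ 1 m (Ioo 0 B)) (hb : ContinuousOn b (Ioo 0 B))
    (hΘ : ContinuousOn Θ (Ioo 0 B))
    (hm' : ∀ t ∈ Ioo 0 B, HasDerivAt m (m t * ((1 + Θ t / 2) / t - 2 * b t)) t)
    (hε : 0 < ε) (hc : 0 < c) (hcT : c ≤ T₁) (hT : T < T₁) (hTB : T₁ < B) :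
    ∫ z in (univ : Set (EuclideanSpace ℝ (Fin n))) ×ˢ Icc c T₁, thinFlux a m b V w ((z.1, ε), z.2)
      = -(∫ x, thinDensity a m V w ((x, ε), c))
        - ∫ z in (univ : Set (EuclideanSpace ℝ (Fin n))) ×ˢ Icc c T₁,
            thinRemainder a s m Θ V w ((z.1, ε), z.2) := by
  have hD := contDiffOn_thinDensity (a := a) hV hB hw hs hm
  have sD := hs.thinDensity (a := a) (m := m) (V := V)
  have hX : ∀ i, ContDiffOn ℝ 1 (fun r => thinDensity a m V w r * (r.1.1 i * (1 / (2 * r.2))))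
      (region n B) := fun i =>
    hD.mul ((contDiff_coord i).contDiffOn.mul (contDiffOn_inv_two_mul B))
  have sX : ∀ i, SupportedBy T
      (fun r : SpaceTime n => thinDensity a m V w r * (r.1.1 i * (1 / (2 * r.2)))) :=
    fun i => sD.mul_right _
  have iF := integrableOn_thin (continuousOn_thinFlux (a := a) hV hB hw hs hm.continuousOn hb)
    hs.thinFlux hε hc hTB
  have iR := integrableOn_thin (continuousOn_thinRemainder (a := a) (s := s) hV hB hw hs
    hm.continuousOn hΘ) hs.thinRemainder hε hc hTB
  have iT := integrableOn_thin (continuousOn_dt hD) sD.dt hε hc hTB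
  have iX := fun i => integrableOn_thin (continuousOn_dx (hX i) i) ((sX i).dx i) hε hc hTB
  have key : ∫ z in (univ : Set (EuclideanSpace ℝ (Fin n))) ×ˢ Icc c T₁,
      (thinFlux a m b V w ((z.1, ε), z.2) + thinRemainder a s m Θ V w ((z.1, ε), z.2))
      = ∫ z in (univ : Set (EuclideanSpace ℝ (Fin n))) ×ˢ Icc c T₁,
        (dt (thinDensity a m V w) ((z.1, ε), z.2) + ∑ i, dx i (fun r => thinDensity a m V w r
          * (r.1.1 i * (1 / (2 * r.2)))) ((z.1, ε), z.2)) := by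
    refine setIntegral_congr_fun (MeasurableSet.univ.prod measurableSet_Icc) fun z hz => ?_
    have hp : (((z.1, ε), z.2) : SpaceTime n) ∈ region n B :=
      ⟨hε, hc.trans_le hz.2.1, lt_of_le_of_lt hz.2.2 hTB⟩
    exact (thin_divergence_density hp.2.1 has (hasFDerivAt_of_region hw hp).differentiableAt
      (hasFDerivAt_of_region (contDiffOn_potMul hV hB hw hs) hp).differentiableAt
      (hm' _ hp.2)).symm
  rw [integral_add iF iR, integral_add iT (integrable_finsetSum _ fun i _ => iX i),
    integral_finsetSum _ fun i _ => iX i, integral_thin_dt hD sD hε hc hcT hT hTB,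
    Finset.sum_congr rfl fun i _ => integral_thin_dx (hX i) (sX i) hε hc hTB i] at key
  simp only [Finset.sum_const_zero, add_zero] at key
  linarith

/-- The bounds on the potential that enter the estimates. -/
structure PotentialBound (B N : ℝ) (V : EuclideanSpace ℝ (Fin n) × ℝ → ℝ) : Prop where
  bound : ∀ x t, ‖x‖ ≤ 4 → t ∈ Ioo 0 B → |V (x, t)| ≤ N
  drift : ∀ x t, ‖x‖ ≤ 4 → t ∈ Ioo 0 B →
    |fderiv ℝ V (x, t) ((1 / (2 * t)) • x, 1)| ≤ 3 * N / t

theorem abs_potMul_mul_le (hVN : PotentialBound B N V) (hs : SupportedBy T w) {p : SpaceTime n}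
    (hp : p ∈ region n B) : |potMul V w p * w p| ≤ N * w p ^ 2 := by
  by_cases h0 : w p = 0
  · simp [h0]
  · have hx := (norm_le_of_normSq (hs p hp.1 hp.2.1 h0).1).1
    rw [potMul, mul_assoc, ← sq, abs_mul, abs_of_nonneg (sq_nonneg (w p))]
    exact mul_le_mul_of_nonneg_right (hVN.bound _ _ hx hp.2) (sq_nonneg _)

/-- In `w D'(Vw) - Vw D'w` the derivatives of `w` cancel, leaving `w² D'V`. Here the derivatives of
`V` enter: `3N/t` from them and `(1 + K/2) N/t` from the undifferentiated term. -/
theorem abs_thinRemainder_le (hVN : PotentialBound B N V) (hV : ContDiffOn ℝ 1 V (Q5 n))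
    (hB : B ≤ 25) (hw : ContDiffOn ℝ 1 w (region n B)) (hs : SupportedBy T w)
    (hs0 : 0 ≤ s) (hs1 : s ≤ 1) (hm0 : ∀ t ∈ Ioo 0 B, 0 ≤ m t)
    (hΘ0 : ∀ t ∈ Ioo 0 B, 0 ≤ Θ t) (hΘK : ∀ t ∈ Ioo 0 B, Θ t ≤ K) {p : SpaceTime n}
    (hp : p ∈ region n B) :
    |thinRemainder a s m Θ V w p|
      ≤ (4 + K / 2) * N * (m p.2 / p.2 * (thinGauss a p * w p ^ 2)) := by
  by_cases h0 : w p = 0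
  · simp [h0, thinRemainder, potMul]
  · have hx := (norm_le_of_normSq (hs p hp.1 hp.2.1 h0).1).1
    have ht := hp.2.1
    have hV1 := (hV.contDiffAt (mem_nhds_Q5 (x := p.1.1) (t := p.2) (by linarith)
      ⟨ht, hp.2.2.trans_le hB⟩)).differentiableAt (by simp)
    have hwd := (hasFDerivAt_of_region hw hp)
    have hπ : HasFDerivAt (fun q : SpaceTime n => (q.1.1, q.2))
        (((ContinuousLinearMap.fst ℝ _ _).comp (ContinuousLinearMap.fst ℝ (Space n) ℝ)).prod
          (ContinuousLinearMap.snd ℝ (Space n) ℝ)) p :=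
      (hasFDerivAt_tangential p).prodMk hasFDerivAt_snd
    have hVc : HasFDerivAt (fun q : SpaceTime n => V (q.1.1, q.2)) _ p :=
      HasFDerivAt.comp (g := V) p hV1.hasFDerivAt hπ
    have h1 : thinDrift (potMul V w) p = V (p.1.1, p.2) * thinDrift w p
        + w p * fderiv ℝ V (p.1.1, p.2) ((1 / (2 * p.2)) • p.1.1, 1) := by
      rw [thinDrift_eq, thinDrift_eq]
      have h4 : fderiv ℝ (potMul V w) p (((1 / (2 * p.2)) • p.1.1, 0), 1) = _ :=
        congrArg (fun L => L (((1 / (2 * p.2)) • p.1.1, 0), 1)) (hVc.mul hwd).fderiv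
      rw [h4]
      simp
    have h2 := hVN.bound _ _ hx hp.2
    have h3 := hVN.drift _ _ hx hp.2
    have hN : 0 ≤ N := (abs_nonneg _).trans h2
    have hG := thinGauss_pos a ht
    have e1 : thinRemainder a s m Θ V w p = thinGauss a p * (m p.2 * (w p ^ 2 *
        ((s + Θ p.2 / 2) / p.2 * V (p.1.1, p.2)
          + fderiv ℝ V (p.1.1, p.2) ((1 / (2 * p.2)) • p.1.1, 1)))) := by
      rw [thinRemainder, h1, potMul]; ring
    have h5 : |(s + Θ p.2 / 2) / p.2 * V (p.1.1, p.2)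
          + fderiv ℝ V (p.1.1, p.2) ((1 / (2 * p.2)) • p.1.1, 1)| ≤ (4 + K / 2) * N / p.2 := by
      have hΘ0' := hΘ0 _ hp.2
      have hΘK' := hΘK _ hp.2
      have hK : 0 ≤ K := hΘ0'.trans hΘK'
      have h6 : |(s + Θ p.2 / 2) / p.2 * V (p.1.1, p.2)| ≤ (1 + K / 2) / p.2 * N := by
        rw [abs_mul, abs_of_nonneg (by positivity)]
        gcongr
      calc _ ≤ _ := abs_add_le _ _
        _ ≤ (1 + K / 2) / p.2 * N + 3 * N / p.2 := add_le_add h6 h3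
        _ = _ := by ring
    have hm := hm0 _ hp.2
    rw [e1, abs_mul, abs_mul, abs_mul, abs_of_pos hG, abs_of_nonneg hm,
      abs_of_nonneg (sq_nonneg (w p))]
    calc _ ≤ thinGauss a p * (m p.2 * (w p ^ 2 * ((4 + K / 2) * N / p.2))) := by gcongr
      _ = _ := by ring

theorem continuousOn_thinSq (hw : ContDiffOn ℝ 1 w (region n B)) :
    ContinuousOn (fun p => thinGauss a p * w p ^ 2) (region n B) :=
  (continuousOn_thinGauss a B).mul (hw.continuousOn.pow 2)

theorem continuousOn_div_time {k : ℝ → ℝ} (hk : ContinuousOn k (Ioo 0 B)) :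
    ContinuousOn (fun p : SpaceTime n => k p.2 / p.2) (region n B) :=
  (continuousOn_time hk).div (by fun_prop) fun _ hp => ne_of_gt hp.2.1

theorem integral_thinFlux_le (has : a = 1 - 2 * s) (hVN : PotentialBound B N V)
    (hV : ContDiffOn ℝ 1 V (Q5 n)) (hB : B ≤ 25)
    (hw : ContDiffOn ℝ 1 w (region n B)) (hs : SupportedBy T w)
    (hm : ContDiffOn ℝ 1 m (Ioo 0 B)) (hb : ContinuousOn b (Ioo 0 B))
    (hΘ : ContinuousOn Θ (Ioo 0 B)) (hs0 : 0 ≤ s) (hs1 : s ≤ 1) (hm0 : ∀ t ∈ Ioo 0 B, 0 ≤ m t)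
    (hΘ0 : ∀ t ∈ Ioo 0 B, 0 ≤ Θ t) (hΘK : ∀ t ∈ Ioo 0 B, Θ t ≤ K)
    (hm' : ∀ t ∈ Ioo 0 B, HasDerivAt m (m t * ((1 + Θ t / 2) / t - 2 * b t)) t)
    (hε : 0 < ε) (hc : 0 < c) (hcT : c ≤ T₁) (hT : T < T₁) (hTB : T₁ < B) :
    ∫ z in (univ : Set (EuclideanSpace ℝ (Fin n))) ×ˢ Icc c T₁, thinFlux a m b V w ((z.1, ε), z.2)
      ≤ N * m c * (∫ x, thinGauss a ((x, ε), c) * w ((x, ε), c) ^ 2)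
        + (4 + K / 2) * N * ∫ z in (univ : Set (EuclideanSpace ℝ (Fin n))) ×ˢ Icc c T₁,
            m z.2 / z.2 * (thinGauss a ((z.1, ε), z.2) * w ((z.1, ε), z.2) ^ 2) := by
  have hcB : c ∈ Ioo 0 B := ⟨hc, lt_of_le_of_lt hcT hTB⟩
  rw [integral_thinFlux has hV hB hw hs hm hb hΘ hm' hε hc hcT hT hTB]
  have h1 : -(∫ x, thinDensity a m V w ((x, ε), c))
      ≤ N * m c * (∫ x, thinGauss a ((x, ε), c) * w ((x, ε), c) ^ 2) := by
    rw [← integral_neg, ← integral_const_mul]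
    refine integral_mono (integrable_line (contDiffOn_thinDensity hV hB hw hs hm).continuousOn
      hs.thinDensity hε hcB).neg ((integrable_line (continuousOn_thinSq hw) (hs.sq.mul_left _)
      hε hcB).const_mul _) fun x => ?_
    have hp : (((x, ε), c) : SpaceTime n) ∈ region n B := ⟨hε, hcB⟩
    have h2 := (neg_le_abs _).trans (abs_potMul_mul_le hVN hs hp)
    have h3 := mul_le_mul_of_nonneg_left h2 (mul_nonneg (thinGauss_pos a (p := ((x, ε), c)) hc).le
      (hm0 c hcB))
    simp only [thinDensity]
    linarith
  have h2 : -(∫ z in (univ : Set (EuclideanSpace ℝ (Fin n))) ×ˢ Icc c T₁,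
            thinRemainder a s m Θ V w ((z.1, ε), z.2))
      ≤ (4 + K / 2) * N * ∫ z in (univ : Set (EuclideanSpace ℝ (Fin n))) ×ˢ Icc c T₁,
            m z.2 / z.2 * (thinGauss a ((z.1, ε), z.2) * w ((z.1, ε), z.2) ^ 2) := by
    rw [← integral_neg, ← integral_const_mul]
    refine setIntegral_mono_on (integrableOn_thin (continuousOn_thinRemainder hV hB hw hs
      hm.continuousOn hΘ) hs.thinRemainder hε hc hTB).neg ((integrableOn_thin
      (F := fun p => m p.2 / p.2 * (thinGauss a p * w p ^ 2)) ((continuousOn_div_time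
      hm.continuousOn).mul (continuousOn_thinSq hw)) ((hs.sq.mul_left _).mul_left _)
      hε hc hTB).const_mul _) (MeasurableSet.univ.prod measurableSet_Icc) fun z hz => ?_
    have hp : (((z.1, ε), z.2) : SpaceTime n) ∈ region n B :=
      ⟨hε, hc.trans_le hz.2.1, lt_of_le_of_lt hz.2.2 hTB⟩
    exact (neg_le_abs _).trans (abs_thinRemainder_le hVN hV hB hw hs hs0 hs1 hm0 hΘ0 hΘK hp)
  linarith

end ThinCarleman

/-! ### Absorbing the thin terms at a fixed level. -/

namespace ThinCarleman

variable {n : ℕ} {a s B T c T₁ ε N K α Γ C : ℝ} {w : SpaceTime n → ℝ} {m b Θ : ℝ → ℝ}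
  {V : EuclideanSpace ℝ (Fin n) × ℝ → ℝ}

/-- The error committed when the normal flux at `x_{n+1} = ε` is replaced by its limit. -/
noncomputable def fluxError (a : ℝ) (m b : ℝ → ℝ) (V : EuclideanSpace ℝ (Fin n) × ℝ → ℝ)
    (w : SpaceTime n → ℝ) (c T₁ ε : ℝ) : ℝ :=
  ∫ z in (univ : Set (EuclideanSpace ℝ (Fin n))) ×ˢ Icc c T₁,
    (fluxY a m b w ((z.1, ε), z.2) - thinFlux a m b V w ((z.1, ε), z.2))

/-- The level `ε` is small enough for the trace inequality at all times after `c`. -/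
def LevelSmall (a α c ε : ℝ) : Prop :=
  0 < ε ∧ ε ≤ √(c / α) ∧ (ε / √(c / α)) ^ (1 + a) ≤ 1 / 2

/-- The trace scale `√(t/α)` increases with `t`, so smallness of `ε` at `t = c` suffices for all
later times. -/
theorem LevelSmall.trace (hε : LevelSmall a α c ε) (ha : a ∈ Ioo (-1 : ℝ) 1)
    (has : a = 1 - 2 * s) (hα : 1 ≤ α) (hw : ContDiffOn ℝ 1 w (region n B))
    (hs : SupportedBy T w) (hc : 0 < c) {t : ℝ} (hct : c ≤ t) (htB : t < B) :
    ∫ x, thinGauss a ((x, ε), t) * w ((x, ε), t) ^ 2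
      ≤ traceConst a * (t / α) ^ s * ∫ X in univ ×ˢ Ioi ε, traceDensity a α w (X, t) := by
  have hα0 : 0 < α := by linarith
  have h1 : √(c / α) ≤ √(t / α) := Real.sqrt_le_sqrt (by gcongr)
  have h0 : 0 < √(c / α) := Real.sqrt_pos.2 (by positivity)
  refine trace_slice ha has hα hw hs hε.1 ⟨hc.trans_le hct, htB⟩ (hε.2.1.trans h1)
    (le_trans (Real.rpow_le_rpow (div_nonneg hε.1.le (Real.sqrt_nonneg _)) ?_
      (by linarith [ha.1])) hε.2.2)
  have := hε.1.le
  gcongr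

theorem continuousOn_traceCoeff (hα : 0 < α) (C s : ℝ) (hm : ContinuousOn m (Ioo 0 B)) :
    ContinuousOn (fun t => m t / t * (C * (t / α) ^ s)) (Ioo 0 B) := by
  refine (hm.div continuousOn_id fun t ht => ne_of_gt ht.1).mul (continuousOn_const.mul
    fun t ht => ?_)
  exact ((continuousAt_id.div_const α).rpow_const
    (Or.inl (div_pos ht.1 hα).ne')).continuousWithinAt

theorem integral_thin_le (hε : LevelSmall a α c ε) (ha : a ∈ Ioo (-1 : ℝ) 1)
    (has : a = 1 - 2 * s) (hα : 1 ≤ α) (hw : ContDiffOn ℝ 1 w (region n B))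
    (hs : SupportedBy T w) (hm : ContinuousOn m (Ioo 0 B)) (hm0 : ∀ t ∈ Ioo 0 B, 0 ≤ m t)
    (hc : 0 < c) (hTB : T₁ < B) :
    ∫ z in (univ : Set (EuclideanSpace ℝ (Fin n))) ×ˢ Icc c T₁,
        m z.2 / z.2 * (thinGauss a ((z.1, ε), z.2) * w ((z.1, ε), z.2) ^ 2)
      ≤ ∫ p in slab n ε c T₁,
        m p.2 / p.2 * (traceConst a * (p.2 / α) ^ s) * traceDensity a α w p := by
  have hF : ContinuousOn (fun p => m p.2 / p.2 * (thinGauss a p * w p ^ 2)) (region n B) :=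
    (continuousOn_div_time hm).mul (continuousOn_thinSq hw)
  have sF : SupportedBy T (fun p => m p.2 / p.2 * (thinGauss a p * w p ^ 2)) :=
    (hs.sq.mul_left _).mul_left _
  have hk := continuousOn_traceCoeff (by linarith : 0 < α) (traceConst a) s hm
  have hG : ContinuousOn (fun p => m p.2 / p.2 * (traceConst a * (p.2 / α) ^ s)
      * traceDensity a α w p) (region n B) :=
    (continuousOn_time hk).mul (continuousOn_traceDensity hw a α)
  have sG : SupportedBy T (fun p => m p.2 / p.2 * (traceConst a * (p.2 / α) ^ s)
      * traceDensity a α w p) := (hs.traceDensity a α).mul_left _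
  have e1 := integral_thin_eq hF sF hε.1 hc hTB
  rw [e1, integral_slab_eq hG sG hε.1 hc hTB]
  have i1 := integrableOn_thin hF sF hε.1 hc hTB
  rw [IntegrableOn, Measure.volume_eq_prod, ← Measure.prod_restrict, Measure.restrict_univ] at i1
  have i2 := integrableOn_slab hG sG hε.1 hc hTB
  rw [IntegrableOn, slab, Measure.volume_eq_prod, ← Measure.prod_restrict] at i2
  refine setIntegral_mono_on i1.integral_prod_right i2.integral_prod_right measurableSet_Icc
    fun t ht => ?_
  have ht' : t ∈ Ioo 0 B := ⟨hc.trans_le ht.1, lt_of_le_of_lt ht.2 hTB⟩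
  simp only
  rw [integral_const_mul, integral_const_mul, mul_assoc]
  exact mul_le_mul_of_nonneg_left (hε.trace ha has hα hw hs hc ht.1 ht'.2)
    (div_nonneg (hm0 t ht') ht'.1.le)

/-- The Carleman inequality above the level `x_{n+1} = ε`, with the thin terms absorbed. -/
theorem carleman_level (hε : LevelSmall a α c ε) (ha : a ∈ Ioo (-1 : ℝ) 1)
    (has : a = 1 - 2 * s) (hα : 1 ≤ α) (hΓ : 1 ≤ Γ) (hN : 0 ≤ N) (hVN : PotentialBound B N V)
    (hV : ContDiffOn ℝ 1 V (Q5 n)) (hB : B ≤ 25)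
    (hw : ContDiffOn ℝ ∞ w (region n B)) (hs : SupportedBy T w)
    (hm : ContDiffOn ℝ 1 m (Ioo 0 B)) (hb : ContDiffOn ℝ 1 b (Ioo 0 B))
    (hΘ : ContinuousOn Θ (Ioo 0 B)) (hs0 : 0 ≤ s) (hs1 : s ≤ 1) (hm0 : ∀ t ∈ Ioo 0 B, 0 ≤ m t)
    (hΘ0 : ∀ t ∈ Ioo 0 B, 0 ≤ Θ t) (hΘK : ∀ t ∈ Ioo 0 B, Θ t ≤ K)
    (hm' : ∀ t ∈ Ioo 0 B, HasDerivAt m (m t * ((1 + Θ t / 2) / t - 2 * b t)) t)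
    (hb' : ∀ t ∈ Ioo 0 B, HasDerivAt b (-(b t * (1 + Θ t) / t)) t)
    (hb1 : ∀ t ∈ Ioo 0 B, α / (Γ * t) ≤ b t) (hb2 : ∀ t ∈ Ioo 0 B, b t ≤ α / t)
    (hc : 0 < c) (hcT : c ≤ T₁) (hT : T < T₁) (hTB : T₁ < B)
    (hsmall : ∀ t ∈ Icc c T₁, 4 * Γ * ((4 + K / 2) * N * (traceConst a * (t / α) ^ s)) ≤ Θ t)
    (hsmall' : N * (traceConst a * (c / α) ^ s) ≤ 1 / 2) :
    ∫ p in slab n ε c T₁, m p.2 * Θ p.2 / (4 * p.2) * traceDensity a (α / Γ) w p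
      ≤ (∫ p in slab n ε c T₁, m p.2 * opDensity a w p) + fluxError a m b V w c T₁ ε
        + m c * (-(1 / 2) * (∫ X in univ ×ˢ Ioi ε, rho a (X, c) * gradSq w (X, c))
          + 3 * α / (2 * c) * ∫ X in univ ×ˢ Ioi ε, rho a (X, c) * w (X, c) ^ 2) := by
  have hw1 := hw.of_le one_le_infty
  have hε0 := hε.1
  have hα0 : 0 < α := by linarith
  have hΓ0 : 0 < Γ := by linarith
  have hcB : c ∈ Ioo 0 B := ⟨hc, lt_of_le_of_lt hcT hTB⟩
  have h1 := integral_carleman_level (a := a) hw hs hm hb hΘ hm0 hm' hb' hε0 hc hcT hT hTB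
  have h2 := integral_thinFlux_le has hVN hV hB hw1 hs hm hb.continuousOn hΘ hs0 hs1 hm0 hΘ0 hΘK hm'
    hε0 hc hcT hT hTB
  have h3 := integral_thin_le (T₁ := T₁) hε ha has hα hw1 hs hm.continuousOn hm0 hc hTB
  have h4 := hε.trace ha has hα hw1 hs hc le_rfl hcB.2
  have hK : 0 ≤ K := (hΘ0 c hcB).trans (hΘK c hcB)
  have h5 : fluxError a m b V w c T₁ ε
      = (∫ z in (univ : Set (EuclideanSpace ℝ (Fin n))) ×ˢ Icc c T₁,
          fluxY a m b w ((z.1, ε), z.2))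
        - ∫ z in (univ : Set (EuclideanSpace ℝ (Fin n))) ×ˢ Icc c T₁,
          thinFlux a m b V w ((z.1, ε), z.2) :=
    integral_sub (integrableOn_thin (contDiffOn_fluxY hw hm hb).continuousOn hs.fluxY hε0 hc hTB)
      (integrableOn_thin (continuousOn_thinFlux hV hB hw1 hs hm.continuousOn hb.continuousOn)
        hs.thinFlux hε0 hc hTB)
  have hcΘ : ∀ k : ℝ, k ≠ 0 → ContinuousOn (fun p : SpaceTime n => m p.2 * Θ p.2 / (k * p.2))
      (region n B) := fun k hk =>
    ((continuousOn_time hm.continuousOn).mul (continuousOn_time hΘ)).div (by fun_prop)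
      fun p hp => mul_ne_zero hk (ne_of_gt hp.2.1)
  have iL : IntegrableOn (fun p => m p.2 * Θ p.2 / (4 * p.2) * traceDensity a (α / Γ) w p)
      (slab n ε c T₁) := integrableOn_slab ((hcΘ 4 four_ne_zero).mul
    (continuousOn_traceDensity hw1 a (α / Γ))) ((hs.traceDensity a (α / Γ)).mul_left _) hε0 hc hTB
  have iG : IntegrableOn (fun p => m p.2 * Θ p.2 / (2 * p.2) * gainDensity a b w p)
      (slab n ε c T₁) := integrableOn_slab ((hcΘ 2 two_ne_zero).mul
    (continuousOn_gainDensity (a := a) hw hb.continuousOn)) (hs.gainDensity.mul_left _) hε0 hc hTB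
  have iR : IntegrableOn (fun p => m p.2 / p.2 * (traceConst a * (p.2 / α) ^ s)
      * traceDensity a α w p) (slab n ε c T₁) := integrableOn_slab ((continuousOn_time (continuousOn_traceCoeff hα0 (traceConst a) s
    hm.continuousOn)).mul (continuousOn_traceDensity hw1 a α))
    ((hs.traceDensity a α).mul_left _) hε0 hc hTB
  -- The gain `Θ/2` is divided in two equal parts: one is kept, the other absorbs the trace term.
  -- The trace density carries `α/t` where only `b ≥ α/(Γt)` is available, hence the factor `Γ` in
  -- the smallness hypothesis.
  have h6 : (∫ p in slab n ε c T₁, m p.2 * Θ p.2 / (4 * p.2) * traceDensity a (α / Γ) w p)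
      + (4 + K / 2) * N * (∫ p in slab n ε c T₁,
        m p.2 / p.2 * (traceConst a * (p.2 / α) ^ s) * traceDensity a α w p)
      ≤ ∫ p in slab n ε c T₁, m p.2 * Θ p.2 / (2 * p.2) * gainDensity a b w p := by
    rw [← integral_const_mul, ← integral_add iL (iR.const_mul _)]
    refine setIntegral_mono_on (iL.add (iR.const_mul _)) iG (measurableSet_slab ε c T₁)
      fun p hp => ?_
    have hp' : p ∈ region n B := slab_subset_region hε0.le hc hTB hp
    have ht : 0 < p.2 := hp'.2.1
    have hr := rho_pos a hp'.1 ht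
    have hm0' := hm0 _ hp'.2
    have hg := gradSq_nonneg w p
    have hsm := hsmall _ hp.2
    have hmt : 0 ≤ m p.2 / p.2 := div_nonneg hm0' ht.le
    set E := (4 + K / 2) * N * (traceConst a * (p.2 / α) ^ s) with hE
    have hE0 : 0 ≤ E := by
      have := traceConst_pos ha
      have : 0 ≤ (p.2 / α) ^ s := Real.rpow_nonneg (by positivity) _
      positivity
    have hEΘ : E ≤ Θ p.2 / 4 / Γ := by
      rw [le_div_iff₀ hΓ0]; linarith
    have hΘ0' := hΘ0 _ hp'.2
    have k1 : E * gradSq w p ≤ Θ p.2 / 4 * gradSq w p :=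
      mul_le_mul_of_nonneg_right (hEΘ.trans (div_le_self (by positivity) hΓ)) hg
    have k2 : E * (α / p.2 * w p ^ 2) ≤ Θ p.2 / 4 * (α / Γ / p.2 * w p ^ 2) := by
      calc E * (α / p.2 * w p ^ 2) ≤ Θ p.2 / 4 / Γ * (α / p.2 * w p ^ 2) :=
            mul_le_mul_of_nonneg_right hEΘ (by positivity)
        _ = _ := by field_simp
    have k3 : Θ p.2 / 4 * (α / Γ / p.2 * w p ^ 2) ≤ Θ p.2 / 4 * (b p.2 * w p ^ 2) := by
      have := hb1 _ hp'.2
      rw [← div_div] at this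
      gcongr
    have k4 : Θ p.2 / 4 * (gradSq w p + α / Γ / p.2 * w p ^ 2)
        + E * (gradSq w p + α / p.2 * w p ^ 2) ≤ Θ p.2 / 2 * (gradSq w p + b p.2 * w p ^ 2) := by
      linarith
    have k5 := mul_le_mul_of_nonneg_left k4 (mul_nonneg hmt hr.le)
    calc _ = m p.2 / p.2 * rho a p * (Θ p.2 / 4 * (gradSq w p + α / Γ / p.2 * w p ^ 2)
        + E * (gradSq w p + α / p.2 * w p ^ 2)) := by
          simp only [traceDensity, hE]; field_simp
      _ ≤ _ := k5
      _ = _ := by simp only [gainDensity]; field_simp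
  have hcr : ContinuousOn (fun p : SpaceTime n => rho a p * gradSq w p) (region n B) :=
    (continuousOn_rho a B).mul (continuousOn_gradSq hw1)
  have hcw : ContinuousOn (fun p : SpaceTime n => rho a p * w p ^ 2) (region n B) :=
    (continuousOn_rho a B).mul (hw1.continuousOn.pow 2)
  have jg := integrableOn_slice hcr (hs.gradSq.mul_left _) hε0 hcB
  have jw := integrableOn_slice hcw (hs.sq.mul_left _) hε0 hcB
  have jT := integrableOn_slice (contDiffOn_fluxT (a := a) hw hm hb).continuousOn hs.fluxT hε0 hcB
  have jD := integrableOn_slice (continuousOn_traceDensity hw1 a α) (hs.traceDensity a α) hε0 hcB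
  have hmc := hm0 c hcB
  -- At `t = c` the trace term takes half of `-|∇w|²` and adds `α/(2c) w²` to `b w² ≤ (α/c) w²`;
  -- hence the coefficients `-1/2` and `3α/(2c)`.
  have h7 : m c / 2 * (∫ X in univ ×ˢ Ioi ε, traceDensity a α w (X, c))
      + (∫ X in univ ×ˢ Ioi ε, fluxT a m b w (X, c))
      ≤ m c * (-(1 / 2) * (∫ X in univ ×ˢ Ioi ε, rho a (X, c) * gradSq w (X, c))
          + 3 * α / (2 * c) * ∫ X in univ ×ˢ Ioi ε, rho a (X, c) * w (X, c) ^ 2) := by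
    rw [← integral_const_mul, ← integral_const_mul, ← integral_const_mul,
      ← integral_add (jD.const_mul _) jT, ← integral_add (jg.const_mul _) (jw.const_mul _),
      ← integral_const_mul]
    refine setIntegral_mono_on ((jD.const_mul _).add jT)
      (((jg.const_mul _).add (jw.const_mul _)).const_mul _)
      (MeasurableSet.univ.prod measurableSet_Ioi) fun X hX => ?_
    have hr := rho_pos a (p := (X, c)) (hε0.trans hX.2) hc
    have k1 : b c * w (X, c) ^ 2 ≤ α / c * w (X, c) ^ 2 :=
      mul_le_mul_of_nonneg_right (hb2 c hcB) (sq_nonneg _)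
    have k2 := mul_le_mul_of_nonneg_left k1 (mul_nonneg hmc hr.le)
    simp only [traceDensity, fluxT, fluxEnergy]
    have e3 : 3 * α / (2 * c) = 3 / 2 * (α / c) := by field_simp
    rw [e3]
    linarith
  have h8 : N * m c * (∫ x, thinGauss a ((x, ε), c) * w ((x, ε), c) ^ 2)
      ≤ m c / 2 * (∫ X in univ ×ˢ Ioi ε, traceDensity a α w (X, c)) := by
    have hI : 0 ≤ ∫ X in univ ×ˢ Ioi ε, traceDensity a α w (X, c) :=
      setIntegral_nonneg (MeasurableSet.univ.prod measurableSet_Ioi) fun X hX =>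
        traceDensity_nonneg hα0.le w (hε0.trans hX.2) hc
    calc _ ≤ N * m c * (traceConst a * (c / α) ^ s
          * ∫ X in univ ×ˢ Ioi ε, traceDensity a α w (X, c)) :=
          mul_le_mul_of_nonneg_left h4 (mul_nonneg hN hmc)
      _ = m c * (N * (traceConst a * (c / α) ^ s))
          * ∫ X in univ ×ˢ Ioi ε, traceDensity a α w (X, c) := by ring
      _ ≤ m c * (1 / 2) * ∫ X in univ ×ˢ Ioi ε, traceDensity a α w (X, c) := by gcongr
      _ = _ := by ring
  have h9 : (4 + K / 2) * N * (∫ z in (univ : Set (EuclideanSpace ℝ (Fin n))) ×ˢ Icc c T₁,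
        m z.2 / z.2 * (thinGauss a ((z.1, ε), z.2) * w ((z.1, ε), z.2) ^ 2))
      ≤ (4 + K / 2) * N * (∫ p in slab n ε c T₁,
        m p.2 / p.2 * (traceConst a * (p.2 / α) ^ s) * traceDensity a α w p) :=
    mul_le_mul_of_nonneg_left h3 (by positivity)
  linarith

end ThinCarleman

/-! ### Passage to the thin space: the limit of the normal flux. -/

namespace ThinCarleman

variable {n : ℕ}

/-- A compact set of the closed half-space that contains the spatial supports. -/
def spaceBox (n : ℕ) : Set (Space n) := Metric.closedBall 0 4 ×ˢ Icc 0 4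

/-- The part of `spaceBox` off the thin space. -/
def spaceBoxPos (n : ℕ) : Set (Space n) := Metric.closedBall 0 4 ×ˢ Ioc 0 4

theorem isCompact_spaceBox : IsCompact (spaceBox n) := (isCompact_closedBall _ _).prod isCompact_Icc

theorem spaceBoxPos_subset : spaceBoxPos n ⊆ spaceBox n := prod_mono le_rfl Ioc_subset_Icc_self

theorem measurableSet_spaceBoxPos : MeasurableSet (spaceBoxPos n) :=
  Metric.isClosed_closedBall.measurableSet.prod measurableSet_Ioc

theorem mem_spaceBoxPos {X : Space n} (hX : 0 < X.2) (h : normSq X ≤ 4 ^ 2) : X ∈ spaceBoxPos n := by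
  have := norm_le_of_normSq h
  exact ⟨by simpa using this.1, hX, (le_abs_self _).trans this.2⟩

theorem upperHalf_eq : upperHalf n = univ ×ˢ Ioi 0 := by
  ext X; simp [upperHalf]

theorem integrableOn_height_rpow {e : ℝ} (he : -1 < e) :
    IntegrableOn (fun X : Space n => X.2 ^ e) (spaceBox n) := by
  have h1 : IntegrableOn (fun y : ℝ => y ^ e) (Icc 0 4) := by
    rw [integrableOn_Icc_iff_integrableOn_Ioc]
    exact (intervalIntegrable_iff_integrableOn_Ioc_of_le (by norm_num)).1
      (intervalIntegral.intervalIntegrable_rpow' he)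
  have : IsFiniteMeasure ((volume : Measure (EuclideanSpace ℝ (Fin n))).restrict
      (Metric.closedBall 0 4)) := ⟨by
    rw [Measure.restrict_apply_univ]; exact (isCompact_closedBall _ _).measure_lt_top⟩
  rw [IntegrableOn, spaceBox, Measure.volume_eq_prod, ← Measure.prod_restrict]
  exact Integrable.comp_snd h1 _

theorem integrableOn_spaceBoxPos {e : ℝ} (he : -1 < e) {f : Space n → ℝ}
    (hf : ContinuousOn f (spaceBox n)) :
    IntegrableOn (fun X => X.2 ^ e * f X) (spaceBoxPos n) :=
  ((integrableOn_height_rpow he).mul_continuousOn hf isCompact_spaceBox).mono_set spaceBoxPos_subset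

theorem integrableOn_timeBoxPos {e c b : ℝ} (he : -1 < e) {f : SpaceTime n → ℝ}
    (hf : ContinuousOn f (spaceBox n ×ˢ Icc c b)) :
    IntegrableOn (fun p => p.1.2 ^ e * f p) (spaceBoxPos n ×ˢ Icc c b) := by
  have h1 : IntegrableOn (fun p : SpaceTime n => p.1.2 ^ e) (spaceBox n ×ˢ Icc c b) := by
    rw [IntegrableOn, Measure.volume_eq_prod, ← Measure.prod_restrict]
    exact Integrable.comp_fst (integrableOn_height_rpow he) _
  exact (h1.mul_continuousOn hf (isCompact_spaceBox.prod isCompact_Icc)).mono_set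
    (prod_mono spaceBoxPos_subset le_rfl)

/-- The regularity of a test function, with the extensions to the thin space chosen. -/
structure Extensions (a : ℝ) (V : EuclideanSpace ℝ (Fin n) × ℝ → ℝ) (w : SpaceTime n → ℝ)
    (gx : Fin n → SpaceTime n → ℝ) (gt gy : SpaceTime n → ℝ) : Prop where
  cont : ContinuousOn w (upperHalfClosed n ×ˢ Ioi 0)
  cont_x : ∀ i, ContinuousOn (gx i) (upperHalfClosed n ×ˢ Ioi 0)
  cont_t : ContinuousOn gt (upperHalfClosed n ×ˢ Ioi 0)
  cont_y : ContinuousOn gy (upperHalfClosed n ×ˢ Ioi 0)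
  eq_x : ∀ i, EqOn (dx i w) (gx i) (upperHalf n ×ˢ Ioi 0)
  eq_t : EqOn (dt w) gt (upperHalf n ×ˢ Ioi 0)
  eq_y : EqOn (fun p => p.1.2 ^ a * dy w p) gy (upperHalf n ×ˢ Ioi 0)
  robin : ∀ x t, 0 < t → gy ((x, 0), t) = V (x, t) * w ((x, 0), t)

/-- The value at `y = 0` of the extended flux is identified with `V w` by uniqueness of limits along
vertical lines. -/
theorem IsTestFunction.exists_extensions {a T₀ : ℝ} {V : EuclideanSpace ℝ (Fin n) × ℝ → ℝ}
    {w : SpaceTime n → ℝ} (h : IsTestFunction a T₀ V w) : ∃ gx gt gy, Extensions a V w gx gt gy := by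
  choose gx hx using h.cont_dx
  obtain ⟨gt, ht⟩ := h.cont_dt
  obtain ⟨gy, hy⟩ := h.cont_flux
  refine ⟨gx, gt, gy, h.cont, fun i => (hx i).1, ht.1, hy.1, fun i => (hx i).2, ht.2, hy.2,
    fun x t ht0 => ?_⟩
  refine tendsto_nhds_unique ?_ (h.robin x t ht0)
  have h1 : ContinuousWithinAt gy (upperHalfClosed n ×ˢ Ioi 0) ((x, 0), t) :=
    hy.1 _ ⟨show (0 : ℝ) ≤ 0 from le_rfl, ht0⟩
  have h2 : Tendsto (fun y : ℝ => (((x, y), t) : SpaceTime n)) (𝓝[>] 0)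
      (𝓝[upperHalfClosed n ×ˢ Ioi 0] ((x, 0), t)) := by
    refine tendsto_nhdsWithin_iff.2 ⟨?_, ?_⟩
    · have : Continuous fun y : ℝ => (((x, y), t) : SpaceTime n) := by fun_prop
      exact (this.tendsto 0).mono_left nhdsWithin_le_nhds
    · filter_upwards [self_mem_nhdsWithin] with y hy0
      exact ⟨show (0 : ℝ) ≤ y from le_of_lt hy0, ht0⟩
  refine (h1.tendsto.comp h2).congr' ?_
  filter_upwards [self_mem_nhdsWithin] with y hy0
  exact (hy.2 (x := ((x, y), t)) ⟨hy0, ht0⟩).symm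

section Limits

variable {a B T c T₁ : ℝ} {w gt gy : SpaceTime n → ℝ} {gx : Fin n → SpaceTime n → ℝ}
  {m b : ℝ → ℝ} {V : EuclideanSpace ℝ (Fin n) × ℝ → ℝ}

theorem box_subset (hc : 0 < c) :
    spaceBox n ×ˢ Icc c T₁ ⊆ upperHalfClosed n ×ˢ Ioi 0 := fun _ hp =>
  ⟨hp.1.2.1, hc.trans_le hp.2.1⟩

theorem continuousOn_thinGauss_pos (a : ℝ) :
    ContinuousOn (thinGauss (n := n) a) (univ ×ˢ Ioi 0) := fun p hp => by
  obtain ⟨L, hL, -⟩ := exists_fderiv_thinGauss a (p := p) hp.2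
  exact hL.continuousAt.continuousWithinAt

theorem continuousOn_gauss_pos (a : ℝ) :
    ContinuousOn (gauss (n := n) a) (univ ×ˢ Ioi 0) := by
  have h : gauss (n := n) a = fun p => thinGauss a p * Real.exp (-p.1.2 ^ 2 / (4 * p.2)) := by
    funext p
    simp only [gauss, thinGauss, normSq]
    rw [mul_assoc, ← Real.exp_add]
    congr 2
    ring
  rw [h]
  refine (continuousOn_thinGauss_pos a).mul (ContinuousOn.rexp (ContinuousOn.div (by fun_prop)
    (by fun_prop) fun p hp => mul_ne_zero four_ne_zero (ne_of_gt hp.2)))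

/-- The difference of the normal flux and its limit, extended to the thin space. -/
noncomputable def fluxGap (a : ℝ) (m b : ℝ → ℝ) (V : EuclideanSpace ℝ (Fin n) × ℝ → ℝ)
    (w : SpaceTime n → ℝ) (gx : Fin n → SpaceTime n → ℝ) (gt gy : SpaceTime n → ℝ)
    (p : SpaceTime n) : ℝ :=
  thinGauss a p * Real.exp (-p.1.2 ^ 2 / (4 * p.2)) * (2 * m p.2 *
      ((∑ i, p.1.1 i * gx i p) / (2 * p.2) + gt p + p.1.2 ^ (1 - a) * gy p / (2 * p.2)
        - b p.2 * w p) * gy p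
      + m p.2 / (2 * p.2) * (p.1.2 ^ (1 + a) * (b p.2 * w p ^ 2 - ∑ i, gx i p ^ 2)
        - p.1.2 ^ (1 - a) * gy p ^ 2))
    - thinGauss a p * (2 * m p.2 * ((∑ i, p.1.1 i * gx i p) / (2 * p.2) + gt p - b p.2 * w p)
      * (V (p.1.1, p.2) * w p))

/-- Once `∂_y w` is written as `y^{-a}` times the flux, which is continuous up to `y = 0`, the extra
terms carry only the positive powers `y^{1-a}` and `y^{1+a}`. The gap is thus continuous up to the
thin space and vanishes there by the Robin condition. -/
theorem fluxGap_eq (h : Extensions a V w gx gt gy) {p : SpaceTime n} (hy : 0 < p.1.2)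
    (ht : 0 < p.2) :
    fluxGap a m b V w gx gt gy p = fluxY a m b w p - thinFlux a m b V w p := by
  have hmem : p ∈ upperHalf n ×ˢ Ioi (0 : ℝ) := ⟨hy, ht⟩
  have hgy : gy p = p.1.2 ^ a * dy w p := (h.eq_y hmem).symm
  have hsum : ∑ i, p.1.1 i * gx i p = ∑ i, p.1.1 i * dx i w p :=
    Finset.sum_congr rfl fun i _ => by rw [h.eq_x i hmem]
  have hsum2 : ∑ i, gx i p ^ 2 = ∑ i, dx i w p ^ 2 :=
    Finset.sum_congr rfl fun i _ => by rw [h.eq_x i hmem]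
  have e1 : p.1.2 ^ (1 - a) = p.1.2 / p.1.2 ^ a := by rw [Real.rpow_sub hy, Real.rpow_one]
  have e2 : p.1.2 ^ (1 + a) = p.1.2 * p.1.2 ^ a := by rw [Real.rpow_add hy, Real.rpow_one]
  have hya := (Real.rpow_pos_of_pos hy a).ne'
  rw [fluxGap, hsum, hsum2, hgy, ← h.eq_t hmem, fluxY, rho_eq, fluxMult, fluxEnergy, drift_eq,
    thinFlux, thinDrift, potMul, gradSq, e1, e2]
  field_simp
  ring

theorem continuousOn_fluxGap (ha : a ∈ Ioo (-1 : ℝ) 1) (h : Extensions a V w gx gt gy)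
    (hV : ContDiffOn ℝ 1 V (Q5 n)) (hB : B ≤ 25) (hm : ContinuousOn m (Ioo 0 B))
    (hb : ContinuousOn b (Ioo 0 B)) (hc : 0 < c) (hTB : T₁ < B) :
    ContinuousOn (fluxGap a m b V w gx gt gy) (spaceBox n ×ˢ Icc c T₁) := by
  have hsub := box_subset (n := n) (T₁ := T₁) hc
  have hG := (continuousOn_thinGauss_pos (n := n) a).mono
    (show spaceBox n ×ˢ Icc c T₁ ⊆ univ ×ˢ Ioi 0 from fun p hp => ⟨trivial, hc.trans_le hp.2.1⟩)
  have hne : ∀ p ∈ spaceBox n ×ˢ Icc c T₁, p.2 ≠ 0 := fun p hp => (hc.trans_le hp.2.1).ne'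
  have ht : ∀ {k : ℝ → ℝ}, ContinuousOn k (Ioo 0 B) →
      ContinuousOn (fun p : SpaceTime n => k p.2) (spaceBox n ×ˢ Icc c T₁) := fun hk =>
    hk.comp continuous_snd.continuousOn fun p hp =>
      ⟨hc.trans_le hp.2.1, lt_of_le_of_lt hp.2.2 hTB⟩
  have hm' := ht hm
  have hb' := ht hb
  have hw := h.cont.mono hsub
  have hgx := fun i => (h.cont_x i).mono hsub
  have hgt := h.cont_t.mono hsub
  have hgy := h.cont_y.mono hsub
  have hV' : ContinuousOn (fun p : SpaceTime n => V (p.1.1, p.2)) (spaceBox n ×ˢ Icc c T₁) := by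
    refine hV.continuousOn.comp (by fun_prop) fun p hp => ⟨?_, (hc.trans_le hp.2.1).le,
      (lt_of_le_of_lt hp.2.2 hTB).trans_le hB⟩
    exact Metric.closedBall_subset_ball (by norm_num) hp.1.1
  have h2t : ContinuousOn (fun p : SpaceTime n => 2 * p.2) (spaceBox n ×ˢ Icc c T₁) := by fun_prop
  have h2ne : ∀ p ∈ spaceBox n ×ˢ Icc c T₁, 2 * p.2 ≠ 0 := fun p hp =>
    mul_ne_zero two_ne_zero (hne p hp)
  have hE : ContinuousOn (fun p : SpaceTime n => Real.exp (-p.1.2 ^ 2 / (4 * p.2)))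
      (spaceBox n ×ˢ Icc c T₁) :=
    ContinuousOn.rexp (ContinuousOn.div (by fun_prop) (by fun_prop)
      fun p hp => mul_ne_zero four_ne_zero (hne p hp))
  have hp1 : ∀ e : ℝ, 0 < e → ContinuousOn (fun p : SpaceTime n => p.1.2 ^ e)
      (spaceBox n ×ˢ Icc c T₁) := fun e he =>
    ContinuousOn.rpow_const (by fun_prop) fun p _ => Or.inr he.le
  have hp2 := hp1 (1 - a) (by linarith [ha.2])
  have hp3 := hp1 (1 + a) (by linarith [ha.1])
  have hS1 : ContinuousOn (fun p : SpaceTime n => ∑ i, p.1.1 i * gx i p)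
      (spaceBox n ×ˢ Icc c T₁) :=
    continuousOn_finsetSum _ fun i _ => (contDiff_coord i).continuous.continuousOn.mul (hgx i)
  have hS2 : ContinuousOn (fun p : SpaceTime n => ∑ i, gx i p ^ 2) (spaceBox n ×ˢ Icc c T₁) :=
    continuousOn_finsetSum _ fun i _ => (hgx i).pow 2
  have hD := (hS1.div h2t h2ne).add hgt
  refine ((hG.mul hE).mul ((((continuousOn_const.mul hm').mul (((hD.add ((hp2.mul hgy).div h2t
    h2ne)).sub (hb'.mul hw)))).mul hgy).add ((hm'.div h2t h2ne).mul ((hp3.mul ((hb'.mul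
    (hw.pow 2)).sub hS2)).sub (hp2.mul (hgy.pow 2)))))).sub
    (hG.mul (((continuousOn_const.mul hm').mul (hD.sub (hb'.mul hw))).mul (hV'.mul hw)))

theorem fluxGap_eq_zero (ha : a ∈ Ioo (-1 : ℝ) 1) (h : Extensions a V w gx gt gy)
    {x : EuclideanSpace ℝ (Fin n)} {t : ℝ} (ht : 0 < t) :
    fluxGap a m b V w gx gt gy ((x, 0), t) = 0 := by
  have h1 : (0 : ℝ) ^ (1 - a) = 0 := Real.zero_rpow (by linarith [ha.2])
  have h2 : (0 : ℝ) ^ (1 + a) = 0 := Real.zero_rpow (by linarith [ha.1])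
  simp only [fluxGap, h1, h2, h.robin x t ht]
  simp

/-- Dominated convergence: the gap is bounded on the compact box, vanishes for `|x| > 4`, and tends
to `0` on every vertical line. -/
theorem tendsto_fluxError (ha : a ∈ Ioo (-1 : ℝ) 1) (h : Extensions a V w gx gt gy)
    (hV : ContDiffOn ℝ 1 V (Q5 n)) (hB : B ≤ 25) (hw : ContDiffOn ℝ ∞ w (region n B))
    (hs : SupportedBy T w) (hm : ContDiffOn ℝ 1 m (Ioo 0 B)) (hb : ContDiffOn ℝ 1 b (Ioo 0 B))
    (hc : 0 < c) (hTB : T₁ < B) :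
    Tendsto (fluxError a m b V w c T₁) (𝓝[>] 0) (𝓝 0) := by
  have hw1 := hw.of_le one_le_infty
  have hcont := continuousOn_fluxGap ha h hV hB hm.continuousOn hb.continuousOn hc hTB
  obtain ⟨C, hC⟩ := (isCompact_spaceBox.prod isCompact_Icc).exists_bound_of_continuousOn hcont
  have hsupp : SupportedBy T (fun p => fluxY a m b w p - thinFlux a m b V w p) :=
    hs.fluxY.sub hs.thinFlux
  have hreg : ContinuousOn (fun p => fluxY a m b w p - thinFlux a m b V w p) (region n B) :=
    (contDiffOn_fluxY hw hm hb).continuousOn.sub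
      (continuousOn_thinFlux hV hB hw1 hs hm.continuousOn hb.continuousOn)
  have hzero : ∀ (z : EuclideanSpace ℝ (Fin n) × ℝ) (ε : ℝ), 0 < ε → 0 < z.2 → ¬‖z.1‖ ≤ 4 →
      fluxY a m b w ((z.1, ε), z.2) - thinFlux a m b V w ((z.1, ε), z.2) = 0 := by
    intro z ε hε hz hx
    by_contra hne
    exact hx (norm_le_of_normSq (hsupp ((z.1, ε), z.2) hε hz hne).1).1
  -- The limit is written as an integral of `0`. The rewriting also changes the base point of the
  -- filter, which the next line restores.
  rw [show (0 : ℝ) = ∫ _ in (univ : Set (EuclideanSpace ℝ (Fin n))) ×ˢ Icc c T₁, (0 : ℝ) by simp]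
  rw [show 𝓝[>] (∫ _ in (univ : Set (EuclideanSpace ℝ (Fin n))) ×ˢ Icc c T₁, (0 : ℝ))
    = 𝓝[>] (0 : ℝ) by simp]
  unfold fluxError
  refine tendsto_integral_filter_of_dominated_convergence
    ((Metric.closedBall (0 : EuclideanSpace ℝ (Fin n)) 4 ×ˢ Icc c T₁).indicator fun _ => C)
    ?_ ?_ ?_ ?_
  · filter_upwards [self_mem_nhdsWithin] with ε hε
    exact (integrableOn_thin hreg hsupp hε hc hTB).aestronglyMeasurable
  · filter_upwards [Ioo_mem_nhdsGT (show (0 : ℝ) < 4 by norm_num)] with ε hε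
    filter_upwards [ae_restrict_mem (MeasurableSet.univ.prod measurableSet_Icc)] with z hz
    have hz0 : 0 < z.2 := hc.trans_le hz.2.1
    by_cases hx : ‖z.1‖ ≤ 4
    · have hx' : z.1 ∈ Metric.closedBall (0 : EuclideanSpace ℝ (Fin n)) 4 := by simpa using hx
      rw [indicator_of_mem (show z ∈ Metric.closedBall 0 4 ×ˢ Icc c T₁ from ⟨hx', hz.2⟩),
        ← fluxGap_eq (p := ((z.1, ε), z.2)) h hε.1 hz0]
      exact hC _ ⟨⟨hx', hε.1.le, hε.2.le⟩, hz.2⟩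
    · rw [hzero z ε hε.1 hz0 hx, indicator_of_notMem (fun hm => hx (by simpa using hm.1))]
      simp
  · refine Integrable.mono_measure ?_ Measure.restrict_le_self
    rw [integrable_indicator_iff (Metric.isClosed_closedBall.measurableSet.prod measurableSet_Icc)]
    exact continuousOn_const.integrableOn_compact ((isCompact_closedBall _ _).prod isCompact_Icc)
  · filter_upwards [ae_restrict_mem (MeasurableSet.univ.prod measurableSet_Icc)] with z hz
    have hz0 : 0 < z.2 := hc.trans_le hz.2.1
    by_cases hx : ‖z.1‖ ≤ 4
    · have hx' : z.1 ∈ Metric.closedBall (0 : EuclideanSpace ℝ (Fin n)) 4 := by simpa using hx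
      have h1 := hcont ((z.1, 0), z.2) ⟨⟨hx', le_rfl, by norm_num⟩, hz.2⟩
      have h2 : Tendsto (fun y : ℝ => (((z.1, y), z.2) : SpaceTime n)) (𝓝[>] 0)
          (𝓝[spaceBox n ×ˢ Icc c T₁] ((z.1, 0), z.2)) := by
        refine tendsto_nhdsWithin_iff.2 ⟨?_, ?_⟩
        · have : Continuous fun y : ℝ => (((z.1, y), z.2) : SpaceTime n) := by fun_prop
          exact (this.tendsto 0).mono_left nhdsWithin_le_nhds
        · filter_upwards [Ioo_mem_nhdsGT (show (0 : ℝ) < 4 by norm_num)] with y hy0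
          exact ⟨⟨hx', hy0.1.le, hy0.2.le⟩, hz.2⟩
      have h3 := h1.tendsto.comp h2
      rw [fluxGap_eq_zero ha h hz0] at h3
      refine h3.congr' ?_
      filter_upwards [self_mem_nhdsWithin] with y hy0
      exact fluxGap_eq h hy0 hz0
    · refine tendsto_const_nhds.congr' ?_
      filter_upwards [self_mem_nhdsWithin] with y hy0
      exact (hzero z y hy0 hz0 hx).symm

end Limits

end ThinCarleman

/-! ### Integrability up to the thin space and exhaustion by levels. -/

namespace ThinCarleman

variable {n : ℕ}

section Integrability

variable {a T c T₁ : ℝ} {F w gt gy : SpaceTime n → ℝ} {gx : Fin n → SpaceTime n → ℝ}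
  {V : EuclideanSpace ℝ (Fin n) × ℝ → ℝ} {k : ℝ → ℝ}

theorem SupportedBy.integrableOn_Ici (hs : SupportedBy T F) (hT : T ≤ T₁) (hc : 0 < c)
    (hF : IntegrableOn F (spaceBoxPos n ×ˢ Icc c T₁)) : IntegrableOn F (upperHalf n ×ˢ Ici c) := by
  refine hF.of_forall_sdiff_eq_zero (isOpen_upperHalf.measurableSet.prod measurableSet_Ici)
    fun p hp => ?_
  by_contra hne
  have hy : 0 < p.1.2 := hp.1.1
  have h1 := hs p hy (hc.trans_le hp.1.2) hne
  exact hp.2 ⟨mem_spaceBoxPos hy h1.1, hp.1.2, h1.2.trans hT⟩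

theorem SupportedBy.integrableOn_upperHalf (hs : SupportedBy T F) (hc : 0 < c)
    (hF : IntegrableOn (fun X => F (X, c)) (spaceBoxPos n)) :
    IntegrableOn (fun X => F (X, c)) (upperHalf n) := by
  refine hF.of_forall_sdiff_eq_zero isOpen_upperHalf.measurableSet fun X hX => ?_
  by_contra hne
  have hy : 0 < X.2 := hX.1
  exact hX.2 (mem_spaceBoxPos hy (hs (X, c) hy hc hne).1)

theorem spaceBoxPos_pos {X : Space n} (hX : X ∈ spaceBoxPos n) : 0 < X.2 := hX.2.1

/-- The normal part `y^a (∂_y w)²` is `y^{-a}` times the square of the flux, so integrability of the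
gradient terms requires both `a > -1` and `-a > -1`. -/
theorem weighted_gradSq_eq (h : Extensions a V w gx gt gy) {p : SpaceTime n} (hy : 0 < p.1.2)
    (ht : 0 < p.2) (r : ℝ) :
    p.1.2 ^ a * r * gradSq w p * gauss a p
      = p.1.2 ^ a * (r * (∑ i, gx i p ^ 2) * gauss a p)
        + p.1.2 ^ (-a) * (r * gy p ^ 2 * gauss a p) := by
  have hmem : p ∈ upperHalf n ×ˢ Ioi (0 : ℝ) := ⟨hy, ht⟩
  have hgy : gy p = p.1.2 ^ a * dy w p := (h.eq_y hmem).symm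
  have hsum2 : ∑ i, gx i p ^ 2 = ∑ i, dx i w p ^ 2 :=
    Finset.sum_congr rfl fun i _ => by rw [h.eq_x i hmem]
  have hya := (Real.rpow_pos_of_pos hy a).ne'
  rw [hgy, hsum2, gradSq, Real.rpow_neg hy.le]
  field_simp

theorem integrableOn_weighted_sq (ha : a ∈ Ioo (-1 : ℝ) 1) (h : Extensions a V w gx gt gy)
    (hs : SupportedBy T w) (hT : T ≤ T₁) (hc : 0 < c) (hk : ContinuousOn k (Icc c T₁)) :
    IntegrableOn (fun p => p.1.2 ^ a * k p.2 * w p ^ 2 * gauss a p) (upperHalf n ×ˢ Ici c) := by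
  refine SupportedBy.integrableOn_Ici ((hs.sq.mul_left _).mul_right _) hT hc ?_
  have hsub := box_subset (n := n) (T₁ := T₁) hc
  have hk' : ContinuousOn (fun p : SpaceTime n => k p.2) (spaceBox n ×ˢ Icc c T₁) :=
    hk.comp continuous_snd.continuousOn fun p hp => hp.2
  have hG := (continuousOn_gauss_pos (n := n) a).mono
    (show spaceBox n ×ˢ Icc c T₁ ⊆ univ ×ˢ Ioi 0 from fun p hp => ⟨trivial, hc.trans_le hp.2.1⟩)
  refine (integrableOn_timeBoxPos ha.1 ((hk'.mul ((h.cont.mono hsub).pow 2)).mul hG)).congr_fun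
    (fun p _ => ?_) (measurableSet_spaceBoxPos.prod measurableSet_Icc)
  simp only [Pi.mul_apply, Pi.pow_apply]
  ring

theorem integrableOn_weighted_gradSq (ha : a ∈ Ioo (-1 : ℝ) 1) (h : Extensions a V w gx gt gy)
    (hs : SupportedBy T w) (hT : T ≤ T₁) (hc : 0 < c) (hk : ContinuousOn k (Icc c T₁)) :
    IntegrableOn (fun p => p.1.2 ^ a * k p.2 * gradSq w p * gauss a p)
      (upperHalf n ×ˢ Ici c) := by
  refine SupportedBy.integrableOn_Ici ((hs.gradSq.mul_left _).mul_right _) hT hc ?_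
  have hsub := box_subset (n := n) (T₁ := T₁) hc
  have hk' : ContinuousOn (fun p : SpaceTime n => k p.2) (spaceBox n ×ˢ Icc c T₁) :=
    hk.comp continuous_snd.continuousOn fun p hp => hp.2
  have hG := (continuousOn_gauss_pos (n := n) a).mono
    (show spaceBox n ×ˢ Icc c T₁ ⊆ univ ×ˢ Ioi 0 from fun p hp => ⟨trivial, hc.trans_le hp.2.1⟩)
  have h1 : ContinuousOn (fun p => k p.2 * (∑ i, gx i p ^ 2) * gauss a p)
      (spaceBox n ×ˢ Icc c T₁) :=
    (hk'.mul (continuousOn_finsetSum _ fun i _ => ((h.cont_x i).mono hsub).pow 2)).mul hG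
  have h2 : ContinuousOn (fun p => k p.2 * gy p ^ 2 * gauss a p) (spaceBox n ×ˢ Icc c T₁) :=
    (hk'.mul ((h.cont_y.mono hsub).pow 2)).mul hG
  refine ((integrableOn_timeBoxPos ha.1 h1).add (integrableOn_timeBoxPos
    (by linarith [ha.2] : -1 < -a) h2)).congr_fun (fun p hp => ?_)
    (measurableSet_spaceBoxPos.prod measurableSet_Icc)
  exact (weighted_gradSq_eq h (spaceBoxPos_pos hp.1) (hc.trans_le hp.2.1) _).symm

theorem integrableOn_slice_sq (ha : a ∈ Ioo (-1 : ℝ) 1) (h : Extensions a V w gx gt gy)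
    (hs : SupportedBy T w) (hc : 0 < c) :
    IntegrableOn (fun X => X.2 ^ a * w (X, c) ^ 2 * gauss a (X, c)) (upperHalf n) := by
  refine SupportedBy.integrableOn_upperHalf (F := fun p => p.1.2 ^ a * w p ^ 2 * gauss a p)
    ((hs.sq.mul_left _).mul_right _) hc ?_
  have hmap : MapsTo (fun X : Space n => (X, c)) (spaceBox n) (upperHalfClosed n ×ˢ Ioi 0) :=
    fun X hX => ⟨hX.2.1, hc⟩
  have hG : ContinuousOn (fun X : Space n => gauss a (X, c)) (spaceBox n) :=
    (continuousOn_gauss_pos a).comp (by fun_prop) fun X _ => ⟨trivial, hc⟩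
  refine (integrableOn_spaceBoxPos ha.1 (((h.cont.comp (by fun_prop) hmap).pow 2).mul
    hG)).congr_fun (fun X _ => ?_) measurableSet_spaceBoxPos
  simp only [Pi.mul_apply, Pi.pow_apply, Function.comp_apply]
  ring

theorem integrableOn_slice_gradSq (ha : a ∈ Ioo (-1 : ℝ) 1) (h : Extensions a V w gx gt gy)
    (hs : SupportedBy T w) (hc : 0 < c) :
    IntegrableOn (fun X => X.2 ^ a * gradSq w (X, c) * gauss a (X, c)) (upperHalf n) := by
  refine SupportedBy.integrableOn_upperHalf (F := fun p => p.1.2 ^ a * gradSq w p * gauss a p)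
    ((hs.gradSq.mul_left _).mul_right _) hc ?_
  have hmap : MapsTo (fun X : Space n => (X, c)) (spaceBox n) (upperHalfClosed n ×ˢ Ioi 0) :=
    fun X hX => ⟨hX.2.1, hc⟩
  have hG : ContinuousOn (fun X : Space n => gauss a (X, c)) (spaceBox n) :=
    (continuousOn_gauss_pos a).comp (by fun_prop) fun X _ => ⟨trivial, hc⟩
  have h1 : ContinuousOn (fun X => 1 * (∑ i, gx i (X, c) ^ 2) * gauss a (X, c)) (spaceBox n) :=
    (continuousOn_const.mul (continuousOn_finsetSum _ fun i _ =>
      ((h.cont_x i).comp (by fun_prop) hmap).pow 2)).mul hG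
  have h2 : ContinuousOn (fun X => 1 * gy (X, c) ^ 2 * gauss a (X, c)) (spaceBox n) :=
    (continuousOn_const.mul ((h.cont_y.comp (by fun_prop) hmap).pow 2)).mul hG
  refine ((integrableOn_spaceBoxPos ha.1 h1).add (integrableOn_spaceBoxPos
    (by linarith [ha.2] : -1 < -a) h2)).congr_fun (fun X hX => ?_) measurableSet_spaceBoxPos
  have := weighted_gradSq_eq h (p := (X, c)) (spaceBoxPos_pos hX) hc 1
  rw [mul_one] at this
  exact this.symm

end Integrability

section Exhaustion

variable {T c T₁ : ℝ} {F : SpaceTime n → ℝ}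

theorem one_div_antitone {i j : ℕ} (hij : i ≤ j) : (1 : ℝ) / (j + 1) ≤ 1 / (i + 1) :=
  one_div_le_one_div_of_le (by positivity) (by exact_mod_cast Nat.succ_le_succ hij)

theorem iUnion_Ioi_one_div : ⋃ k : ℕ, Ioi (1 / ((k : ℝ) + 1)) = Ioi 0 := by
  ext y
  simp only [mem_iUnion, mem_Ioi]
  refine ⟨fun ⟨k, hk⟩ => lt_trans (by positivity) hk, fun hy => exists_nat_one_div_lt hy⟩

theorem tendsto_integral_slab (hs : SupportedBy T F) (hT : T ≤ T₁) (hc : 0 < c)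
    (hF : IntegrableOn F (upperHalf n ×ˢ Ici c)) :
    Tendsto (fun k : ℕ => ∫ p in slab n (1 / ((k : ℝ) + 1)) c T₁, F p) atTop
      (𝓝 (∫ p in upperHalf n ×ˢ Ici c, F p)) := by
  have hU : ⋃ k : ℕ, slab n (1 / ((k : ℝ) + 1)) c T₁ = upperHalf n ×ˢ Icc c T₁ := by
    simp only [slab]
    rw [← iUnion_prod_const, ← prod_iUnion, iUnion_Ioi_one_div, upperHalf_eq]
  have h1 : ∫ p in upperHalf n ×ˢ Ici c, F p = ∫ p in upperHalf n ×ˢ Icc c T₁, F p := by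
    refine setIntegral_eq_of_subset_of_forall_sdiff_eq_zero
      (isOpen_upperHalf.measurableSet.prod measurableSet_Ici)
      (prod_mono le_rfl Icc_subset_Ici_self) fun p hp => ?_
    by_contra hne
    have h1 := hs p hp.1.1 (hc.trans_le hp.1.2) hne
    exact hp.2 ⟨hp.1.1, hp.1.2, h1.2.trans hT⟩
  rw [h1, ← hU]
  refine tendsto_setIntegral_of_monotone (fun k => measurableSet_slab _ _ _)
    (fun i j hij => prod_mono (prod_mono le_rfl (Ioi_subset_Ioi (one_div_antitone hij))) le_rfl) ?_
  rw [hU]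
  exact hF.mono_set (prod_mono le_rfl Icc_subset_Ici_self)

theorem tendsto_integral_slice {f : Space n → ℝ} (hf : IntegrableOn f (upperHalf n)) :
    Tendsto (fun k : ℕ => ∫ X in univ ×ˢ Ioi (1 / ((k : ℝ) + 1)), f X) atTop
      (𝓝 (∫ X in upperHalf n, f X)) := by
  have hU : ⋃ k : ℕ, (univ : Set (EuclideanSpace ℝ (Fin n))) ×ˢ Ioi (1 / ((k : ℝ) + 1))
      = upperHalf n := by
    rw [← prod_iUnion, iUnion_Ioi_one_div, upperHalf_eq]
  rw [← hU] at hf ⊢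
  exact tendsto_setIntegral_of_monotone (fun k => MeasurableSet.univ.prod measurableSet_Ioi)
    (fun i j hij => prod_mono le_rfl (Ioi_subset_Ioi (one_div_antitone hij))) hf

theorem eventually_levelSmall {a α : ℝ} (ha : a ∈ Ioo (-1 : ℝ) 1) (hα : 0 < α) (hc : 0 < c) :
    ∀ᶠ ε in 𝓝[>] (0 : ℝ), LevelSmall a α c ε := by
  have hr : 0 < √(c / α) := Real.sqrt_pos.2 (by positivity)
  have h1 : Tendsto (fun ε : ℝ => (ε / √(c / α)) ^ (1 + a)) (𝓝[>] 0) (𝓝 0) := by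
    have hc : ContinuousAt (fun ε : ℝ => (ε / √(c / α)) ^ (1 + a)) 0 :=
      (continuousAt_id.div_const _).rpow_const (Or.inr (by linarith [ha.1]))
    have h2 := hc.tendsto
    simp only [zero_div, Real.zero_rpow (by linarith [ha.1] : 1 + a ≠ 0)] at h2
    exact h2.mono_left nhdsWithin_le_nhds
  filter_upwards [Ioo_mem_nhdsGT hr, h1.eventually (eventually_le_nhds (by norm_num :
    (0 : ℝ) < 1 / 2))] with ε hε hε'
  exact ⟨hε.1, hε.2.le, hε'⟩

theorem tendsto_one_div_nhdsGT :
    Tendsto (fun k : ℕ => 1 / ((k : ℝ) + 1)) atTop (𝓝[>] 0) :=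
  tendsto_nhdsWithin_iff.2 ⟨tendsto_one_div_add_atTop_nhds_zero_nat,
    Eventually.of_forall fun k => by simp only [mem_Ioi]; positivity⟩

end Exhaustion

end ThinCarleman

/-! ### Translation of the hypotheses and the inequality on the whole half-space. -/

namespace ThinCarleman

variable {n : ℕ}

/-- The hypothesis on `α` forces the extended norm to be finite; `N` is its real value. Only
interior points of the cylinder are used, where the derivative within `Q5` is the full derivative.
-/
theorem exists_potentialBound {V : EuclideanSpace ℝ (Fin n) × ℝ → ℝ} {s M α B : ℝ} (hs : 0 < s)
    (hM : 0 < M) (hB : B ≤ 1)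
    (h : ENNReal.ofReal M * (1 + potNorm V ^ (1 / (2 * s))) ≤ ENNReal.ofReal α) :
    ∃ N, 1 ≤ N ∧ PotentialBound B N V ∧ M * (1 + N ^ (1 / (2 * s))) ≤ α := by
  have hs2 : 0 < 1 / (2 * s) := by positivity
  have htop : potNorm V ≠ ⊤ := fun htop => by
    rw [htop, ENNReal.top_rpow_of_pos hs2, add_top, ENNReal.mul_top (by simpa using hM)] at h
    exact (lt_of_le_of_lt h ENNReal.ofReal_lt_top).ne rfl
  have h1 : 1 ≤ potNorm V := by
    unfold potNorm
    rw [add_assoc, add_assoc]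
    exact le_self_add
  set N := (potNorm V).toReal with hN
  have hN1 : 1 ≤ N := by simpa using ENNReal.toReal_mono htop h1
  have hle : ∀ {E : Type} [NormedAddCommGroup E] (x : E), ‖x‖ₑ ≤ potNorm V → ‖x‖ ≤ N :=
    fun x hx => by simpa using ENNReal.toReal_mono htop hx
  have b1 : ∀ p ∈ Q5 n, ‖V p‖ₑ ≤ potNorm V := fun p hp => by
    unfold potNorm
    refine le_trans (le_iSup₂ (f := fun p (_ : p ∈ Q5 n) => ‖V p‖ₑ) p hp) ?_
    rw [add_assoc, add_assoc]
    exact le_add_of_nonneg_of_le zero_le le_self_add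
  have b2 : ∀ p ∈ Q5 n, ‖(fderivWithin ℝ V (Q5 n) p).comp (ContinuousLinearMap.inl ℝ _ _)‖ₑ
      ≤ potNorm V := fun p hp => by
    unfold potNorm
    refine le_trans (le_iSup₂ (f := fun p (_ : p ∈ Q5 n) =>
      ‖(fderivWithin ℝ V (Q5 n) p).comp (ContinuousLinearMap.inl ℝ _ _)‖ₑ) p hp) ?_
    exact le_trans le_add_self le_self_add
  have b3 : ∀ p ∈ Q5 n, ‖fderivWithin ℝ V (Q5 n) p (0, 1)‖ₑ ≤ potNorm V := fun p hp => by
    unfold potNorm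
    exact le_trans (le_iSup₂ (f := fun p (_ : p ∈ Q5 n) =>
      ‖fderivWithin ℝ V (Q5 n) p (0, 1)‖ₑ) p hp) le_add_self
  refine ⟨N, hN1, ⟨fun x t hx ht => ?_, fun x t hx ht => ?_⟩, ?_⟩
  · have hmem := mem_of_mem_nhds (mem_nhds_Q5 (x := x) (t := t) (by linarith)
      ⟨ht.1, by linarith [ht.2]⟩)
    exact hle _ (b1 _ hmem)
  · have hnhds := mem_nhds_Q5 (x := x) (t := t) (by linarith) ⟨ht.1, by linarith [ht.2]⟩
    have hmem := mem_of_mem_nhds hnhds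
    have c2 := hle _ (b2 _ hmem)
    have c3 := hle _ (b3 _ hmem)
    rw [fderivWithin_of_mem_nhds hnhds] at c2 c3
    set L := fderiv ℝ V (x, t) with hL
    have e1 : L ((1 / (2 * t)) • x, 1)
        = (1 / (2 * t)) * (L.comp (ContinuousLinearMap.inl ℝ _ _)) x + L (0, 1) := by
      have : (((1 / (2 * t)) • x, 1) : EuclideanSpace ℝ (Fin n) × ℝ)
          = (1 / (2 * t)) • (x, 0) + (0, 1) := by simp
      rw [this, map_add, map_smul]
      simp
    have c4 : |(L.comp (ContinuousLinearMap.inl ℝ _ _)) x| ≤ N * 4 := by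
      refine ((L.comp (ContinuousLinearMap.inl ℝ _ _)).le_opNorm x).trans ?_
      gcongr
    have ht0 := ht.1
    have ht1 : t ≤ 1 := by linarith [ht.2]
    rw [e1]
    calc _ ≤ |1 / (2 * t) * (L.comp (ContinuousLinearMap.inl ℝ _ _)) x| + |L (0, 1)| :=
          abs_add_le _ _
      _ ≤ 1 / (2 * t) * (N * 4) + N := by
          rw [abs_mul, abs_of_pos (by positivity : 0 < 1 / (2 * t))]
          gcongr
          exact c3
      -- The coefficient `2N` is `|x|/2 ≤ 2` times the bound on `∇_x V`; the time derivative is put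
      -- over `t` using `t ≤ 1`.
      _ = (2 * N + N * t) / t := by field_simp; ring
      _ ≤ 3 * N / t := by
          gcongr
          nlinarith
  · have e : potNorm V = ENNReal.ofReal N := (ENNReal.ofReal_toReal htop).symm
    rw [e, ENNReal.ofReal_rpow_of_pos (by linarith), ← ENNReal.ofReal_one,
      ← ENNReal.ofReal_add zero_le_one (by positivity), ← ENNReal.ofReal_mul hM.le,
      ENNReal.ofReal_le_ofReal_iff'] at h
    have hpos : 0 < M * (1 + N ^ (1 / (2 * s))) := by positivity
    exact h.resolve_right (not_le.2 hpos)

theorem multCoeff_bounds {α Γ t : ℝ} {σ : ℝ → ℝ} (hΓ : 1 ≤ Γ) (ht : 0 < t)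
    (hσ : 0 < σ t) (h1 : 1 / Γ ≤ logSlope σ t) (h2 : logSlope σ t ≤ 1) :
    t * σ t ^ (-2 * α) ≤ multCoeff α σ t ∧ multCoeff α σ t ≤ Γ * (t * σ t ^ (-2 * α)) := by
  have hΓ0 : 0 < Γ := by linarith
  have hg : 0 < logSlope σ t := lt_of_lt_of_le (by positivity) h1
  have hA : 0 < σ t ^ (-2 * α) := Real.rpow_pos_of_pos hσ _
  have k1 : 1 ≤ logSlope σ t ^ (-(1 / 2) : ℝ) :=
    Real.one_le_rpow_of_pos_of_le_one_of_nonpos hg h2 (by norm_num)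
  have k2 : logSlope σ t ^ (-(1 / 2) : ℝ) ≤ Γ := by
    calc logSlope σ t ^ (-(1 / 2) : ℝ) ≤ (1 / Γ) ^ (-(1 / 2) : ℝ) :=
          Real.rpow_le_rpow_of_nonpos (by positivity) h1 (by norm_num)
      _ = Γ ^ (1 / 2 : ℝ) := by
          rw [one_div Γ, Real.inv_rpow hΓ0.le, Real.rpow_neg hΓ0.le, inv_inv]
      _ ≤ Γ ^ (1 : ℝ) := Real.rpow_le_rpow_of_exponent_le hΓ (by norm_num)
      _ = Γ := Real.rpow_one Γ
  unfold multCoeff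
  constructor
  · calc t * σ t ^ (-2 * α) = t * 1 * σ t ^ (-2 * α) := by ring
      _ ≤ _ := by gcongr
  · calc _ ≤ t * Γ * σ t ^ (-2 * α) := by gcongr
      _ = _ := by ring

theorem rpow_one_sub {σ α : ℝ} (hσ : 0 < σ) : σ ^ (1 - 2 * α) = σ * σ ^ (-2 * α) := by
  rw [show 1 - 2 * α = 1 + -2 * α by ring, Real.rpow_add hσ, Real.rpow_one]

section Main

variable {a s α lam c Γ K N : ℝ} {σ : ℝ → ℝ} {w : SpaceTime n → ℝ}
  {V : EuclideanSpace ℝ (Fin n) × ℝ → ℝ}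

/-- The Carleman inequality with constants expressed through the bounds on the weight. -/
theorem carleman_of_bounds (hs : s ∈ Ioo (0 : ℝ) 1) (has : a = 1 - 2 * s) (hα : 1 ≤ α)
    (hαl : α ≤ lam) (hΓ : 1 ≤ Γ) (hK : 0 < K)
    (hσ : IsCarlemanWeight s lam σ)
    (hbd : ∀ t ∈ Ioo 0 (1 / lam), 1 / Γ ≤ logSlope σ t ∧ logSlope σ t ≤ 1 ∧ t / Γ ≤ σ t ∧ σ t ≤ t ∧
      0 ≤ theta s (lam * t) ∧ theta s (lam * t) ≤ K)
    (hN : 1 ≤ N) (hVN : PotentialBound (1 / lam) N V) (hV : ContDiffOn ℝ 1 V (Q5 n))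
    (hNα : (4 * Γ * (4 + K / 2) * traceConst a + 2 * traceConst a) * N ≤ α ^ (2 * s))
    (hc : 0 < c) (hcl : c ≤ 1 / (5 * lam))
    (hw : IsTestFunction a (1 / (Real.exp 1 * lam)) V w) :
    IntegrableOn (fun p => p.1.2 ^ a * σ p.2 ^ (-2 * α) * w p ^ 2 * gauss a p)
        (upperHalf n ×ˢ Ici c) ∧
      IntegrableOn (fun p => p.1.2 ^ a * σ p.2 ^ (1 - 2 * α) * gradSq w p * gauss a p)
        (upperHalf n ×ˢ Ici c) ∧
      IntegrableOn (fun X => X.2 ^ a * gradSq w (X, c) * gauss a (X, c)) (upperHalf n) ∧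
      IntegrableOn (fun X => X.2 ^ a * w (X, c) ^ 2 * gauss a (X, c)) (upperHalf n) ∧
      (IntegrableOn (fun p => σ p.2 ^ (1 - 2 * α) * p.1.2 ^ (-a) * extOp a w p ^ 2 * gauss a p)
        (upperHalf n ×ˢ Ici c) →
      1 / (4 * Γ) * (α ^ 2 * (∫ p in upperHalf n ×ˢ Ici c,
            p.1.2 ^ a * σ p.2 ^ (-2 * α) * w p ^ 2 * gauss a p)
          + α * (∫ p in upperHalf n ×ˢ Ici c,
            p.1.2 ^ a * σ p.2 ^ (1 - 2 * α) * gradSq w p * gauss a p))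
        ≤ Γ ^ 2 * (∫ p in upperHalf n ×ˢ Ici c,
            σ p.2 ^ (1 - 2 * α) * p.1.2 ^ (-a) * extOp a w p ^ 2 * gauss a p)
          + multCoeff α σ c * (-(1 / 2) * (∫ X in upperHalf n,
              X.2 ^ a * gradSq w (X, c) * gauss a (X, c))
            + 3 * α / (2 * c) * (∫ X in upperHalf n,
              X.2 ^ a * w (X, c) ^ 2 * gauss a (X, c)))) := by
  have ha : a ∈ Ioo (-1 : ℝ) 1 := by
    rw [has]; exact ⟨by linarith [hs.2], by linarith [hs.1]⟩
  have hα0 : 0 < α := by linarith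
  have hlam : 0 < lam := by linarith
  have hΓ0 : 0 < Γ := by linarith
  have he1 : 1 < Real.exp 1 := by linarith [Real.add_one_lt_exp one_ne_zero]
  have he5 : Real.exp 1 < 5 := by linarith [Real.exp_one_lt_d9]
  set T₁ := 1 / (Real.exp 1 * lam) with hT₁
  set B := 1 / lam with hB
  have hTB : T₁ < B := by
    rw [hT₁, hB]
    exact one_div_lt_one_div_of_lt hlam (by nlinarith)
  have hB1 : B ≤ 1 := by rw [hB, div_le_one hlam]; linarith
  have hcT : c ≤ T₁ := hcl.trans (one_div_le_one_div_of_le (by positivity) (by gcongr))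
  obtain ⟨T, hT, hsupp⟩ := hw.support
  have hS : SupportedBy T w := fun p hy ht hne =>
    hsupp p ⟨show 0 ≤ p.1.2 from hy.le, ht⟩ hne
  obtain ⟨gx, gt, gy, hext⟩ := hw.exists_extensions
  have hwB : ContDiffOn ℝ ∞ w (region n B) :=
    hw.smooth.mono (prod_mono le_rfl Ioo_subset_Ioi_self)
  have hmem : ∀ t ∈ Icc c T₁, t ∈ Ioo 0 B := fun t ht =>
    ⟨hc.trans_le ht.1, lt_of_le_of_lt ht.2 hTB⟩
  have hσc : ContinuousOn σ (Icc c T₁) := fun t ht =>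
    (hσ.hasDerivAt (hmem t ht)).continuousAt.continuousWithinAt
  have hk : ∀ e : ℝ, ContinuousOn (fun t => σ t ^ e) (Icc c T₁) := fun e =>
    hσc.rpow_const fun t ht => Or.inl (hσ.pos t (hmem t ht)).ne'
  have i1 := integrableOn_weighted_sq ha hext hS hT.le hc (hk (-2 * α))
  have i2 := integrableOn_weighted_gradSq ha hext hS hT.le hc (hk (1 - 2 * α))
  have j1 := integrableOn_slice_gradSq ha hext hS hc
  have j2 := integrableOn_slice_sq ha hext hS hc
  refine ⟨i1, i2, j1, j2, fun i3 => ?_⟩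
  set m := multCoeff α σ with hm
  set b := dampCoeff α σ with hb
  set Θ : ℝ → ℝ := fun t => theta s (lam * t) with hΘ
  set I1 : SpaceTime n → ℝ := fun p => p.1.2 ^ a * σ p.2 ^ (-2 * α) * w p ^ 2 * gauss a p with hI1
  set I2 : SpaceTime n → ℝ :=
    fun p => p.1.2 ^ a * σ p.2 ^ (1 - 2 * α) * gradSq w p * gauss a p with hI2
  set I3 : SpaceTime n → ℝ :=
    fun p => σ p.2 ^ (1 - 2 * α) * p.1.2 ^ (-a) * extOp a w p ^ 2 * gauss a p with hI3
  have s1 : SupportedBy T I1 := (hS.sq.mul_left _).mul_right _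
  have s2 : SupportedBy T I2 := (hS.gradSq.mul_left _).mul_right _
  have s3 : SupportedBy T I3 := (hS.extOp.sq.mul_left _).mul_right _
  have hm1 : ContDiffOn ℝ 1 m (Ioo 0 B) := hσ.contDiffOn_multCoeff hs.1 hlam α
  have hb1 : ContDiffOn ℝ 1 b (Ioo 0 B) := hσ.contDiffOn_dampCoeff hs.1 hlam α
  have hΘc : ContinuousOn Θ (Ioo 0 B) := IsCarlemanWeight.continuousOn_theta hs.1 hlam
  have hmb : ∀ t ∈ Ioo 0 B, t * σ t ^ (-2 * α) ≤ m t ∧ m t ≤ Γ * (t * σ t ^ (-2 * α)) :=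
    fun t ht => multCoeff_bounds hΓ ht.1 (hσ.pos t ht) (hbd t ht).1 (hbd t ht).2.1
  have hA : ∀ t ∈ Ioo 0 B, 0 < σ t ^ (-2 * α) := fun t ht => Real.rpow_pos_of_pos (hσ.pos t ht) _
  have hm0 : ∀ t ∈ Ioo 0 B, 0 ≤ m t := fun t ht =>
    (mul_nonneg ht.1.le (hA t ht).le).trans (hmb t ht).1
  have hbl : ∀ t ∈ Ioo 0 B, α / (Γ * t) ≤ b t := fun t ht => by
    have h1 := (hbd t ht).1
    have ht0 := ht.1
    calc α / (Γ * t) = α * (1 / Γ) / t := by field_simp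
      _ ≤ _ := by simp only [hb, dampCoeff]; gcongr
  have hbu : ∀ t ∈ Ioo 0 B, b t ≤ α / t := fun t ht => by
    have h1 := (hbd t ht).2.1
    have ht0 := ht.1
    simp only [hb, dampCoeff]
    gcongr
    exact mul_le_of_le_one_right hα0.le h1
  have hpow : ∀ t, 0 < t → α ^ (2 * s) * (t / α) ^ s = (α * t) ^ s := fun t ht => by
    rw [Real.rpow_mul hα0.le, Real.rpow_two, ← Real.mul_rpow (by positivity) (by positivity)]
    congr 1
    field_simp
  have hC0 := traceConst_pos ha
  have hΘlow : ∀ t ∈ Icc c T₁, (lam * t) ^ s ≤ Θ t := fun t ht => by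
    refine rpow_le_theta hs.1 (mul_pos hlam (hmem t ht).1) ?_
    calc lam * t ≤ lam * T₁ := by gcongr; exact ht.2
      _ = _ := by rw [hT₁]; field_simp
  -- The balance that fixes the size of `α`: `N` is at most a multiple of `α^{2s}`, and `α^{2s}
  -- (t/α)^s = (αt)^s ≤ (λt)^s ≤ Θ(t)`.
  have hsmall : ∀ t ∈ Icc c T₁,
      4 * Γ * ((4 + K / 2) * N * (traceConst a * (t / α) ^ s)) ≤ Θ t := fun t ht => by
    have ht0 := (hmem t ht).1
    have hp : 0 ≤ (t / α) ^ s := Real.rpow_nonneg (by positivity) _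
    calc _ = (4 * Γ * (4 + K / 2) * traceConst a) * N * (t / α) ^ s := by ring
      _ ≤ (4 * Γ * (4 + K / 2) * traceConst a + 2 * traceConst a) * N * (t / α) ^ s := by
          gcongr; linarith
      _ ≤ α ^ (2 * s) * (t / α) ^ s := by gcongr
      _ = (α * t) ^ s := hpow t ht0
      _ ≤ (lam * t) ^ s := Real.rpow_le_rpow (by positivity) (by gcongr) hs.1.le
      _ ≤ _ := hΘlow t ht
  have hsmall' : N * (traceConst a * (c / α) ^ s) ≤ 1 / 2 := by
    have hp : 0 ≤ (c / α) ^ s := Real.rpow_nonneg (by positivity) _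
    have h1 : (2 * traceConst a) * N * (c / α) ^ s ≤ 1 := by
      calc _ ≤ (4 * Γ * (4 + K / 2) * traceConst a + 2 * traceConst a) * N * (c / α) ^ s := by
            gcongr
            have : 0 ≤ 4 * Γ * (4 + K / 2) * traceConst a := by positivity
            linarith
        _ ≤ α ^ (2 * s) * (c / α) ^ s := by gcongr
        _ = (α * c) ^ s := hpow c hc
        _ ≤ 1 := by
            refine Real.rpow_le_one (by positivity) ?_ hs.1.le
            calc α * c ≤ lam * (1 / (5 * lam)) := by gcongr
              _ ≤ 1 := by field_simp; norm_num
    linarith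
  have hlevel : ∀ᶠ k : ℕ in atTop,
      1 / (4 * Γ) * (α ^ 2 * (∫ p in slab n (1 / ((k : ℝ) + 1)) c T₁, I1 p)
          + α * (∫ p in slab n (1 / ((k : ℝ) + 1)) c T₁, I2 p))
        ≤ Γ ^ 2 * (∫ p in slab n (1 / ((k : ℝ) + 1)) c T₁, I3 p)
          + fluxError a m b V w c T₁ (1 / ((k : ℝ) + 1))
          + m c * (-(1 / 2) * (∫ X in univ ×ˢ Ioi (1 / ((k : ℝ) + 1)),
              X.2 ^ a * gradSq w (X, c) * gauss a (X, c))
            + 3 * α / (2 * c) * (∫ X in univ ×ˢ Ioi (1 / ((k : ℝ) + 1)),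
              X.2 ^ a * w (X, c) ^ 2 * gauss a (X, c))) := by
    filter_upwards [tendsto_one_div_nhdsGT.eventually (eventually_levelSmall ha hα0 hc)] with k hε
    set ε := 1 / ((k : ℝ) + 1) with hεdef
    have hε0 := hε.1
    have hsub : slab n ε c T₁ ⊆ upperHalf n ×ˢ Ici c := fun p hp =>
      ⟨hε0.trans hp.1.2, hp.2.1⟩
    have hlev := carleman_level hε ha has hα hΓ (by linarith : 0 ≤ N) hVN hV (by linarith) hwB hS
      hm1 hb1 hΘc hs.1.le hs.2.le hm0 (fun t ht => (hbd t ht).2.2.2.2.1)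
      (fun t ht => (hbd t ht).2.2.2.2.2) (fun t ht => hσ.hasDerivAt_multCoeff α ht)
      (fun t ht => hσ.hasDerivAt_dampCoeff α ht) hbl hbu hc hcT hT hTB hsmall hsmall'
    have hw1 := hwB.of_le one_le_infty
    have iL : IntegrableOn (fun p => m p.2 * Θ p.2 / (4 * p.2) * traceDensity a (α / Γ) w p)
        (slab n ε c T₁) := by
      refine integrableOn_slab (ContinuousOn.mul (ContinuousOn.div ((continuousOn_time
        hm1.continuousOn).mul (continuousOn_time hΘc)) (by fun_prop) fun p hp => ?_)
        (continuousOn_traceDensity hw1 a (α / Γ))) ((hS.traceDensity a (α / Γ)).mul_left _)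
        hε0 hc hTB
      exact mul_ne_zero four_ne_zero (ne_of_gt hp.2.1)
    have iO : IntegrableOn (fun p => m p.2 * opDensity a w p) (slab n ε c T₁) :=
      integrableOn_slab ((continuousOn_time hm1.continuousOn).mul (continuousOn_opDensity hwB))
        (hS.opDensity.mul_left _) hε0 hc hTB
    have l1 : 1 / (4 * Γ) * (α ^ 2 * (∫ p in slab n ε c T₁, I1 p)
          + α * (∫ p in slab n ε c T₁, I2 p))
        ≤ ∫ p in slab n ε c T₁, m p.2 * Θ p.2 / (4 * p.2) * traceDensity a (α / Γ) w p := by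
      have q1 := (i1.mono_set hsub).const_mul (α ^ 2)
      have q2 := (i2.mono_set hsub).const_mul α
      rw [← integral_const_mul, ← integral_const_mul, ← integral_add q1 q2, ← integral_const_mul]
      refine setIntegral_mono_on ((q1.add q2).const_mul _) iL (measurableSet_slab ε c T₁)
        fun p hp => ?_
      have htI := hmem p.2 hp.2
      have ht := htI.1
      have hr := rho_pos a (p := p) (hε0.trans hp.1.2) ht
      have hσp := hσ.pos _ htI
      have hAp := hA _ htI
      have hg := gradSq_nonneg w p
      -- Since `λt ≤ 1` and `s ≤ 1`, `Θ ≥ (λt)^s ≥ λt ≥ αt`. This supplies the factor `α` in front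
      -- of the gradient term and the second factor `α` in front of `w²`.
      have hΘt : α * p.2 ≤ Θ p.2 := by
        refine le_trans ?_ (hΘlow _ hp.2)
        have hx1 : lam * p.2 ≤ 1 := by
          have := htI.2.le
          rw [hB, le_div_iff₀ hlam] at this
          linarith
        calc α * p.2 ≤ lam * p.2 := by gcongr
          _ = (lam * p.2) ^ (1 : ℝ) := (Real.rpow_one _).symm
          _ ≤ _ := Real.rpow_le_rpow_of_exponent_ge (mul_pos hlam ht) hx1 hs.2.le
      have hmt : σ p.2 ^ (-2 * α) ≤ m p.2 / p.2 := by
        rw [le_div_iff₀ ht, mul_comm]; exact (hmb _ htI).1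
      have hmΘ : σ p.2 ^ (-2 * α) * (α * p.2) ≤ m p.2 / p.2 * Θ p.2 :=
        mul_le_mul hmt hΘt (by positivity) (hAp.le.trans hmt)
      have hσt : σ p.2 ≤ p.2 := (hbd _ htI).2.2.2.1
      have hD : 0 ≤ traceDensity a (α / Γ) w p :=
        traceDensity_nonneg (by positivity) w (hε0.trans hp.1.2) ht
      have hG1 : 1 / (4 * Γ) ≤ 1 / 4 := one_div_le_one_div_of_le (by norm_num) (by linarith)
      calc 1 / (4 * Γ) * (α ^ 2 * I1 p + α * I2 p)
          = 1 / (4 * Γ) * (α ^ 2 * (σ p.2 ^ (-2 * α) * (rho a p * w p ^ 2)))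
            + 1 / (4 * Γ) * (α * (σ p.2 * σ p.2 ^ (-2 * α) * (rho a p * gradSq w p))) := by
            simp only [hI1, hI2, rho, rpow_one_sub hσp]; ring
        _ ≤ 1 / (4 * Γ) * (α ^ 2 * (σ p.2 ^ (-2 * α) * (rho a p * w p ^ 2)))
            + 1 / 4 * (α * (p.2 * σ p.2 ^ (-2 * α) * (rho a p * gradSq w p))) := by gcongr
        _ = σ p.2 ^ (-2 * α) * (α * p.2) * (1 / 4 * traceDensity a (α / Γ) w p) := by
            simp only [traceDensity]; field_simp; ring
        _ ≤ m p.2 / p.2 * Θ p.2 * (1 / 4 * traceDensity a (α / Γ) w p) := by gcongr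
        _ = _ := by field_simp
    have l2 : ∫ p in slab n ε c T₁, m p.2 * opDensity a w p
        ≤ Γ ^ 2 * (∫ p in slab n ε c T₁, I3 p) := by
      rw [← integral_const_mul]
      refine setIntegral_mono_on iO ((i3.mono_set hsub).const_mul _) (measurableSet_slab ε c T₁)
        fun p hp => ?_
      have htI := hmem p.2 hp.2
      have hσp := hσ.pos _ htI
      have hAp := hA _ htI
      have hy : 0 < p.1.2 := hε0.trans hp.1.2
      have ht := htI.1
      have hO : 0 ≤ opDensity a w p := by unfold opDensity gauss; positivity
      have hσt : p.2 ≤ Γ * σ p.2 := by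
        have := (hbd _ htI).2.2.1
        rwa [div_le_iff₀ hΓ0, mul_comm] at this
      calc m p.2 * opDensity a w p ≤ Γ * (p.2 * σ p.2 ^ (-2 * α)) * opDensity a w p := by
            gcongr; exact (hmb _ htI).2
        _ ≤ Γ * (Γ * σ p.2 * σ p.2 ^ (-2 * α)) * opDensity a w p := by gcongr
        _ = _ := by simp only [hI3, opDensity, rpow_one_sub hσp]; ring
    have l3 : ∀ X : Space n, rho a (X, c) * gradSq w (X, c)
        = X.2 ^ a * gradSq w (X, c) * gauss a (X, c) := fun X => by simp only [rho]; ring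
    have l4 : ∀ X : Space n, rho a (X, c) * w (X, c) ^ 2
        = X.2 ^ a * w (X, c) ^ 2 * gauss a (X, c) := fun X => by simp only [rho]; ring
    simp only [l3, l4] at hlev
    linarith
  -- The levels `ε = 1/(k+1)` now tend to `0`.
  refine le_of_tendsto_of_tendsto (b := atTop) ?_ ?_ hlevel
  · exact (((tendsto_integral_slab s1 hT.le hc i1).const_mul _).add
      ((tendsto_integral_slab s2 hT.le hc i2).const_mul _)).const_mul _
  · have herr := (tendsto_fluxError ha hext hV (by linarith) hwB hS hm1 hb1 hc hTB).comp
      tendsto_one_div_nhdsGT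
    have := (((tendsto_integral_slab s3 hT.le hc i3).const_mul (Γ ^ 2)).add herr).add
      ((((tendsto_integral_slice j1).const_mul (-(1 / 2))).add
        ((tendsto_integral_slice j2).const_mul (3 * α / (2 * c)))).const_mul (m c))
    rw [add_zero] at this
    exact this

end Main

end ThinCarleman

/-! ### The final choice of constants. -/

namespace ThinCarleman

/-- After multiplication by `4Γ` the operator term has the constant `4Γ³` and the term in `w(·, c)²`
the constant `6Γ²`, since `m(c)` is comparable to `c σ(c)^{-2α}`. Both are at most `6Γ³`. -/
theorem carleman_scale {Γ M α c A m P I J₁ J₂ : ℝ} (hΓ : 1 ≤ Γ) (hM : 6 * Γ ^ 3 ≤ M)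
    (hα : 0 ≤ α) (hc : 0 < c) (hA : 0 ≤ A) (hI : 0 ≤ I) (hJ₁ : 0 ≤ J₁) (hJ₂ : 0 ≤ J₂)
    (hm₁ : c * A ≤ m) (hm₂ : m ≤ Γ * (c * A))
    (h : 1 / (4 * Γ) * P ≤ Γ ^ 2 * I + m * (-(1 / 2) * J₁ + 3 * α / (2 * c) * J₂)) :
    P ≤ M * I + A * (-(c / M) * J₁ + M * α * J₂) := by
  have hΓ0 : 0 < Γ := by linarith
  have hΓ2 : Γ ^ 2 ≤ Γ ^ 3 := pow_le_pow_right₀ hΓ (by norm_num)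
  have hΓ3 : 1 ≤ Γ ^ 3 := one_le_pow₀ hΓ
  have hM1 : 1 / M ≤ 1 := by
    rw [div_le_one (by linarith)]; linarith
  have hP : P ≤ 4 * Γ ^ 3 * I
      + (-(2 * Γ) * (m * J₁) + 4 * Γ * (3 * α / (2 * c)) * (m * J₂)) := by
    rw [div_mul_eq_mul_div, one_mul, div_le_iff₀ (by positivity)] at h
    linarith
  have h1 : 4 * Γ ^ 3 * I ≤ M * I := by gcongr; linarith
  have h2 : c * A * J₁ * (1 / M) ≤ 2 * Γ * (m * J₁) :=
    calc c * A * J₁ * (1 / M) ≤ c * A * J₁ * 1 := by gcongr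
      _ ≤ m * J₁ * (2 * Γ) := by
        gcongr
        · exact (by positivity : 0 ≤ c * A).trans hm₁ |> fun h => mul_nonneg h hJ₁
        · linarith
      _ = _ := by ring
  have h3 : 4 * Γ * (3 * α / (2 * c)) * (m * J₂) ≤ A * (M * α * J₂) :=
    calc 4 * Γ * (3 * α / (2 * c)) * (m * J₂)
        ≤ 4 * Γ * (3 * α / (2 * c)) * (Γ * (c * A) * J₂) := by gcongr
      _ = A * (6 * Γ ^ 2 * α * J₂) := by field_simp; ring
      _ ≤ A * (M * α * J₂) := by gcongr; linarith
  calc P ≤ _ := hP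
    _ ≤ M * I + (-(c * A * J₁ * (1 / M)) + A * (M * α * J₂)) := by linarith
    _ = _ := by ring

end ThinCarleman

theorem theorem3p1 (n : ℕ) (hn : 1 ≤ n) (s : ℝ) (hs : s ∈ Set.Ioo (0 : ℝ) 1) (a : ℝ)
    (ha : a = 1 - 2 * s) :
    ∃ M δ₀ : ℝ, 0 < M ∧ 0 < δ₀ ∧ δ₀ ≤ 1 ∧
      ∀ (V : EuclideanSpace ℝ (Fin n) × ℝ → ℝ) (α δ lam c : ℝ) (σ : ℝ → ℝ)
        (w : ThinCarleman.SpaceTime n → ℝ),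
        ContDiffOn ℝ 1 V (ThinCarleman.Q5 n) →
        ENNReal.ofReal M * (1 + ThinCarleman.potNorm V ^ (1 / (2 * s))) ≤ ENNReal.ofReal α →
        0 < δ → δ < δ₀ → lam = α / δ ^ 2 →
        0 < c → c ≤ 1 / (5 * lam) →
        ThinCarleman.IsCarlemanWeight s lam σ →
        ThinCarleman.IsTestFunction a (1 / (Real.exp 1 * lam)) V w →
        IntegrableOn
            (fun p => p.1.2 ^ a * σ p.2 ^ (-2 * α) * w p ^ 2 * ThinCarleman.gauss a p)
            (ThinCarleman.upperHalf n ×ˢ Set.Ici c) ∧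
          IntegrableOn
            (fun p => p.1.2 ^ a * σ p.2 ^ (1 - 2 * α) * ThinCarleman.gradSq w p
              * ThinCarleman.gauss a p)
            (ThinCarleman.upperHalf n ×ˢ Set.Ici c) ∧
          IntegrableOn
            (fun X => X.2 ^ a * ThinCarleman.gradSq w (X, c) * ThinCarleman.gauss a (X, c))
            (ThinCarleman.upperHalf n) ∧
          IntegrableOn
            (fun X => X.2 ^ a * w (X, c) ^ 2 * ThinCarleman.gauss a (X, c))
            (ThinCarleman.upperHalf n) ∧
          -- if the next function is not integrable, the right-hand side below is infinite
          (IntegrableOn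
            (fun p => σ p.2 ^ (1 - 2 * α) * p.1.2 ^ (-a) * ThinCarleman.extOp a w p ^ 2
              * ThinCarleman.gauss a p)
            (ThinCarleman.upperHalf n ×ˢ Set.Ici c) →
          α ^ 2 * (∫ p in ThinCarleman.upperHalf n ×ˢ Set.Ici c,
              p.1.2 ^ a * σ p.2 ^ (-2 * α) * w p ^ 2 * ThinCarleman.gauss a p)
            + α * (∫ p in ThinCarleman.upperHalf n ×ˢ Set.Ici c,
              p.1.2 ^ a * σ p.2 ^ (1 - 2 * α) * ThinCarleman.gradSq w p
                * ThinCarleman.gauss a p)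
          ≤ M * (∫ p in ThinCarleman.upperHalf n ×ˢ Set.Ici c,
              σ p.2 ^ (1 - 2 * α) * p.1.2 ^ (-a) * ThinCarleman.extOp a w p ^ 2
                * ThinCarleman.gauss a p)
            + σ c ^ (-2 * α) *
              (-(c / M) * (∫ X in ThinCarleman.upperHalf n,
                  X.2 ^ a * ThinCarleman.gradSq w (X, c) * ThinCarleman.gauss a (X, c))
                + M * α * (∫ X in ThinCarleman.upperHalf n,
                  X.2 ^ a * w (X, c) ^ 2 * ThinCarleman.gauss a (X, c)))) := by
  subst ha
  set a := 1 - 2 * s with ha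
  have hs0 : 0 < s := hs.1
  have ha' : a ∈ Ioo (-1 : ℝ) 1 := ⟨by linarith [hs.2], by linarith⟩
  obtain ⟨Γ, K, hΓ, hK, hbd⟩ := ThinCarleman.exists_weight_bounds hs0
  have hC := ThinCarleman.traceConst_pos ha'
  have hΓ0 : 0 < Γ := by linarith
  set Y := 4 * Γ * (4 + K / 2) * ThinCarleman.traceConst a + 2 * ThinCarleman.traceConst a with hY
  have hY0 : 0 < Y := by positivity
  have hYr : 0 < Y ^ (1 / (2 * s)) := by positivity
  have hΓ3 : 1 ≤ Γ ^ 3 := one_le_pow₀ hΓ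
  -- The first summand serves `carleman_scale`; the second gives `Y ≤ M^{2s}`, so that `α ≥ M
  -- N^{1/2s}` implies `Y N ≤ α^{2s}`.
  set M := 6 * Γ ^ 3 + Y ^ (1 / (2 * s)) with hM
  have hM1 : 1 ≤ M := by linarith
  have hMΓ : 6 * Γ ^ 3 ≤ M := by linarith
  have hMY : Y ≤ M ^ (2 * s) := by
    have h1 : (Y ^ (1 / (2 * s))) ^ (2 * s) ≤ M ^ (2 * s) :=
      Real.rpow_le_rpow hYr.le (by linarith) (by positivity)
    rwa [← Real.rpow_mul hY0.le, one_div_mul_cancel (by positivity), Real.rpow_one] at h1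
  -- `δ₀ = 1` suffices, because smallness of `δ` is used only to obtain `α ≤ λ`.
  refine ⟨M, 1, by linarith, one_pos, le_rfl, ?_⟩
  intro V α δ lam c σ w hV hVα hδ hδ1 hlam hc hcl hσ hw
  have hα1 : 1 ≤ α := by
    by_contra! hlt
    have h1 : ENNReal.ofReal M ≤ ENNReal.ofReal α :=
      (le_mul_of_one_le_right zero_le le_self_add).trans hVα
    have h2 := lt_of_lt_of_le hlt hM1
    exact absurd h1 (not_le.2 ((ENNReal.ofReal_lt_ofReal_iff (by linarith)).2 h2))
  have hα0 : 0 < α := by linarith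
  have hαl : α ≤ lam := by
    rw [hlam, le_div_iff₀ (by positivity)]
    exact mul_le_of_le_one_right hα0.le (pow_le_one₀ hδ.le hδ1.le)
  have hlam0 : 0 < lam := by linarith
  have hB : 1 / lam ≤ 1 := by rw [div_le_one hlam0]; linarith
  obtain ⟨N, hN, hVN, hNα⟩ := ThinCarleman.exists_potentialBound hs0 (by linarith) hB hVα
  have hN0 : 0 < N := by linarith
  have hYN : Y * N ≤ α ^ (2 * s) :=
    calc Y * N ≤ M ^ (2 * s) * N := by gcongr
      _ = (M * N ^ (1 / (2 * s))) ^ (2 * s) := by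
        rw [Real.mul_rpow (by linarith) (by positivity), ← Real.rpow_mul hN0.le,
          one_div_mul_cancel (by positivity), Real.rpow_one]
      _ ≤ α ^ (2 * s) := by
        have : 0 ≤ M * N ^ (1 / (2 * s)) := by positivity
        refine Real.rpow_le_rpow this ?_ (by positivity)
        linarith
  have hbd' := hbd lam σ hlam0 hσ
  have hcI : c ∈ Ioo 0 (1 / lam) :=
    ⟨hc, hcl.trans_lt (one_div_lt_one_div_of_lt hlam0 (by linarith))⟩
  obtain ⟨h1, h2, h3, h4, h5⟩ := ThinCarleman.carleman_of_bounds hs ha hα1 hαl hΓ hK hσ hbd' hN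
    hVN hV hYN hc hcl hw
  refine ⟨h1, h2, h3, h4, fun hI => ?_⟩
  have hσc : 0 < σ c := hσ.pos c hcI
  obtain ⟨hm₁, hm₂⟩ := ThinCarleman.multCoeff_bounds (α := α) hΓ hc hσc
    (hbd' c hcI).1 (hbd' c hcI).2.1
  have hup : MeasurableSet (ThinCarleman.upperHalf n) :=
    measurableSet_lt measurable_const measurable_snd
  refine ThinCarleman.carleman_scale hΓ hMΓ hα0.le hc (by positivity) ?_ ?_ ?_ hm₁ hm₂ (h5 hI)
  · refine setIntegral_nonneg (hup.prod measurableSet_Ici) fun p hp => ?_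
    have hy : 0 < p.1.2 := hp.1
    have ht : 0 < p.2 := hc.trans_le hp.2
    obtain ⟨T, hT, hsupp⟩ := hw.support
    have hS : ThinCarleman.SupportedBy T w := fun q hy ht hne => hsupp q ⟨le_of_lt hy, ht⟩ hne
    -- The sign of `σ` is known only before `1/λ`. Where the operator does not vanish, `t` lies in
    -- the support of `w` and so before that time.
    by_cases h0 : ThinCarleman.extOp a w p = 0
    · simp [h0]
    have hpT : p.2 ≤ T := (hS.extOp p hy ht h0).2
    have hσp : 0 < σ p.2 := by
      refine hσ.pos _ ⟨ht, (hpT.trans_lt hT).trans_le ?_⟩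
      have he : 1 < Real.exp 1 := Real.one_lt_exp_iff.2 one_pos
      exact one_div_le_one_div_of_le hlam0 (le_mul_of_one_le_left hlam0.le he.le)
    unfold ThinCarleman.gauss
    positivity
  · refine setIntegral_nonneg hup fun X hX => ?_
    have hy : 0 < X.2 := hX
    have := ThinCarleman.gradSq_nonneg w (X, c)
    unfold ThinCarleman.gauss
    positivity
  · refine setIntegral_nonneg hup fun X hX => ?_
    have hy : 0 < X.2 := hX
    unfold ThinCarleman.gauss
    positivity
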